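/- **Setting.** Let $V$ be a finite-dimensional real vector space and $\Delta$ a (not necessarily rational) fan in $V$: a finite set of strictly convex polyhedral cones, closed under taking faces, any two of which meet in a common face. For $\sigma\in\Delta$ let $V_\sigma$ be its linear span and $A_\sigma=S(V_\sigma^*)$, graded so that $V_\sigma^*$ has degree $2$. A sheaf of graded modules $\mathcal F$ on $\Delta$ (open sets are the subfans) consists of $\mathbb Z$-graded $A_\sigma$-modules $F_\sigma$ and functorial restrictions $F_\sigma\to F_\tau$ ($\tau\le\sigma$) that are homogeneous of degree $0$ and linear over $A_\sigma\to A_\tau$; its sections over a subfan are the compatible families. It is *perverse* if it is flabby and each $F_\sigma$ is a finitely generated free $A_\sigma$-module. Let $F_{(\sigma,\partial\sigma)}\subset F_\sigma$ be the submodule of sections that vanish on all proper faces of $\sigma$. **Dual sheaf.** Fix an orientation of every $V_\sigma$. For perverse $\mathcal F$ put $(D\mathcal F)_\sigma=\operatorname{Hom}_{A_\sigma}(F_{(\sigma,\partial\sigma)},A_\sigma)\otimes_{\mathbb R}\det V_\sigma^*$, with $\det V_\sigma^*$ in degree $2\dim\sigma$. For a facet $\tau$ of $\sigma$ let $h\in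 V_\sigma^*$ have kernel $V_\tau$; the restriction map is $\varepsilon^\sigma_\tau\cdot(\varphi_h\otimes\psi_h)$, where $\varphi_h(f)(g)=f(h\hat g)|_\tau$ with $\hat g\in F_\sigma$ any element with $\hat g|_\tau=g$ that vanishes on all proper faces of $\sigma$ other than $\tau$, $\psi_h(h\wedge\eta)=\eta|_{V_\tau}$, and $\varepsilon^\sigma_\tau=\pm1$ compares the orientation of $\tau$ with the one induced from $\sigma$ (by $h\wedge\eta\mapsto\eta|_{V_\tau}$ for $h\ge 0$ on $\sigma$). This map does not depend on $h$ and $\hat g$. For arbitrary faces one composes along a chain of facets. A homomorphism $\phi:\mathcal F\to\mathcal G$ of sheaves of graded modules (of degree $0$) induces $D\phi: D\mathcal G\to D\mathcal F$, $f\otimes\omega\mapsto (f\circ\phi)\otimes\omega$. **Theorem.** For every perverse sheaf $\mathcal F$ on $\Delta$ the dual $D\mathcal F$ is a perverse sheaf, so that $D(D\mathcal F)$ is defined and perverse, and there are isomorphisms of sheaves of graded modules $$\beta_{\mathcal F}:\mathcal F\longrightarrow D(D\mathcal F)$$ that are natural: $D(D\phi)\circ\beta_{\mathcal F}=\beta_{\mathcal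 G}\circ\phi$ for every homomorphism $\phi:\mathcal F\to\mathcal G$ of perverse sheaves. On each cone $\sigma$, $\beta_{\mathcal F}$ is the biduality isomorphism of the free module $F_\sigma$: for every $0\ne\omega\in\det V_\sigma^*$ the map $e_\omega:\operatorname{Hom}_{A_\sigma}(F_\sigma,A_\sigma)\to(D\mathcal F)_{(\sigma,\partial\sigma)}$, $\psi\mapsto\psi|_{F_{(\sigma,\partial\sigma)}}\otimes\omega$, is well defined and an isomorphism of $A_\sigma$-modules, and $$\beta_{\mathcal F}(x)=\bigl(y\mapsto (e_\omega^{-1}y)(x)\bigr)\otimes\omega\qquad(x\in F_\sigma).$$ -/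

import Mathlib

open scoped TensorProduct

universe u w

noncomputable section

namespace FanSheaf

/-! ### Fans and their polynomial algebras -/

/-- A fan in a real vector space: a finite set of strictly convex polyhedral cones, closed under
taking faces, any two of which intersect in a common face. Cones are not assumed rational. -/
structure Fan (V : Type u) [AddCommGroup V] [Module ℝ V] where
  cones : Set (PointedCone ℝ V)
  finite : cones.Finite
  polyhedral : ∀ σ ∈ cones, Submodule.FG σ
  strictlyConvex : ∀ σ ∈ cones, ∀ x ∈ σ, -x ∈ σ → x = 0
  face_mem : ∀ σ ∈ cones, ∀ τ : PointedCone ℝ V, τ.IsFaceOf σ → τ ∈ cones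
  inter_isFaceOf : ∀ σ ∈ cones, ∀ τ ∈ cones, (σ ⊓ τ).IsFaceOf σ

/-- The cones of a fan, ordered by inclusion. By the intersection axiom `τ ≤ σ` holds exactly
when `τ` is a face of `σ`, see `Cone.le_iff_isFaceOf`. -/
abbrev Cone {V : Type u} [AddCommGroup V] [Module ℝ V] (Δ : Fan V) : Type u :=
  {σ : PointedCone ℝ V // σ ∈ Δ.cones}

variable {V : Type u} [AddCommGroup V] [Module ℝ V] {Δ : Fan V}

theorem Cone.le_iff_isFaceOf (τ σ : Cone Δ) : τ ≤ σ ↔ τ.1.IsFaceOf σ.1 := by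
  constructor
  · intro h
    have := Δ.inter_isFaceOf σ.1 σ.2 τ.1 τ.2
    rwa [inf_eq_right.mpr (show τ.1 ≤ σ.1 from h)] at this
  · exact fun h => h.le

/-- The linear span `V_σ` of a cone. -/
def lin (σ : Cone Δ) : Submodule ℝ V := Submodule.span ℝ (σ.1 : Set V)

theorem lin_mono {σ τ : Cone Δ} (h : τ ≤ σ) : lin τ ≤ lin σ :=
  Submodule.span_mono (show (τ.1 : Set V) ⊆ σ.1 from h)

/-- The dimension of a cone. -/
def dim (σ : Cone Δ) : ℕ := Module.finrank ℝ (lin σ)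

/-- The algebra `A_σ = S(V_σ^*)` of polynomial functions on `V_σ`. -/
abbrev A (σ : Cone Δ) : Type u := SymmetricAlgebra ℝ (Module.Dual ℝ (lin σ))

/-- A linear form on `V_σ`, as an element of `A_σ`. -/
abbrev form (σ : Cone Δ) : Module.Dual ℝ (lin σ) →ₗ[ℝ] A σ := SymmetricAlgebra.ι ℝ _

/-- The grading of `A_σ` in which linear forms have degree `2`: the component of degree `2 d`
consists of the sums of products of `d` linear forms, and the other components vanish. -/
def gradeA (σ : Cone Δ) (q : ℤ) : Submodule ℝ (A σ) :=
  ⨆ (d : ℕ) (_ : 2 * (d : ℤ) = q), LinearMap.range (form σ) ^ d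

/-- Restriction of linear forms to a face. -/
def restrictForm {σ τ : Cone Δ} (h : τ ≤ σ) :
    Module.Dual ℝ (lin σ) →ₗ[ℝ] Module.Dual ℝ (lin τ) :=
  (Submodule.inclusion (lin_mono h)).dualMap

/-- Restriction `A_σ → A_τ` of polynomial functions to a face. -/
def restrict {σ τ : Cone Δ} (h : τ ≤ σ) : A σ →ₐ[ℝ] A τ :=
  SymmetricAlgebra.lift (form τ ∘ₗ restrictForm h)

theorem restrict_form {σ τ : Cone Δ} (h : τ ≤ σ) (l : Module.Dual ℝ (lin σ)) :
    restrict h (form σ l) = form τ (restrictForm h l) := by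
  simp [restrict]

theorem restrict_surjective {σ τ : Cone Δ} (h : τ ≤ σ) :
    Function.Surjective (restrict h) := by
  intro a
  induction a using SymmetricAlgebra.induction with
  | algebraMap r => exact ⟨algebraMap ℝ _ r, by simp⟩
  | ι x =>
    obtain ⟨l, hl⟩ := LinearMap.dualMap_surjective_of_injective
      (f := Submodule.inclusion (lin_mono h)) (Submodule.inclusion_injective _) x
    refine ⟨form σ l, ?_⟩
    rw [restrict_form]
    exact congrArg _ hl
  | mul a b ha hb =>
    obtain ⟨x, rfl⟩ := ha
    obtain ⟨y, rfl⟩ := hb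
    exact ⟨x * y, by simp⟩
  | add a b ha hb =>
    obtain ⟨x, rfl⟩ := ha
    obtain ⟨y, rfl⟩ := hb
    exact ⟨x + y, by simp⟩

theorem restrict_comp {σ τ γ : Cone Δ} (h : τ ≤ σ) (h' : γ ≤ τ) (a : A σ) :
    restrict h' (restrict h a) = restrict (h'.trans h) a := by
  have : (restrict h').comp (restrict h) = restrict (h'.trans h) := by
    apply SymmetricAlgebra.algHom_ext
    ext l
    change restrict h' (restrict h (form σ l)) = restrict (h'.trans h) (form σ l)
    rw [restrict_form, restrict_form, restrict_form]
    rfl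
  exact DFunLike.congr_fun this a

theorem restrict_refl (σ : Cone Δ) (a : A σ) : restrict (le_refl σ) a = a := by
  have : restrict (le_refl σ) = AlgHom.id ℝ (A σ) := by
    apply SymmetricAlgebra.algHom_ext
    ext l
    change restrict (le_refl σ) (form σ l) = form σ l
    rw [restrict_form]
    rfl
  exact DFunLike.congr_fun this a

/-! ### Sheaves on the fan space -/

/-- A family of graded `A_σ`-modules `F_σ`, indexed by the cones of the fan, with restriction
homomorphisms `F_σ → F_τ` for the faces `τ ≤ σ`. The remaining axioms of a sheaf of graded
modules are collected in `IsSheaf`. -/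
structure GradedSystem (Δ : Fan V) where
  obj : Cone Δ → Type (max u w)
  [addCommGroup : ∀ σ, AddCommGroup (obj σ)]
  [module : ∀ σ, Module (A σ) (obj σ)]
  grade : ∀ σ, ℤ → AddSubgroup (obj σ)
  res : ∀ {σ τ : Cone Δ}, τ ≤ σ → obj σ →+ obj τ
  res_smul : ∀ {σ τ : Cone Δ} (h : τ ≤ σ) (a : A σ) (x : obj σ),
    res h (a • x) = restrict h a • res h x

attribute [instance] GradedSystem.addCommGroup GradedSystem.module

/-- The system defines a sheaf of graded modules over the sheaf `σ ↦ A_σ` of graded algebras. -/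
structure IsSheaf (F : GradedSystem.{u, w} Δ) : Prop where
  isInternal : ∀ σ, DirectSum.IsInternal (F.grade σ)
  smul_mem : ∀ σ (i j : ℤ) (a : A σ) (x : F.obj σ),
    a ∈ gradeA σ i → x ∈ F.grade σ j → a • x ∈ F.grade σ (i + j)
  res_mem : ∀ {σ τ : Cone Δ} (h : τ ≤ σ) (i : ℤ) (x : F.obj σ),
    x ∈ F.grade σ i → F.res h x ∈ F.grade τ i
  res_refl : ∀ σ (x : F.obj σ), F.res (le_refl σ) x = x
  res_comp : ∀ {σ τ γ : Cone Δ} (h : τ ≤ σ) (h' : γ ≤ τ) (x : F.obj σ),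
    F.res h' (F.res h x) = F.res (h'.trans h) x

/-- The sections over a subfan `Λ` (an open subset of the fan space): compatible families. -/
structure Section (F : GradedSystem.{u, w} Δ) (Λ : LowerSet (Cone Δ)) where
  val : ∀ σ ∈ Λ, F.obj σ
  compatible : ∀ (σ τ : Cone Δ) (hσ : σ ∈ Λ) (hτ : τ ∈ Λ) (h : τ ≤ σ),
    F.res h (val σ hσ) = val τ hτ

/-- The sheaf is flabby: every section over a subfan extends to a section over the fan. -/
def IsFlabby (F : GradedSystem.{u, w} Δ) : Prop :=
  ∀ (Λ : LowerSet (Cone Δ)) (s : Section F Λ), ∃ t : Section F ⊤,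
    ∀ (σ : Cone Δ) (hσ : σ ∈ Λ), t.val σ (LowerSet.mem_top) = s.val σ hσ

/-- A perverse sheaf: a flabby sheaf of graded modules with finitely generated free `F_σ`. -/
structure IsPerverse (F : GradedSystem.{u, w} Δ) : Prop where
  isSheaf : IsSheaf F
  isFlabby : IsFlabby F
  finite : ∀ σ, Module.Finite (A σ) (F.obj σ)
  free : ∀ σ, Module.Free (A σ) (F.obj σ)

/-- Perverse sheaves on a fan. -/
structure PerverseSheaf (Δ : Fan V) extends GradedSystem.{u, w} Δ where
  isPerverse : IsPerverse toGradedSystem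

/-- Homomorphisms of sheaves of graded modules: families of linear maps of degree `0` that are
compatible with the restrictions. -/
structure Hom (F G : GradedSystem.{u, w} Δ) where
  app : ∀ σ, F.obj σ →ₗ[A σ] G.obj σ
  app_mem : ∀ σ (i : ℤ) (x : F.obj σ), x ∈ F.grade σ i → app σ x ∈ G.grade σ i
  app_res : ∀ {σ τ : Cone Δ} (h : τ ≤ σ) (x : F.obj σ),
    app τ (F.res h x) = G.res h (app σ x)

/-- Isomorphisms of sheaves of graded modules. -/
structure Iso (F G : GradedSystem.{u, w} Δ) where
  hom : Hom F G
  inv : Hom G F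
  inv_hom : ∀ σ (x : F.obj σ), inv.app σ (hom.app σ x) = x
  hom_inv : ∀ σ (y : G.obj σ), hom.app σ (inv.app σ y) = y

/-- The module `F_(σ,∂σ)` of sections over `σ` that vanish on the boundary fan `∂σ`, whose cones
are the proper faces of `σ`. -/
def rel (F : GradedSystem.{u, w} Δ) (σ : Cone Δ) : Submodule (A σ) (F.obj σ) where
  carrier := {x | ∀ (τ : Cone Δ) (h : τ < σ), F.res h.le x = 0}
  zero_mem' := by intro τ h; simp
  add_mem' := by
    intro x y hx hy τ h
    rw [map_add, hx τ h, hy τ h, add_zero]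
  smul_mem' := by
    intro a x hx τ h
    rw [F.res_smul, hx τ h, smul_zero]

theorem mem_rel {F : GradedSystem.{u, w} Δ} {σ : Cone Δ} {x : F.obj σ} :
    x ∈ rel F σ ↔ ∀ (τ : Cone Δ) (h : τ < σ), F.res h.le x = 0 := Iff.rfl

/-- A sheaf homomorphism restricts to `F_(σ,∂σ) → G_(σ,∂σ)`. -/
def Hom.relMap {F G : GradedSystem.{u, w} Δ} (φ : Hom F G) (σ : Cone Δ) :
    rel F σ →ₗ[A σ] rel G σ :=
  (φ.app σ).restrict (by
    intro x hx τ h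
    rw [← φ.app_res, hx τ h, map_zero])

/-! ### Facets -/

/-- `τ` is a facet of `σ`: a face of dimension one less. -/
structure IsFacet (τ σ : Cone Δ) : Prop where
  le : τ ≤ σ
  dim_eq : dim τ + 1 = dim σ

/-- A linear form on `V_σ` with kernel `V_τ`. -/
def IsFacetForm (τ σ : Cone Δ) (h : Module.Dual ℝ (lin σ)) : Prop :=
  LinearMap.ker h = (lin τ).comap (lin σ).subtype

theorem mem_of_mem_lin {τ σ : Cone Δ} (hτσ : τ ≤ σ) {x : V} (hx : x ∈ σ.1) (hx' : x ∈ lin τ) :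
    x ∈ τ.1 := by
  have hface := (Cone.le_iff_isFaceOf τ σ).1 hτσ
  have key : ∀ y ∈ lin τ, ∃ a ∈ τ.1, ∃ b ∈ τ.1, y + b = a := by
    intro y hy
    refine Submodule.span_induction (p := fun y _ => ∃ a ∈ τ.1, ∃ b ∈ τ.1, y + b = a)
      ?_ ?_ ?_ ?_ hy
    · intro y hy
      exact ⟨y, hy, 0, τ.1.zero_mem, by simp⟩
    · exact ⟨0, τ.1.zero_mem, 0, τ.1.zero_mem, by simp⟩
    · rintro y z - - ⟨a, ha, b, hb, rfl⟩ ⟨c, hc, d, hd, rfl⟩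
      exact ⟨_, τ.1.add_mem ha hc, _, τ.1.add_mem hb hd, by abel⟩
    · rintro r y - ⟨a, ha, b, hb, rfl⟩
      rcases le_total 0 r with hr | hr
      · exact ⟨_, τ.1.smul_mem hr ha, _,
          τ.1.smul_mem hr hb, (smul_add r y b).symm⟩
      · have hr' : 0 ≤ -r := by linarith
        refine ⟨_, τ.1.smul_mem hr' hb, _,
          τ.1.smul_mem hr' ha, ?_⟩
        change r • y + (-r) • (y + b) = (-r) • b
        module
  obtain ⟨a, ha, b, hb, hab⟩ := key x hx'
  refine hface.mem_of_smul_add_mem (a := 1) hx (hτσ hb) one_pos ?_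
  rw [one_smul, hab]
  exact ha

theorem lin_ne_of_lt {τ σ : Cone Δ} (h : τ < σ) : lin τ ≠ lin σ := by
  intro he
  refine h.not_ge ?_
  intro x hx
  exact mem_of_mem_lin h.le hx (he ▸ Submodule.subset_span hx)

theorem dim_lt_of_lt [FiniteDimensional ℝ V] {τ σ : Cone Δ} (h : τ < σ) : dim τ < dim σ :=
  Submodule.finrank_lt_finrank_of_lt (lt_of_le_of_ne (lin_mono h.le) (lin_ne_of_lt h))

theorem IsFacet.lt {τ σ : Cone Δ} (h : IsFacet τ σ) : τ < σ := by
  refine lt_of_le_of_ne h.le ?_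
  rintro rfl
  have := h.dim_eq
  omega

theorem IsFacet.eq_of_le_of_lt [FiniteDimensional ℝ V] {τ σ γ : Cone Δ} (h : IsFacet τ σ)
    (h1 : τ ≤ γ) (h2 : γ < σ) : γ = τ := by
  by_contra hne
  have h3 := dim_lt_of_lt (lt_of_le_of_ne h1 (Ne.symm hne))
  have h4 := dim_lt_of_lt h2
  have := h.dim_eq
  omega

theorem exists_facetForm [FiniteDimensional ℝ V] {τ σ : Cone Δ} (hf : IsFacet τ σ) :
    ∃ h : Module.Dual ℝ (lin σ), IsFacetForm τ σ h ∧
      ∀ (x : V) (hx : x ∈ σ.1), 0 ≤ h ⟨x, Submodule.subset_span hx⟩ := by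
  set W : Submodule ℝ (lin σ) := (lin τ).comap (lin σ).subtype with hW
  have hWdim : Module.finrank ℝ W = dim τ :=
    (Submodule.comapSubtypeEquivOfLe (lin_mono hf.le)).finrank_eq
  have hlt : Module.finrank ℝ W < Module.finrank ℝ (lin σ) := by
    have := hf.dim_eq
    unfold dim at *
    omega
  have hne : W ≠ ⊤ := by
    intro h
    rw [h, finrank_top] at hlt
    exact lt_irrefl _ hlt
  obtain ⟨l, hl0, hl⟩ := Submodule.exists_le_ker_of_lt_top W (lt_top_iff_ne_top.2 hne)
  have hker : W = LinearMap.ker l := by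
    apply Submodule.eq_of_le_of_finrank_le hl
    have h1 := LinearMap.finrank_range_add_finrank_ker l
    have h2 : 1 ≤ Module.finrank ℝ (LinearMap.range l) := by
      rw [Nat.one_le_iff_ne_zero]
      intro h0
      exact hl0 (LinearMap.range_eq_bot.1 (Submodule.finrank_eq_zero.1 h0))
    have := hf.dim_eq
    unfold dim at *
    omega
  have hface := (Cone.le_iff_isFaceOf τ σ).1 hf.le
  have key : ∀ (x : V) (hx : x ∈ σ.1) (y : V) (hy : y ∈ σ.1),
      0 < l ⟨x, Submodule.subset_span hx⟩ → l ⟨y, Submodule.subset_span hy⟩ < 0 → False := by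
    intro x hx y hy hlx hly
    set x' : lin σ := ⟨x, Submodule.subset_span hx⟩
    set y' : lin σ := ⟨y, Submodule.subset_span hy⟩
    have hz : (-(l y')) • x' + (l x') • y' ∈ W := by
      rw [hker, LinearMap.mem_ker, map_add, map_smul, map_smul, smul_eq_mul, smul_eq_mul]
      ring
    have hzlin : (-(l y')) • x + (l x') • y ∈ lin τ := hz
    have hpos : 0 < -(l y') := by linarith
    have hzσ : (-(l y')) • x + (l x') • y ∈ σ.1 :=
      σ.1.add_mem (σ.1.smul_mem hpos.le hx)
        (σ.1.smul_mem hlx.le hy)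
    have hxτ : x ∈ τ.1 := hface.mem_of_smul_add_smul_mem_left hx hy hpos hlx
      (mem_of_mem_lin hf.le hzσ hzlin)
    have hxW : x' ∈ W := Submodule.subset_span (s := (τ.1 : Set V)) hxτ
    rw [hker, LinearMap.mem_ker] at hxW
    linarith
  by_cases hcase : ∃ (x : V) (hx : x ∈ σ.1), 0 < l ⟨x, Submodule.subset_span hx⟩
  · obtain ⟨x, hx, hlx⟩ := hcase
    refine ⟨l, hker.symm, fun y hy => ?_⟩
    by_contra hy'
    exact key x hx y hy hlx (not_le.1 hy')
  · push Not at hcase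
    refine ⟨-l, ?_, fun y hy => ?_⟩
    · unfold IsFacetForm
      rw [← hW, hker]
      ext z
      simp
    · have := hcase y hy
      simpa using this

/-- A linear form on `V_σ` with kernel `V_τ` that is nonnegative on `σ`, for a facet `τ`. -/
def facetForm [FiniteDimensional ℝ V] {τ σ : Cone Δ} (hf : IsFacet τ σ) :
    Module.Dual ℝ (lin σ) := (exists_facetForm hf).choose

theorem facetForm_spec [FiniteDimensional ℝ V] {τ σ : Cone Δ} (hf : IsFacet τ σ) :
    IsFacetForm τ σ (facetForm hf) := (exists_facetForm hf).choose_spec.1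

theorem facetForm_nonneg [FiniteDimensional ℝ V] {τ σ : Cone Δ} (hf : IsFacet τ σ) (x : V)
    (hx : x ∈ σ.1) : 0 ≤ facetForm hf ⟨x, Submodule.subset_span hx⟩ :=
  (exists_facetForm hf).choose_spec.2 x hx

theorem IsFacetForm.restrict_eq_zero {τ σ : Cone Δ} {h : Module.Dual ℝ (lin σ)}
    (hh : IsFacetForm τ σ h) (hle : τ ≤ σ) : restrict hle (form σ h) = 0 := by
  rw [restrict_form]
  have : restrictForm hle h = 0 := by
    ext x
    have hx : Submodule.inclusion (lin_mono hle) x ∈ LinearMap.ker h := by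
      rw [hh]
      exact x.2
    exact hx
  rw [this, map_zero]

theorem IsFacetForm.exists_eq_one {τ σ : Cone Δ} (hf : IsFacet τ σ)
    {h : Module.Dual ℝ (lin σ)} (hh : IsFacetForm τ σ h) : ∃ v : lin σ, h v = 1 := by
  have hne : ∃ v, h v ≠ 0 := by
    by_contra hcon
    push Not at hcon
    have h0 : LinearMap.ker h = ⊤ := by
      ext v
      simp [hcon v]
    refine lin_ne_of_lt hf.lt (le_antisymm (lin_mono hf.le) ?_)
    intro x hx
    have : (⟨x, hx⟩ : lin σ) ∈ LinearMap.ker h := by rw [h0]; trivial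
    rw [hh] at this
    exact this
  obtain ⟨v, hv⟩ := hne
  exact ⟨(h v)⁻¹ • v, by rw [map_smul, smul_eq_mul, inv_mul_cancel₀ hv]⟩

/-! ### Determinant lines and orientations -/

/-- The determinant line `det V_σ^*`: the alternating forms of top degree on `V_σ`. -/
abbrev Det (σ : Cone Δ) : Type u := (lin σ) [⋀^Fin (dim σ)]→ₗ[ℝ] ℝ

/-- Contraction of a top form on `V_σ` with a vector, restricted to `V_τ`. -/
def contract {τ σ : Cone Δ} (hf : IsFacet τ σ) (v : lin σ) : Det σ →ₗ[ℝ] Det τ where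
  toFun ω := ((ω.domDomCongr (finCongr hf.dim_eq.symm)).curryLeft v).compLinearMap
    (Submodule.inclusion (lin_mono hf.le))
  map_add' _ _ := rfl
  map_smul' _ _ := rfl

/-- The map `ψ_h : det V_σ^* → det V_τ^*` sending `h ∧ η` to the restriction of `η`. It is the
contraction with any vector `v` such that `h v = 1`, since
`(h ∧ η) (v, u₁, …, uₖ) = h v * η (u₁, …, uₖ)` for `uᵢ` in `V_τ = ker h`. -/
def psi {τ σ : Cone Δ} (hf : IsFacet τ σ) (h : Module.Dual ℝ (lin σ))
    (hh : IsFacetForm τ σ h) : Det σ →ₗ[ℝ] Det τ :=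
  contract hf (hh.exists_eq_one hf).choose

/-- A choice of an orientation of `V_σ` for every cone. -/
abbrev Orientations (Δ : Fan V) : Type u :=
  ∀ σ : Cone Δ, Orientation ℝ (lin σ) (Fin (dim σ))

open Classical in
/-- The transition coefficient `ε = ±1`: it is `1` if the given orientation of `σ` induces the
given orientation of the facet `τ`, via `h ∧ η ↦ η` for `h ≥ 0` on `σ`, and `-1` otherwise. -/
def transition [FiniteDimensional ℝ V] (o : Orientations Δ) {τ σ : Cone Δ}
    (hf : IsFacet τ σ) : ℤ :=
  if ∃ (ω : Det σ) (hω : ω ≠ 0) (hη : psi hf (facetForm hf) (facetForm_spec hf) ω ≠ 0),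
      rayOfNeZero ℝ ω hω = o σ ∧ rayOfNeZero ℝ _ hη = o τ
  then 1 else -1

/-! ### The dual sheaf -/

/-- `x` in `F_σ` extends the trivial extension to `∂σ` of the section `g` over the facet `τ`. -/
structure IsExt (F : GradedSystem.{u, w} Δ) {τ σ : Cone Δ} (hf : IsFacet τ σ) (g : F.obj τ)
    (x : F.obj σ) : Prop where
  res_eq : F.res hf.le x = g
  res_eq_zero : ∀ (γ : Cone Δ) (h : γ < σ), γ ≠ τ → F.res h.le x = 0

section Phi

variable {F : PerverseSheaf.{u, w} Δ} {τ σ : Cone Δ} {hf : IsFacet τ σ}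

theorem IsExt.smul_mem_rel {h : Module.Dual ℝ (lin σ)} (hh : IsFacetForm τ σ h)
    {g : F.obj τ} {x : F.obj σ} (hx : IsExt F.toGradedSystem hf g x) :
    form σ h • x ∈ rel F.toGradedSystem σ := by
  intro γ hγ
  rw [F.res_smul]
  by_cases e : γ = τ
  · subst e
    rw [hh.restrict_eq_zero, zero_smul]
  · rw [hx.res_eq_zero γ hγ e, smul_zero]

theorem IsExt.restrict_eq {h : Module.Dual ℝ (lin σ)} (hh : IsFacetForm τ σ h)
    (f : rel F.toGradedSystem σ →ₗ[A σ] A σ) {g : F.obj τ} {x y : F.obj σ}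
    (hx : IsExt F.toGradedSystem hf g x) (hy : IsExt F.toGradedSystem hf g y) :
    restrict hf.le (f ⟨_, hx.smul_mem_rel hh⟩) = restrict hf.le (f ⟨_, hy.smul_mem_rel hh⟩) := by
  have hk : x - y ∈ rel F.toGradedSystem σ := by
    intro γ hγ
    rw [map_sub]
    by_cases e : γ = τ
    · subst e
      rw [hx.res_eq, hy.res_eq, sub_self]
    · rw [hx.res_eq_zero γ hγ e, hy.res_eq_zero γ hγ e, sub_self]
  have hs : (⟨_, hx.smul_mem_rel hh⟩ : rel F.toGradedSystem σ) =
      ⟨_, hy.smul_mem_rel hh⟩ + form σ h • (⟨x - y, hk⟩ : rel F.toGradedSystem σ) := by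
    apply Subtype.ext
    change form σ h • x = form σ h • y + form σ h • (x - y)
    rw [smul_sub]
    abel
  rw [hs, map_add, map_smul, map_add, smul_eq_mul, map_mul, hh.restrict_eq_zero, zero_mul,
    add_zero]

variable [FiniteDimensional ℝ V] (F) (hf)

theorem exists_isExt (g : rel F.toGradedSystem τ) :
    ∃ x, IsExt F.toGradedSystem hf g.1 x := by
  classical
  let s : Section F.toGradedSystem (LowerSet.Iio σ) :=
    { val := fun γ _ => if e : γ = τ then e ▸ g.1 else 0
      compatible := by
        intro γ δ hγ hδ hle
        by_cases e1 : γ = τ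
        · subst e1
          by_cases e2 : δ = γ
          · subst e2
            simpa using F.isPerverse.isSheaf.res_refl _ _
          · simpa [e2] using g.2 δ (lt_of_le_of_ne hle e2)
        · by_cases e2 : δ = τ
          · subst e2
            exact absurd (hf.eq_of_le_of_lt hle hγ) e1
          · simp [e1, e2] }
  obtain ⟨t, ht⟩ := F.isPerverse.isFlabby _ s
  refine ⟨t.val σ LowerSet.mem_top, ?_, ?_⟩
  · rw [t.compatible σ τ LowerSet.mem_top LowerSet.mem_top hf.le, ht τ hf.lt]
    simp [s]
  · intro γ h hne
    rw [t.compatible σ γ LowerSet.mem_top LowerSet.mem_top h.le, ht γ h]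
    simp [s, hne]

/-- The homomorphism `φ_h f : F_(τ,∂τ) → A_τ`: it sends `g` to `f (h ĝ)` restricted to `τ`, where
`ĝ` in `F_σ` extends the trivial extension of `g` to `∂σ`. -/
def phiApply (h : Module.Dual ℝ (lin σ)) (hh : IsFacetForm τ σ h)
    (f : rel F.toGradedSystem σ →ₗ[A σ] A σ) : rel F.toGradedSystem τ →ₗ[A τ] A τ where
  toFun g := restrict hf.le (f ⟨_, (exists_isExt F hf g).choose_spec.smul_mem_rel hh⟩)
  map_add' g g' := by
    have h1 := (exists_isExt F hf g).choose_spec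
    have h2 := (exists_isExt F hf g').choose_spec
    have h3 : IsExt F.toGradedSystem hf (g + g').1
        ((exists_isExt F hf g).choose + (exists_isExt F hf g').choose) :=
      ⟨by rw [map_add, h1.res_eq, h2.res_eq]; rfl, fun γ hγ hne => by
        rw [map_add, h1.res_eq_zero γ hγ hne, h2.res_eq_zero γ hγ hne, add_zero]⟩
    rw [IsExt.restrict_eq hh f (exists_isExt F hf (g + g')).choose_spec h3, ← map_add, ← map_add]
    congr 2
    exact Subtype.ext (smul_add _ _ _)
  map_smul' a g := by
    obtain ⟨b, rfl⟩ := restrict_surjective hf.le a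
    have h1 := (exists_isExt F hf g).choose_spec
    have h3 : IsExt F.toGradedSystem hf (restrict hf.le b • g).1
        (b • (exists_isExt F hf g).choose) :=
      ⟨by rw [F.res_smul, h1.res_eq]; rfl, fun γ hγ hne => by
        rw [F.res_smul, h1.res_eq_zero γ hγ hne, smul_zero]⟩
    rw [IsExt.restrict_eq hh f (exists_isExt F hf (restrict hf.le b • g)).choose_spec h3,
      RingHom.id_apply, smul_eq_mul, ← map_mul, ← smul_eq_mul, ← map_smul]
    congr 2
    exact Subtype.ext (smul_comm _ _ _)

theorem phiApply_eq (h : Module.Dual ℝ (lin σ)) (hh : IsFacetForm τ σ h)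
    (f : rel F.toGradedSystem σ →ₗ[A σ] A σ) (g : rel F.toGradedSystem τ) {x : F.obj σ}
    (hx : IsExt F.toGradedSystem hf g.1 x) :
    phiApply F hf h hh f g = restrict hf.le (f ⟨_, hx.smul_mem_rel hh⟩) :=
  IsExt.restrict_eq hh f (exists_isExt F hf g).choose_spec hx

/-- The map `φ_h : Hom (F_(σ,∂σ), A_σ) → Hom (F_(τ,∂τ), A_τ)`. -/
def phi (h : Module.Dual ℝ (lin σ)) (hh : IsFacetForm τ σ h) :
    (rel F.toGradedSystem σ →ₗ[A σ] A σ) →ₗ[ℝ] (rel F.toGradedSystem τ →ₗ[A τ] A τ) where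
  toFun f := phiApply F hf h hh f
  map_add' f f' := by
    ext g
    exact map_add (restrict hf.le) _ _
  map_smul' r f := by
    ext g
    exact map_smul (restrict hf.le) _ _

end Phi

/-- The module `(DF)_σ = Hom (F_(σ,∂σ), A_σ) ⊗ det V_σ^*`. -/
abbrev DualObj (F : GradedSystem.{u, w} Δ) (σ : Cone Δ) : Type (max u w) :=
  (rel F σ →ₗ[A σ] A σ) ⊗[ℝ] Det σ

/-- The grading of `(DF)_σ`: a homomorphism of degree `j` tensored with a determinant form has
degree `j + 2 dim σ`. -/
def dualGrade (F : GradedSystem.{u, w} Δ) (σ : Cone Δ) (q : ℤ) : AddSubgroup (DualObj F σ) :=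
  AddSubgroup.closure {z | ∃ (f : rel F σ →ₗ[A σ] A σ) (ω : Det σ),
    (∀ (i : ℤ) (x : rel F σ), x.1 ∈ F.grade σ i → f x ∈ gradeA σ (i + (q - 2 * (dim σ : ℤ)))) ∧
    z = f ⊗ₜ[ℝ] ω}

/-- A descending chain of cones from `σ` to `τ`, each one a facet of the preceding one. -/
inductive FacetChain : Cone Δ → Cone Δ → Type u
  | nil (σ : Cone Δ) : FacetChain σ σ
  | cons {σ ρ τ : Cone Δ} (h : IsFacet ρ σ) (c : FacetChain ρ τ) : FacetChain σ τ

theorem FacetChain.le {σ τ : Cone Δ} (c : FacetChain σ τ) : τ ≤ σ := by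
  induction c with
  | nil σ => exact le_refl σ
  | cons h c ih => exact ih.trans h.le

section DualMap

variable {F G : GradedSystem.{u, w} Δ} (φ : Hom F G)

/-- The map `(DG)_σ → (DF)_σ`, `f ⊗ ω ↦ (f ∘ φ) ⊗ ω`, induced by `φ : F → G`. -/
def dualMapApp (σ : Cone Δ) :
    DualObj G σ →ₗ[A σ] DualObj F σ :=
  TensorProduct.AlgebraTensorModule.map
    (LinearMap.lcomp (A σ) (A σ) (φ.relMap σ)) (LinearMap.id : Det σ →ₗ[ℝ] Det σ)

theorem dualMapApp_tmul (σ : Cone Δ) (f : rel G σ →ₗ[A σ] A σ) (ω : Det σ) :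
    dualMapApp φ σ (f ⊗ₜ ω) = (f ∘ₗ φ.relMap σ) ⊗ₜ[ℝ] ω := rfl

theorem dualMapApp_mem (σ : Cone Δ) (q : ℤ) (z : DualObj G σ)
    (hz : z ∈ dualGrade G σ q) :
    dualMapApp φ σ z ∈ dualGrade F σ q := by
  unfold dualGrade at hz
  induction hz using AddSubgroup.closure_induction with
  | mem z hz =>
    obtain ⟨f, ω, hf, rfl⟩ := hz
    refine AddSubgroup.subset_closure ⟨f ∘ₗ φ.relMap σ, ω, ?_, rfl⟩
    intro i x hx
    exact hf i (φ.relMap σ x) (φ.app_mem σ i x.1 hx)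
  | zero => rw [map_zero]; exact AddSubgroup.zero_mem _
  | add x y _ _ hx hy => rw [map_add]; exact AddSubgroup.add_mem _ hx hy
  | neg x _ hx => rw [map_neg]; exact AddSubgroup.neg_mem _ hx

end DualMap

section Dual

variable [FiniteDimensional ℝ V]

/-- The restriction `(DF)_σ → (DF)_τ` to a facet: `ε • (φ_h ⊗ ψ_h)`, where `ε` is the transition
coefficient and `h` is a linear form with kernel `V_τ`. -/
def facetRes (o : Orientations Δ) (F : PerverseSheaf.{u, w} Δ) {τ σ : Cone Δ}
    (hf : IsFacet τ σ) : DualObj F.toGradedSystem σ →+ DualObj F.toGradedSystem τ :=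
  transition o hf • (TensorProduct.map (phi F hf (facetForm hf) (facetForm_spec hf))
    (psi hf (facetForm hf) (facetForm_spec hf))).toAddMonoidHom

theorem facetRes_tmul (o : Orientations Δ) (F : PerverseSheaf.{u, w} Δ) {τ σ : Cone Δ}
    (hf : IsFacet τ σ) (f : rel F.toGradedSystem σ →ₗ[A σ] A σ) (ω : Det σ) :
    facetRes o F hf (f ⊗ₜ ω) = transition o hf •
      (phi F hf (facetForm hf) (facetForm_spec hf) f ⊗ₜ[ℝ]
        psi hf (facetForm hf) (facetForm_spec hf) ω) := rfl

theorem facetRes_smul (o : Orientations Δ) (F : PerverseSheaf.{u, w} Δ) {τ σ : Cone Δ}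
    (hf : IsFacet τ σ) (a : A σ) (z : DualObj F.toGradedSystem σ) :
    facetRes o F hf (a • z) = restrict hf.le a • facetRes o F hf z := by
  induction z using TensorProduct.induction_on with
  | zero => simp
  | add x y hx hy => rw [smul_add, map_add, hx, hy, map_add, smul_add]
  | tmul f ω =>
    rw [TensorProduct.smul_tmul', facetRes_tmul, facetRes_tmul, smul_comm (restrict hf.le a),
      TensorProduct.smul_tmul']
    congr 2
    ext g
    exact map_mul (restrict hf.le) _ _

/-- The composition of the restrictions to facets along a chain. -/
def chainRes (o : Orientations Δ) (F : PerverseSheaf.{u, w} Δ) :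
    ∀ {σ τ : Cone Δ}, FacetChain σ τ → (DualObj F.toGradedSystem σ →+ DualObj F.toGradedSystem τ)
  | _, _, .nil _ => AddMonoidHom.id _
  | _, _, .cons h c => (chainRes o F c).comp (facetRes o F h)

theorem chainRes_smul (o : Orientations Δ) (F : PerverseSheaf.{u, w} Δ) {σ τ : Cone Δ}
    (c : FacetChain σ τ) (a : A σ) (z : DualObj F.toGradedSystem σ) :
    chainRes o F c (a • z) = restrict c.le a • chainRes o F c z := by
  induction c with
  | nil σ => exact congrArg (· • z) (restrict_refl σ a).symm
  | cons h c ih =>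
    change chainRes o F c (facetRes o F h (a • z)) = _ • chainRes o F c (facetRes o F h z)
    rw [facetRes_smul, ih, restrict_comp]

open Classical in
/-- The restriction `(DF)_σ → (DF)_τ` to a face: the composition of the restrictions to facets
along some chain from `σ` to `τ`. (Such chains exist for all faces of polyhedral cones.) -/
def dualRes (o : Orientations Δ) (F : PerverseSheaf.{u, w} Δ) (σ τ : Cone Δ) :
    DualObj F.toGradedSystem σ →+ DualObj F.toGradedSystem τ :=
  if c : Nonempty (FacetChain σ τ) then chainRes o F c.some else 0

/-- The dual sheaf `DF` of a perverse sheaf. -/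
def dual (o : Orientations Δ) (F : PerverseSheaf.{u, w} Δ) : GradedSystem.{u, w} Δ where
  obj σ := DualObj F.toGradedSystem σ
  grade σ := dualGrade F.toGradedSystem σ
  res {σ τ} _ := dualRes o F σ τ
  res_smul {σ τ} h a x := by
    unfold dualRes
    split_ifs with c
    · exact chainRes_smul o F c.some a x
    · simp

variable {F G : PerverseSheaf.{u, w} Δ} (φ : Hom F.toGradedSystem G.toGradedSystem)

theorem dualMapApp_facetRes (o : Orientations Δ) {τ σ : Cone Δ} (hf : IsFacet τ σ)
    (z : DualObj G.toGradedSystem σ) :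
    dualMapApp φ τ (facetRes o G hf z) = facetRes o F hf (dualMapApp φ σ z) := by
  induction z using TensorProduct.induction_on with
  | zero => simp
  | add x y hx hy => simp only [map_add, hx, hy]
  | tmul f ω =>
    rw [facetRes_tmul, map_zsmul, dualMapApp_tmul, dualMapApp_tmul, facetRes_tmul]
    congr 2
    ext g
    obtain ⟨x, hx⟩ := exists_isExt F hf g
    have hx' : IsExt G.toGradedSystem hf (φ.relMap τ g).1 (φ.app σ x) :=
      ⟨by rw [← φ.app_res, hx.res_eq]; rfl, fun γ hγ hne => by
        rw [← φ.app_res, hx.res_eq_zero γ hγ hne, map_zero]⟩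
    refine (phiApply_eq G hf _ (facetForm_spec hf) f (φ.relMap τ g) hx').trans
      (Eq.trans ?_ (phiApply_eq F hf _ (facetForm_spec hf) (f ∘ₗ φ.relMap σ) g hx).symm)
    rw [LinearMap.comp_apply]
    congr 2
    exact Subtype.ext (map_smul (φ.app σ) _ _).symm

theorem dualMapApp_chainRes (o : Orientations Δ) {τ σ : Cone Δ} (c : FacetChain σ τ)
    (z : DualObj G.toGradedSystem σ) :
    dualMapApp φ τ (chainRes o G c z) = chainRes o F c (dualMapApp φ σ z) := by
  induction c with
  | nil σ => rfl
  | cons h c ih =>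
    change dualMapApp φ _ (chainRes o G c (facetRes o G h z)) =
      chainRes o F c (facetRes o F h (dualMapApp φ _ z))
    rw [ih, dualMapApp_facetRes]

/-- The homomorphism `Dφ : DG → DF` induced by `φ : F → G`. -/
def dualMap (o : Orientations Δ) : Hom (dual o G) (dual o F) where
  app σ := dualMapApp φ σ
  app_mem σ q z hz := dualMapApp_mem φ σ q z hz
  app_res {σ τ} _ z := by
    change dualMapApp φ τ (dualRes o G σ τ z) = dualRes o F σ τ (dualMapApp φ σ z)
    unfold dualRes
    split_ifs with c
    · exact dualMapApp_chainRes φ o c.some z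
    · exact map_zero (dualMapApp φ τ)

/-- The dual sheaf as a perverse sheaf, given that it is one. -/
abbrev dualSheaf (o : Orientations Δ) (F : PerverseSheaf.{u, w} Δ) (h : IsPerverse (dual o F)) :
    PerverseSheaf.{u, w} Δ := ⟨dual o F, h⟩

end Dual

end FanSheaf

end

open FanSheaf

/-!
# Biduality for perverse sheaves on fans

Write `K_σ` for `F_(σ,∂σ)`. After the facet forms are normalized so that they match the chosen
volume forms (`exists_normForm`), the map `f ↦ f ⊗ vol` identifies `(DF)_σ` with `Hom (K_σ, A_σ)`,
and the restriction to a facet becomes `homRes`, without signs. Two facets of `σ` that share a face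
of codimension two give the same composed restriction to that face (`homRes_comm`). Any two facets
through a given face are connected through such faces: as in the simplex method, one walks along
facets of decreasing value of a linear functional (`facet_connected`). So the restrictions do not
depend on the chain of facets (`chainRes_eq`).

Everything else rests on two observations.

*Division.* A linear form `f` on `K_σ` extends to `F_σ` exactly when its restrictions to all facets
vanish. The extension sends `x` to `f (H x) / H`, where `H` is the product of the equations of the
facets; the quotient is a polynomial because the vanishing of the restriction to a facet says that
`f (H x)` is divisible by the equation of that facet (`exists_extend_hom`). Hence
`(DF)_(σ,∂σ) ≃ Hom (F_σ, A_σ)`, which is `dualRelEquiv`.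

*Line shellings.* Order the facets of `σ` by the normalized values of their forms at a generic
point. A facet `τ` then meets the preceding facets in the facets of `τ` that are visible from a
point of `V_τ` (`facetForm_project_neg_iff`, `exists_adjacent_level_lt`). By induction along the
shelling and on the dimension, the sections that vanish on an initial segment form a projective
module: each step takes the kernel of a surjection onto a projective module over `A_σ / (h)`, and
such a kernel is again projective (`projective_ker_of_semilinear`). So `K_σ` is projective
(`projective_rel`), and it has a homogeneous basis by the graded Nakayama argument
(`exists_homogeneous_basis`). Running through the shelling backwards, compatible linear forms over
the facets are lifted to linear forms over `σ` (`exists_homRes_eq`), so that `DF` is flabby.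

The biduality map of `F_σ` is the composition of `F_σ ≃ Hom (Hom (F_σ, A_σ), A_σ)` with the dual of
`dualRelEquiv`. Its compatibility with the gradings and with the restriction to a facet `τ` is
checked after multiplication by the product of the equations of all facets, respectively of all
facets other than `τ`, whose restriction to `τ` is not zero (`mem_homGrade_of_comp_subtype`,
`restrict_apply_eq`).
-/

noncomputable section

namespace FanSheaf

variable {V : Type u} [AddCommGroup V] [Module ℝ V] {Δ : Fan V}

/-! ### Internal gradings -/

/-- A criterion for internal gradings: the components are separated by additive maps and they
span. -/
theorem isInternal_of_components {M S : Type*} [AddCommGroup M] [SetLike S M]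
    [AddSubgroupClass S M] (G : ℤ → S) (c : ℤ → M →+ M)
    (hsame : ∀ i, ∀ x ∈ G i, c i x = x) (hne : ∀ i j, i ≠ j → ∀ x ∈ G i, c j x = 0)
    (hspan : ∀ x, ∃ (s : Finset ℤ) (f : ℤ → M), (∀ i, f i ∈ G i) ∧ x = ∑ i ∈ s, f i) :
    DirectSum.IsInternal G := by
  classical
  constructor
  · rw [injective_iff_map_eq_zero]
    intro z hz
    refine DFinsupp.ext fun j => Subtype.ext ?_
    have key : ∀ z : DirectSum ℤ fun i => G i,
        c j (DirectSum.coeAddMonoidHom G z) = (z j : M) := by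
      intro z
      induction z using DirectSum.induction_on with
      | zero => simp
      | of i x =>
        rw [DirectSum.coeAddMonoidHom_of]
        by_cases h : i = j
        · subst h; rw [hsame i x x.2, DirectSum.of_eq_same]
        · rw [hne i j h x x.2, DirectSum.of_eq_of_ne _ _ _ (Ne.symm h)]; rfl
      | add x y hx hy => rw [map_add, map_add, hx, hy]; rfl
    rw [← key z, hz, map_zero]
    rfl
  · intro x
    obtain ⟨s, f, hf, rfl⟩ := hspan x
    refine ⟨∑ i ∈ s, DirectSum.of (fun i => G i) i ⟨f i, hf i⟩, ?_⟩
    rw [map_sum]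
    exact Finset.sum_congr rfl fun i _ => DirectSum.coeAddMonoidHom_of G i _

/-! ### The polynomial algebras -/

theorem gradeA_two_mul (σ : Cone Δ) (d : ℕ) :
    gradeA σ (2 * (d : ℤ)) = LinearMap.range (form σ) ^ d := by
  unfold gradeA
  apply le_antisymm
  · refine iSup₂_le fun e he => ?_
    obtain rfl : e = d := by omega
    exact le_rfl
  · exact le_iSup₂_of_le d rfl le_rfl

theorem mem_gradeA_iff {σ : Cone Δ} {q : ℤ} {a : A σ} :
    a ∈ gradeA σ q ↔ a = 0 ∨ ∃ d : ℕ, 2 * (d : ℤ) = q ∧ a ∈ LinearMap.range (form σ) ^ d := by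
  by_cases h : ∃ d : ℕ, 2 * (d : ℤ) = q
  · obtain ⟨d, rfl⟩ := h
    rw [gradeA_two_mul]
    constructor
    · exact fun ha => Or.inr ⟨d, rfl, ha⟩
    · rintro (rfl | ⟨e, he, ha⟩)
      · exact Submodule.zero_mem _
      · obtain rfl : e = d := by omega
        exact ha
  · have : gradeA σ q = ⊥ := by
      unfold gradeA
      rw [eq_bot_iff]
      exact iSup₂_le fun e he => (h ⟨e, he⟩).elim
    rw [this, Submodule.mem_bot]
    exact ⟨Or.inl, fun h' => h'.elim id fun ⟨d, hd, _⟩ => (h ⟨d, hd⟩).elim⟩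

theorem form_mem_gradeA (σ : Cone Δ) (l : Module.Dual ℝ (lin σ)) : form σ l ∈ gradeA σ 2 :=
  mem_gradeA_iff.2 (Or.inr ⟨1, by norm_num, by rw [pow_one]; exact ⟨l, rfl⟩⟩)

instance (σ : Cone Δ) : SetLike.GradedMonoid (gradeA σ) where
  one_mem := mem_gradeA_iff.2 (Or.inr ⟨0, by norm_num, by
    rw [pow_zero]; exact Submodule.one_le.1 le_rfl⟩)
  mul_mem := by
    intro i j a b ha hb
    rcases mem_gradeA_iff.1 ha with rfl | ⟨d, rfl, hd⟩
    · rw [zero_mul]; exact Submodule.zero_mem _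
    rcases mem_gradeA_iff.1 hb with rfl | ⟨e, rfl, he⟩
    · rw [mul_zero]; exact Submodule.zero_mem _
    refine mem_gradeA_iff.2 (Or.inr ⟨d + e, by push_cast; ring, ?_⟩)
    rw [pow_add]
    exact Submodule.mul_mem_mul hd he

/-- The algebra map `A_σ → A_σ[X]` that multiplies each linear form by `X`. Its coefficients are the
homogeneous components. -/
def degreeMap (σ : Cone Δ) : A σ →ₐ[ℝ] Polynomial (A σ) :=
  SymmetricAlgebra.lift (LinearMap.mulLeft ℝ Polynomial.X ∘ₗ
    (Polynomial.CAlgHom (R := ℝ) (A := A σ)).toLinearMap ∘ₗ form σ)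

theorem degreeMap_form (σ : Cone Δ) (l : Module.Dual ℝ (lin σ)) :
    degreeMap σ (form σ l) = Polynomial.X * Polynomial.C (form σ l) :=
  SymmetricAlgebra.lift_ι_apply _ _

theorem degreeMap_of_mem {σ : Cone Δ} {d : ℕ} {a : A σ} (ha : a ∈ LinearMap.range (form σ) ^ d) :
    degreeMap σ a = Polynomial.X ^ d * Polynomial.C a := by
  induction ha using Submodule.pow_induction_on_left' with
  | algebraMap r => rw [AlgHom.commutes, pow_zero, one_mul]; rfl
  | add x y i hx hy ihx ihy => rw [map_add, ihx, ihy, map_add, mul_add]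
  | mem_mul m hm i x hx ih =>
    obtain ⟨l, rfl⟩ := hm
    rw [map_mul, ih, degreeMap_form, map_mul, pow_succ]
    ring

theorem coeff_degreeMap_mem {σ : Cone Δ} (a : A σ) (d : ℕ) :
    (degreeMap σ a).coeff d ∈ LinearMap.range (form σ) ^ d := by
  induction a using SymmetricAlgebra.induction generalizing d with
  | algebraMap r =>
    rw [AlgHom.commutes, Polynomial.algebraMap_apply, Polynomial.coeff_C]
    split_ifs with h
    · subst h; rw [pow_zero]; exact Submodule.mem_one.2 ⟨r, rfl⟩
    · exact Submodule.zero_mem _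
  | ι l =>
    change (degreeMap σ (form σ l)).coeff d ∈ _
    rw [degreeMap_form, mul_comm, Polynomial.coeff_C_mul_X]
    split_ifs with h
    · subst h; rw [pow_one]; exact ⟨l, rfl⟩
    · exact Submodule.zero_mem _
  | mul a b ha hb =>
    rw [map_mul, Polynomial.coeff_mul]
    refine Submodule.sum_mem _ fun p hp => ?_
    rw [← Finset.HasAntidiagonal.mem_antidiagonal.1 hp, pow_add]
    exact Submodule.mul_mem_mul (ha _) (hb _)
  | add a b ha hb =>
    rw [map_add, Polynomial.coeff_add]
    exact Submodule.add_mem _ (ha d) (hb d)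

theorem eval_degreeMap {σ : Cone Δ} (a : A σ) : (degreeMap σ a).eval 1 = a := by
  induction a using SymmetricAlgebra.induction with
  | algebraMap r => rw [AlgHom.commutes, Polynomial.algebraMap_apply, Polynomial.eval_C]
  | ι l =>
    change (degreeMap σ (form σ l)).eval 1 = _
    rw [degreeMap_form, Polynomial.eval_mul, Polynomial.eval_X, Polynomial.eval_C, one_mul]
  | mul a b ha hb => rw [map_mul, Polynomial.eval_mul, ha, hb]
  | add a b ha hb => rw [map_add, Polynomial.eval_add, ha, hb]

theorem gradeA_isInternal (σ : Cone Δ) : DirectSum.IsInternal (gradeA σ) := by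
  classical
  refine isInternal_of_components (gradeA σ)
    (fun q => if h : ∃ d : ℕ, 2 * (d : ℤ) = q then
      ((Polynomial.lcoeff (A σ) h.choose).toAddMonoidHom.comp
        (degreeMap σ).toRingHom.toAddMonoidHom) else 0) ?_ ?_ ?_
  · intro q a ha
    rcases mem_gradeA_iff.1 ha with rfl | ⟨d, rfl, hd⟩
    · exact map_zero _
    have h : ∃ e : ℕ, 2 * (e : ℤ) = 2 * (d : ℤ) := ⟨d, rfl⟩
    have he : h.choose = d := by have := h.choose_spec; omega
    rw [dif_pos h]
    change (degreeMap σ a).coeff h.choose = a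
    rw [he, degreeMap_of_mem hd, Polynomial.coeff_X_pow_mul', if_pos le_rfl, Nat.sub_self,
      Polynomial.coeff_C_zero]
  · intro i j hij a ha
    rcases mem_gradeA_iff.1 ha with rfl | ⟨d, rfl, hd⟩
    · exact map_zero _
    by_cases h : ∃ e : ℕ, 2 * (e : ℤ) = j
    · have he := h.choose_spec
      rw [dif_pos h]
      change (degreeMap σ a).coeff h.choose = 0
      rw [degreeMap_of_mem hd, mul_comm, Polynomial.coeff_C_mul, Polynomial.coeff_X_pow,
        if_neg (by rintro h'; rw [h'] at he; exact hij he), mul_zero]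
    · rw [dif_neg h]; rfl
  · intro a
    refine ⟨(Finset.range ((degreeMap σ a).natDegree + 1)).image fun d : ℕ => 2 * (d : ℤ),
      fun q => (degreeMap σ a).coeff (q / 2).toNat * (if Even q ∧ 0 ≤ q then 1 else 0), ?_, ?_⟩
    · intro q
      dsimp only
      split_ifs with h
      · obtain ⟨⟨d, rfl⟩, h0⟩ := h
        rw [mul_one]
        have hd : (d + d) / 2 = d := by omega
        rw [hd]
        lift d to ℕ using by omega
        rw [← two_mul, gradeA_two_mul, Int.toNat_natCast]
        exact coeff_degreeMap_mem a d
      · rw [mul_zero]; exact Submodule.zero_mem _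
    · rw [Finset.sum_image (by intro x _ y _ h; simpa using h)]
      conv_lhs => rw [← eval_degreeMap a, Polynomial.eval_eq_sum_range]
      refine Finset.sum_congr rfl fun d _ => ?_
      simp

instance gradedAlgebra (σ : Cone Δ) : GradedAlgebra (gradeA σ) :=
  { (gradeA_isInternal σ).chooseDecomposition with }

/-- The augmentation `A_σ → ℝ` kills every component of nonzero degree. -/
theorem algebraMapInv_eq_zero {σ : Cone Δ} {i : ℤ} (hi : i ≠ 0) {a : A σ} (ha : a ∈ gradeA σ i) :
    (SymmetricAlgebra.algebraMapInv a : ℝ) = 0 := by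
  rcases mem_gradeA_iff.1 ha with rfl | ⟨d, rfl, hd⟩
  · exact map_zero _
  obtain ⟨e, rfl⟩ : ∃ e, d = e + 1 := Nat.exists_eq_succ_of_ne_zero (by rintro rfl; simp at hi)
  rw [pow_succ'] at hd
  clear ha
  induction hd using Submodule.mul_induction_on' with
  | mem_mul_mem x hx y hy =>
    obtain ⟨l, rfl⟩ := hx
    rw [map_mul, SymmetricAlgebra.algebraMapInv_ι, zero_mul]
  | add x _ y _ hx hy => rw [map_add, hx, hy, add_zero]

theorem exists_algebraMap_eq {σ : Cone Δ} {a : A σ} (ha : a ∈ gradeA σ 0) :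
    ∃ r : ℝ, algebraMap ℝ (A σ) r = a := by
  rcases mem_gradeA_iff.1 ha with rfl | ⟨d, hd, h⟩
  · exact ⟨0, map_zero _⟩
  · obtain rfl : d = 0 := by omega
    rw [pow_zero] at h
    exact Submodule.mem_one.1 h

theorem restrict_mem_gradeA {σ τ : Cone Δ} (h : τ ≤ σ) {i : ℤ} {a : A σ} (ha : a ∈ gradeA σ i) :
    restrict h a ∈ gradeA τ i := by
  rcases mem_gradeA_iff.1 ha with rfl | ⟨d, rfl, hd⟩
  · rw [map_zero]; exact Submodule.zero_mem _
  · refine mem_gradeA_iff.2 (Or.inr ⟨d, rfl, ?_⟩)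
    have h1 : (LinearMap.range (form σ) ^ d).map (restrict h).toLinearMap ≤
        LinearMap.range (form τ) ^ d := by
      rw [Submodule.map_pow]
      refine pow_le_pow_left' ?_ d
      rintro _ ⟨_, ⟨l, rfl⟩, rfl⟩
      exact ⟨_, (restrict_form h l).symm⟩
    exact h1 ⟨a, hd, rfl⟩

/-- Homogeneity can be tested after multiplication by a nonzero homogeneous polynomial. -/
theorem mem_gradeA_of_mul_mem {σ : Cone Δ} {i j : ℤ} {a b : A σ} (ha : a ∈ gradeA σ i)
    (ha0 : a ≠ 0) (hab : a * b ∈ gradeA σ (i + j)) : b ∈ gradeA σ j := by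
  classical
  have h1 : ∀ k, k ≠ j → (DirectSum.decompose (gradeA σ) b k : A σ) = 0 := by
    intro k hk
    have h2 := DirectSum.coe_decompose_mul_add_of_left_mem (gradeA σ) (i := i) (j := k) (b := b) ha
    rw [DirectSum.decompose_of_mem_ne (gradeA σ) hab (by omega)] at h2
    exact (mul_eq_zero.1 h2.symm).resolve_left ha0
  rw [← DirectSum.sum_support_decompose (gradeA σ) b]
  refine Submodule.sum_mem _ fun k _ => ?_
  by_cases hk : k = j
  · subst hk; exact SetLike.coe_mem _
  · rw [h1 k hk]; exact Submodule.zero_mem _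

theorem form_injective (σ : Cone Δ) : Function.Injective (form σ) := by
  intro l l' h
  let e : A σ →ₐ[ℝ] TrivSqZeroExt ℝ (Module.Dual ℝ (lin σ)) :=
    SymmetricAlgebra.lift (TrivSqZeroExt.inrHom ℝ _)
  have h1 : ∀ l, e (form σ l) = TrivSqZeroExt.inr l := fun l => SymmetricAlgebra.lift_ι_apply _ _
  exact TrivSqZeroExt.inr_injective (by rw [← h1, ← h1, h])

theorem form_ne_zero {σ : Cone Δ} {l : Module.Dual ℝ (lin σ)} (h : l ≠ 0) : form σ l ≠ 0 :=
  fun h' => h (form_injective σ (by rw [h', map_zero]))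

instance [FiniteDimensional ℝ V] (σ : Cone Δ) : IsNoetherianRing (A σ) :=
  isNoetherianRing_of_ringEquiv _
    (SymmetricAlgebra.equivMvPolynomial
      (Module.Free.chooseBasis ℝ (Module.Dual ℝ (lin σ)))).symm.toRingEquiv

/-- The kernel of the restriction of polynomial functions to a facet is generated by the equation
of the facet. -/
theorem exists_eq_form_mul {τ σ : Cone Δ} (hf : IsFacet τ σ) {h : Module.Dual ℝ (lin σ)}
    (hh : IsFacetForm τ σ h) {a : A σ} (ha : restrict hf.le a = 0) : ∃ b, a = form σ h * b := by
  obtain ⟨v, hv⟩ := hh.exists_eq_one hf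
  -- the projection `V_σ → V_τ` along `v` yields a section of the restriction
  have hmem : ∀ x : lin σ, ((x - h x • v : lin σ) : V) ∈ lin τ := by
    intro x
    have : x - h x • v ∈ LinearMap.ker h := by
      rw [LinearMap.mem_ker, map_sub, map_smul, hv, smul_eq_mul, mul_one, sub_self]
    rw [hh] at this
    exact this
  let p : lin σ →ₗ[ℝ] lin τ := ((lin σ).subtype ∘ₗ (LinearMap.id - h.smulRight v)).codRestrict
    (lin τ) hmem
  let s : A τ →ₐ[ℝ] A σ := SymmetricAlgebra.lift (form σ ∘ₗ p.dualMap)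
  let I : Ideal (A σ) := Ideal.span {form σ h}
  have key : (Ideal.Quotient.mkₐ ℝ I).comp (s.comp (restrict hf.le)) = Ideal.Quotient.mkₐ ℝ I := by
    apply SymmetricAlgebra.algHom_ext
    ext l
    change Ideal.Quotient.mk I (s (restrict hf.le (form σ l))) = Ideal.Quotient.mk I (form σ l)
    rw [restrict_form, SymmetricAlgebra.lift_ι_apply, Ideal.Quotient.eq, Ideal.mem_span_singleton]
    have : p.dualMap (restrictForm hf.le l) = l - l v • h := by
      ext x
      change l (Submodule.inclusion (lin_mono hf.le) (p x)) = _
      have : Submodule.inclusion (lin_mono hf.le) (p x) = x - h x • v := rfl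
      rw [this]
      simp [mul_comm]
    rw [LinearMap.comp_apply, this, map_sub, map_smul]
    refine ⟨algebraMap ℝ _ (-l v), ?_⟩
    rw [mul_comm, ← Algebra.smul_def, neg_smul]
    abel
  have h1 := DFunLike.congr_fun key a
  change Ideal.Quotient.mk I (s (restrict hf.le a)) = Ideal.Quotient.mk I a at h1
  rw [ha, map_zero, map_zero, eq_comm, Ideal.Quotient.eq_zero_iff_mem,
    Ideal.mem_span_singleton] at h1
  exact h1

theorem IsFacetForm.ne_zero {τ σ : Cone Δ} (hf : IsFacet τ σ) {h : Module.Dual ℝ (lin σ)}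
    (hh : IsFacetForm τ σ h) : h ≠ 0 := by
  rintro rfl
  obtain ⟨v, hv⟩ := hh.exists_eq_one hf
  simp at hv

/-- A facet form vanishes on no other facet. -/
theorem IsFacet.eq_of_restrictForm_eq_zero [FiniteDimensional ℝ V] {τ σ ρ : Cone Δ}
    (hτ : IsFacet τ σ) {h : Module.Dual ℝ (lin σ)} (hh : IsFacetForm τ σ h) (hρ : IsFacet ρ σ)
    (h0 : restrictForm hρ.le h = 0) : τ = ρ := by
  have h1 : lin ρ ≤ lin τ := by
    intro x hx
    have : (⟨x, lin_mono hρ.le hx⟩ : lin σ) ∈ LinearMap.ker h :=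
      LinearMap.mem_ker.2 (DFunLike.congr_fun h0 (⟨x, hx⟩ : lin ρ))
    rw [hh] at this
    exact this
  have h2 : ρ ≤ τ := fun x hx =>
    mem_of_mem_lin hτ.le (hρ.le hx) (h1 (Submodule.subset_span hx))
  by_contra hne
  have h3 := dim_lt_of_lt (lt_of_le_of_ne h2 (Ne.symm hne))
  have := hτ.dim_eq
  have := hρ.dim_eq
  omega

/-! ### Polyhedral geometry: facets of a cone -/

/-- A finitely generated cone is a finite intersection of half-spaces. The half-spaces are found by
Fourier–Motzkin elimination, adding one generator at a time. -/
theorem exists_finset_dual_of_fg [FiniteDimensional ℝ V] (C : PointedCone ℝ V)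
    (hC : Submodule.FG C) :
    ∃ L : Finset (Module.Dual ℝ V), ∀ x, x ∈ C ↔ ∀ l ∈ L, 0 ≤ l x := by
  classical
  obtain ⟨s, rfl⟩ := hC
  induction s using Finset.induction_on with
  | empty =>
    let b := Module.finBasis ℝ V
    refine ⟨Finset.univ.image b.coord ∪ Finset.univ.image fun i => -b.coord i, fun x => ?_⟩
    rw [Finset.coe_empty, Submodule.span_empty, Submodule.mem_bot]
    constructor
    · rintro rfl l -
      rw [map_zero]
    · intro h
      refine b.ext_elem fun i => ?_
      have h1 := h (b.coord i) (by simp)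
      have h2 := h (-b.coord i) (by simp)
      simp only [Module.Basis.coord_apply, LinearMap.neg_apply] at h1 h2
      rw [map_zero, Finsupp.zero_apply]
      linarith
  | insert v s hv ih =>
    obtain ⟨L, hL⟩ := ih
    refine ⟨L.filter (fun l => 0 ≤ l v) ∪ ((L ×ˢ L).filter fun p => 0 ≤ p.1 v ∧ p.2 v < 0).image
      fun p => p.1 v • p.2 - p.2 v • p.1, fun x => ?_⟩
    rw [Finset.coe_insert, Submodule.span_insert, Submodule.mem_sup]
    constructor
    · rintro ⟨y, hy, z, hz, rfl⟩ l hl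
      obtain ⟨⟨t, ht⟩, rfl⟩ := Submodule.mem_span_singleton.1 hy
      have hz' := (hL z).1 hz
      rcases Finset.mem_union.1 hl with hl | hl
      · obtain ⟨hl, hlv⟩ := Finset.mem_filter.1 hl
        change 0 ≤ l (t • v + z)
        rw [map_add, map_smul, smul_eq_mul]
        have := hz' l hl
        positivity
      · obtain ⟨⟨l1, l2⟩, hp, rfl⟩ := Finset.mem_image.1 hl
        obtain ⟨hp, h1, h2⟩ := Finset.mem_filter.1 hp
        obtain ⟨hl1, hl2⟩ := Finset.mem_product.1 hp
        have e1 := hz' l1 hl1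
        have e2 := hz' l2 hl2
        dsimp only at h1 h2 e1 e2 ⊢
        change 0 ≤ (l1 v • l2 - l2 v • l1) (t • v + z)
        simp only [LinearMap.sub_apply, LinearMap.smul_apply, map_add, map_smul, smul_eq_mul]
        nlinarith [mul_nonneg h1 e2, mul_nonneg (neg_nonneg.2 h2.le) e1]
    · intro h
      have hpos : ∀ l ∈ L, 0 ≤ l v → 0 ≤ l x := fun l hl hlv =>
        h l (Finset.mem_union_left _ (Finset.mem_filter.2 ⟨hl, hlv⟩))
      have hmix : ∀ l1 ∈ L, ∀ l2 ∈ L, 0 ≤ l1 v → l2 v < 0 → 0 ≤ l1 v * l2 x - l2 v * l1 x :=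
        fun l1 hl1 l2 hl2 h1 h2 => h _ (Finset.mem_union_right _ (Finset.mem_image.2
          ⟨(l1, l2), Finset.mem_filter.2 ⟨Finset.mem_product.2 ⟨hl1, hl2⟩, h1, h2⟩, rfl⟩))
      -- `x - t v` must satisfy all inequalities; those with `l v < 0` bound `t` from below
      obtain ⟨t, ht0, hneg, hub⟩ : ∃ t : ℝ, 0 ≤ t ∧ (∀ l ∈ L, l v < 0 → l x / l v ≤ t) ∧
          ∀ l ∈ L, 0 ≤ l v → l v * t ≤ l x := by
        let T := insert 0 ((L.filter fun l => l v < 0).image fun l => l x / l v)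
        have hT : T.Nonempty := Finset.insert_nonempty _ _
        refine ⟨T.max' hT, T.le_max' _ (Finset.mem_insert_self _ _), fun l hl hlv =>
          T.le_max' _ (Finset.mem_insert_of_mem (Finset.mem_image.2
            ⟨l, Finset.mem_filter.2 ⟨hl, hlv⟩, rfl⟩)), fun l hl hlv => ?_⟩
        rcases Finset.mem_insert.1 (T.max'_mem hT) with h0 | h0
        · rw [h0, mul_zero]; exact hpos l hl hlv
        · obtain ⟨l2, hl2, he⟩ := Finset.mem_image.1 h0
          obtain ⟨hl2, hlv2⟩ := Finset.mem_filter.1 hl2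
          rw [← he]
          have := hmix l hl l2 hl2 hlv hlv2
          rw [← mul_div_assoc, div_le_iff_of_neg hlv2]
          linarith
      refine ⟨(⟨t, ht0⟩ : {r : ℝ // 0 ≤ r}) • v, Submodule.smul_mem _ _
        (Submodule.mem_span_singleton_self v), x - t • v, (hL _).2 fun l hl => ?_, ?_⟩
      · rw [map_sub, map_smul, smul_eq_mul]
        rcases le_or_gt 0 (l v) with hlv | hlv
        · have := hub l hl hlv
          linarith
        · have := hneg l hl hlv
          rw [div_le_iff_of_neg hlv] at this
          linarith
      · change t • v + (x - t • v) = x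
        abel

/-- In a set closed under addition, finitely many nonnegative linear forms that are not
identically zero have a common point of positivity. -/
theorem exists_forall_pos {W ι : Type*} [AddCommGroup W] [Module ℝ W] (I : Finset ι)
    (f : ι → Module.Dual ℝ W) (P : W → Prop) (h0 : P 0) (hadd : ∀ x y, P x → P y → P (x + y))
    (hnn : ∀ i ∈ I, ∀ x, P x → 0 ≤ f i x) (h : ∀ i ∈ I, ∃ x, P x ∧ 0 < f i x) :
    ∃ x, P x ∧ ∀ i ∈ I, 0 < f i x := by
  classical
  induction I using Finset.induction_on with
  | empty => exact ⟨0, h0, by simp⟩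
  | insert i I hi ih =>
    obtain ⟨x, hx, hx'⟩ := ih (fun j hj => hnn j (Finset.mem_insert_of_mem hj))
      (fun j hj => h j (Finset.mem_insert_of_mem hj))
    obtain ⟨y, hy, hy'⟩ := h i (Finset.mem_insert_self _ _)
    refine ⟨x + y, hadd x y hx hy, fun j hj => ?_⟩
    rw [map_add]
    rcases Finset.mem_insert.1 hj with rfl | hj'
    · exact add_pos_of_nonneg_of_pos (hnn _ hj x hx) hy'
    · exact add_pos_of_pos_of_nonneg (hx' j hj') (hnn j hj y hy)

/-- A linear form on `V_σ` that vanishes on `σ` is zero. -/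
theorem dual_eq_zero_of_forall_mem {σ : Cone Δ} {l : Module.Dual ℝ (lin σ)}
    (h : ∀ x : lin σ, x.1 ∈ σ.1 → l x = 0) : l = 0 := by
  have : ∀ x (hx : x ∈ lin σ), l ⟨x, hx⟩ = 0 := by
    intro x hx
    induction hx using Submodule.span_induction with
    | mem x hx => exact h ⟨x, Submodule.subset_span hx⟩ hx
    | zero => exact map_zero l
    | add x y hx hy ihx ihy =>
      have := map_add l ⟨x, hx⟩ ⟨y, hy⟩
      rw [ihx, ihy, add_zero] at this
      exact this
    | smul r x hx ih =>
      have := map_smul l r ⟨x, hx⟩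
      rw [ih, smul_zero] at this
      exact this
  exact LinearMap.ext fun x => this x.1 x.2

theorem IsFacetForm.apply_eq_zero_iff {τ σ : Cone Δ} {h : Module.Dual ℝ (lin σ)}
    (hh : IsFacetForm τ σ h) (x : lin σ) : h x = 0 ↔ x.1 ∈ lin τ := by
  rw [← LinearMap.mem_ker, hh]
  rfl

/-- A linear form that vanishes on a facet is a multiple of the facet form. -/
theorem IsFacetForm.exists_eq_smul {τ σ : Cone Δ} (hf : IsFacet τ σ)
    {h : Module.Dual ℝ (lin σ)} (hh : IsFacetForm τ σ h) {l : Module.Dual ℝ (lin σ)}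
    (hl : ∀ x : lin σ, x.1 ∈ lin τ → l x = 0) : ∃ c : ℝ, l = c • h := by
  obtain ⟨v, hv⟩ := hh.exists_eq_one hf
  refine ⟨l v, LinearMap.ext fun x => ?_⟩
  have h1 : l (x - h x • v) = 0 := hl _ ((hh.apply_eq_zero_iff _).1 (by
    rw [map_sub, map_smul, hv, smul_eq_mul, mul_one, sub_self]))
  rw [map_sub, map_smul, smul_eq_mul, sub_eq_zero] at h1
  rw [h1, LinearMap.smul_apply, smul_eq_mul, mul_comm]

theorem IsFacetForm.smul {τ σ : Cone Δ} {h : Module.Dual ℝ (lin σ)}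
    (hh : IsFacetForm τ σ h) {c : ℝ} (hc : c ≠ 0) : IsFacetForm τ σ (c • h) := by
  unfold IsFacetForm
  rw [← hh]
  ext x
  simp [hc]

/-- The irredundant half-spaces that define a cone. -/
theorem exists_irredundant [FiniteDimensional ℝ V] (σ : Cone Δ) :
    ∃ L : Finset (Module.Dual ℝ (lin σ)), (∀ x : lin σ, x.1 ∈ σ.1 ↔ ∀ l ∈ L, 0 ≤ l x) ∧
      ∀ l ∈ L, ∃ y : lin σ, l y < 0 ∧ ∀ k ∈ L, k ≠ l → 0 ≤ k y := by
  classical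
  have hex : ∃ n, ∃ L : Finset (Module.Dual ℝ (lin σ)), L.card = n ∧
      ∀ x : lin σ, x.1 ∈ σ.1 ↔ ∀ l ∈ L, 0 ≤ l x := by
    obtain ⟨L, hL⟩ := exists_finset_dual_of_fg σ.1 (Δ.polyhedral _ σ.2)
    refine ⟨_, L.image fun l => l ∘ₗ (lin σ).subtype, rfl, fun x => ?_⟩
    rw [hL]
    simp
  obtain ⟨L, hcard, hL⟩ := Nat.find_spec hex
  refine ⟨L, hL, fun l hl => ?_⟩
  by_contra hcon
  push Not at hcon
  refine Nat.find_min hex (m := (L.erase l).card) ?_ ⟨L.erase l, rfl, fun x => ?_⟩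
  · rw [← hcard]; exact Finset.card_erase_lt_of_mem hl
  · rw [hL]
    refine ⟨fun h k hk => h k (Finset.mem_of_mem_erase hk), fun h k hk => ?_⟩
    by_cases e : k = l
    · subst e
      by_contra hneg
      obtain ⟨m, hm, hne, hlt⟩ := hcon x (not_le.1 hneg)
      exact hlt.not_ge (h m (Finset.mem_erase.2 ⟨hne, hm⟩))
    · exact h k (Finset.mem_erase.2 ⟨e, hk⟩)

/-- The half-spaces of an irredundant system are bounded by facets. -/
theorem exists_facet_of_irredundant [FiniteDimensional ℝ V] {σ : Cone Δ}
    {L : Finset (Module.Dual ℝ (lin σ))} (hL : ∀ x : lin σ, x.1 ∈ σ.1 ↔ ∀ l ∈ L, 0 ≤ l x)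
    (hirr : ∀ l ∈ L, ∃ y : lin σ, l y < 0 ∧ ∀ k ∈ L, k ≠ l → 0 ≤ k y)
    {l : Module.Dual ℝ (lin σ)} (hl : l ∈ L) : ∃ τ : Cone Δ, IsFacet τ σ ∧ IsFacetForm τ σ l := by
  classical
  have hne : ∀ k ∈ L, k ≠ 0 := by
    rintro _ hk rfl
    obtain ⟨y, hy, -⟩ := hirr _ hk
    simp at hy
  obtain ⟨q, hqσ, hq⟩ : ∃ q : lin σ, q.1 ∈ σ.1 ∧ ∀ k ∈ L, 0 < k q := by
    refine exists_forall_pos L id (fun x : lin σ => x.1 ∈ σ.1) σ.1.zero_mem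
      (fun x y hx hy => σ.1.add_mem hx hy) (fun k hk x hx => (hL x).1 hx k hk) fun k hk => ?_
    by_contra hcon
    push Not at hcon
    exact hne k hk (dual_eq_zero_of_forall_mem fun x hx =>
      le_antisymm (hcon x hx) ((hL x).1 hx k hk))
  obtain ⟨y, hy, hy'⟩ := hirr l hl
  -- the point where the segment from `q` to `y` meets the hyperplane `l = 0`
  set b : lin σ := (-l y) • q + l q • y with hb
  have hlb : l b = 0 := by
    rw [hb, map_add, map_smul, map_smul, smul_eq_mul, smul_eq_mul]; ring
  have hkb : ∀ k ∈ L, k ≠ l → 0 < k b := by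
    intro k hk hkl
    rw [hb, map_add, map_smul, map_smul, smul_eq_mul, smul_eq_mul]
    exact add_pos_of_pos_of_nonneg (mul_pos (by linarith) (hq k hk))
      (mul_nonneg (hq l hl).le (hy' k hk hkl))
  let T : PointedCone ℝ V :=
    { carrier := {x | ∃ h : x ∈ lin σ, x ∈ σ.1 ∧ l ⟨x, h⟩ = 0}
      zero_mem' := ⟨Submodule.zero_mem _, σ.1.zero_mem, map_zero l⟩
      add_mem' := by
        rintro x z ⟨h1, h2, h3⟩ ⟨h1', h2', h3'⟩
        refine ⟨Submodule.add_mem _ h1 h1', σ.1.add_mem h2 h2', ?_⟩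
        have := map_add l ⟨x, h1⟩ ⟨z, h1'⟩
        rw [h3, h3', add_zero] at this
        exact this
      smul_mem' := by
        rintro r x ⟨h1, h2, h3⟩
        refine ⟨Submodule.smul_mem _ (r : ℝ) h1, σ.1.smul_mem r.2 h2, ?_⟩
        have := map_smul l (r : ℝ) ⟨x, h1⟩
        rw [h3, smul_zero] at this
        exact this }
  have hT : T.IsFaceOf σ.1 := by
    refine ⟨fun x hx => hx.2.1, ?_⟩
    rintro x z a hx hz ha ⟨h1, h2, h3⟩
    have hx1 : x ∈ lin σ := Submodule.subset_span hx
    have hz1 : z ∈ lin σ := Submodule.subset_span hz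
    refine ⟨hx1, hx, ?_⟩
    have e := map_add l (a • ⟨x, hx1⟩) ⟨z, hz1⟩
    have e' : l (a • ⟨x, hx1⟩ + ⟨z, hz1⟩) = 0 := h3
    rw [e', map_smul, smul_eq_mul] at e
    have hx2 := (hL ⟨x, hx1⟩).1 hx l hl
    have hz2 := (hL ⟨z, hz1⟩).1 hz l hl
    nlinarith
  let τ : Cone Δ := ⟨T, Δ.face_mem _ σ.2 T hT⟩
  have hle : τ ≤ σ := hT.le
  have hform : IsFacetForm τ σ l := by
    refine le_antisymm ?_ ?_
    · intro z hz
      -- `b + ε z` lies in the face for small `ε > 0`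
      have hev : ∀ᶠ ε : ℝ in nhdsWithin 0 (Set.Ioi 0), ∀ k ∈ L, k ≠ l → 0 ≤ k b + ε * k z := by
        refine (Finset.eventually_all L).2 fun k hk => ?_
        by_cases hkl : k = l
        · exact Filter.Eventually.of_forall fun ε h => (h hkl).elim
        have hc : Continuous fun ε : ℝ => k b + ε * k z := by fun_prop
        have h1 := (hc.tendsto 0).eventually (lt_mem_nhds (a := 0) (by simpa using hkb k hk hkl))
        filter_upwards [h1.filter_mono nhdsWithin_le_nhds] with ε hε _
        exact hε.le
      obtain ⟨ε, hε, hε0⟩ := (hev.and self_mem_nhdsWithin).exists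
      have hε0 : 0 < ε := hε0
      have hmem : ∀ w : lin σ, l w = 0 → (∀ k ∈ L, k ≠ l → 0 ≤ k w) → w.1 ∈ lin τ := by
        intro w hw hw'
        refine Submodule.subset_span ⟨w.2, (hL w).2 fun k hk => ?_, hw⟩
        by_cases e : k = l
        · subst e; exact hw.ge
        · exact hw' k hk e
      have h1 := hmem b hlb fun k hk hkl => (hkb k hk hkl).le
      have h2 := hmem (b + ε • z)
        (by rw [map_add, map_smul, hlb, LinearMap.mem_ker.1 hz, smul_zero, add_zero])
        (fun k hk hkl => by rw [map_add, map_smul, smul_eq_mul]; exact hε k hk hkl)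
      have h3 := Submodule.smul_mem _ ε⁻¹ (Submodule.sub_mem _ h2 h1)
      have h4 : ε⁻¹ • ((b + ε • z).1 - b.1) = z.1 := by
        change ε⁻¹ • ((b.1 + ε • z.1) - b.1) = z.1
        rw [add_sub_cancel_left, smul_smul, inv_mul_cancel₀ hε0.ne', one_smul]
      rw [h4] at h3
      exact h3
    · intro z hz
      have : ∀ x (_ : x ∈ lin τ) (hx' : x ∈ lin σ), l ⟨x, hx'⟩ = 0 := by
        intro x hx
        induction hx using Submodule.span_induction with
        | mem x hx => exact fun _ => hx.2.2
        | zero => exact fun _ => map_zero l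
        | add x y hx hy ihx ihy =>
          intro _
          have := map_add l ⟨x, lin_mono hle hx⟩ ⟨y, lin_mono hle hy⟩
          rw [ihx, ihy, add_zero] at this
          exact this
        | smul r x hx ih =>
          intro _
          have := map_smul l r ⟨x, lin_mono hle hx⟩
          rw [ih, smul_zero] at this
          exact this
      exact this z.1 hz z.2
  refine ⟨τ, ⟨hle, ?_⟩, hform⟩
  have h1 := LinearMap.finrank_range_add_finrank_ker l
  have h2 : LinearMap.range l = ⊤ := LinearMap.range_eq_top.2
    (LinearMap.surjective_of_ne_zero (hne l hl))
  rw [h2, finrank_top, Module.finrank_self, hform,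
    (Submodule.comapSubtypeEquivOfLe (lin_mono hle)).finrank_eq] at h1
  unfold dim
  omega

/-- The facets of a cone. -/
abbrev Facet (σ : Cone Δ) : Type u := {τ : Cone Δ // IsFacet τ σ}

instance : Finite (Cone Δ) := Δ.finite.to_subtype

instance (σ : Cone Δ) : Fintype (Facet σ) := Fintype.ofFinite _

theorem isFacet_of_other {σ : Cone Δ} (τ ρ : Facet σ) {γ : Cone Δ} (hγ : IsFacet γ τ.1)
    (hγρ : γ ≤ ρ.1) : IsFacet γ ρ.1 := by
  refine ⟨hγρ, ?_⟩
  have := hγ.dim_eq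
  have := τ.2.dim_eq
  have := ρ.2.dim_eq
  omega

section FacetGeometry

variable [FiniteDimensional ℝ V] {σ : Cone Δ}

theorem facetForm_apply_eq_zero_iff (τ : Facet σ) (x : lin σ) :
    facetForm τ.2 x = 0 ↔ x.1 ∈ lin τ.1 := (facetForm_spec τ.2).apply_eq_zero_iff x

theorem facetForm_nonneg' (τ : Facet σ) (x : lin σ) (hx : x.1 ∈ σ.1) : 0 ≤ facetForm τ.2 x :=
  facetForm_nonneg τ.2 x.1 hx

theorem facetForm_eq_zero_of_le (τ : Facet σ) {δ : Cone Δ} (h : δ ≤ τ.1) (x : lin σ)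
    (hx : x.1 ∈ δ.1) : facetForm τ.2 x = 0 :=
  (facetForm_apply_eq_zero_iff τ x).2 (Submodule.subset_span (h hx))

theorem facetForm_pos_of_notMem (τ : Facet σ) (x : lin σ) (hx : x.1 ∈ σ.1) (hx' : x.1 ∉ τ.1.1) :
    0 < facetForm τ.2 x :=
  lt_of_le_of_ne (facetForm_nonneg' τ x hx) fun h => hx'
    (mem_of_mem_lin τ.2.le hx ((facetForm_apply_eq_zero_iff τ x).1 h.symm))

theorem Facet.eq_of_le {τ ρ : Facet σ} (h : τ.1 ≤ ρ.1) : τ = ρ := by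
  by_contra hne
  have h1 := dim_lt_of_lt (lt_of_le_of_ne h fun h' => hne (Subtype.ext h'))
  have := τ.2.dim_eq
  have := ρ.2.dim_eq
  omega

/-- A nonzero form that vanishes on a facet and is nonnegative on the cone is a positive multiple of
the facet form. -/
theorem exists_pos_smul_facetForm (τ : Facet σ) {h : Module.Dual ℝ (lin σ)} (h0 : h ≠ 0)
    (hker : ∀ x : lin σ, x.1 ∈ lin τ.1 → h x = 0) (hnn : ∀ x : lin σ, x.1 ∈ σ.1 → 0 ≤ h x) :
    ∃ c : ℝ, 0 < c ∧ h = c • facetForm τ.2 := by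
  obtain ⟨c, rfl⟩ := (facetForm_spec τ.2).exists_eq_smul τ.2 hker
  refine ⟨c, ?_, rfl⟩
  by_contra hc
  refine h0 (dual_eq_zero_of_forall_mem fun x hx => le_antisymm ?_ (hnn x hx))
  exact mul_nonpos_of_nonpos_of_nonneg (not_lt.1 hc) (facetForm_nonneg' τ x hx)

/-- A cone is the intersection of the half-spaces of its facets. -/
theorem mem_of_facetForm_nonneg (x : lin σ) (hx : ∀ τ : Facet σ, 0 ≤ facetForm τ.2 x) :
    x.1 ∈ σ.1 := by
  obtain ⟨L, hL, hirr⟩ := exists_irredundant σ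
  refine (hL x).2 fun l hl => ?_
  obtain ⟨τ, hτ, hform⟩ := exists_facet_of_irredundant hL hirr hl
  obtain ⟨c, hc, rfl⟩ := exists_pos_smul_facetForm ⟨τ, hτ⟩ (hform.ne_zero hτ)
    (fun y hy => (hform.apply_eq_zero_iff y).2 hy) fun y hy => (hL y).1 hy l hl
  exact mul_nonneg hc.le (hx ⟨τ, hτ⟩)

/-- A point of a face at which all forms of facets not containing the face are positive. -/
theorem exists_relint {δ : Cone Δ} (hδ : δ ≤ σ) :
    ∃ d : lin σ, d.1 ∈ δ.1 ∧ ∀ τ : Facet σ, ¬ δ ≤ τ.1 → 0 < facetForm τ.2 d := by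
  classical
  obtain ⟨d, hd, hd'⟩ := exists_forall_pos (Finset.univ.filter fun τ : Facet σ => ¬ δ ≤ τ.1)
    (fun τ => facetForm τ.2) (fun x : lin σ => x.1 ∈ δ.1) δ.1.zero_mem
    (fun x y hx hy => δ.1.add_mem hx hy) (fun τ _ x hx => facetForm_nonneg' τ x (hδ hx))
    (fun τ hτ => by
      obtain ⟨x, hx, hx'⟩ := Set.not_subset.1
        (show ¬ ((δ.1 : Set V) ⊆ τ.1.1) from (Finset.mem_filter.1 hτ).2)
      exact ⟨⟨x, Submodule.subset_span (hδ hx)⟩, hx, facetForm_pos_of_notMem τ _ (hδ hx) hx'⟩)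
  exact ⟨d, hd, fun τ hτ => hd' τ (Finset.mem_filter.2 ⟨Finset.mem_univ _, hτ⟩)⟩

theorem exists_interior (σ : Cone Δ) :
    ∃ q : lin σ, q.1 ∈ σ.1 ∧ ∀ τ : Facet σ, 0 < facetForm τ.2 q := by
  obtain ⟨q, hq, h⟩ := exists_relint (le_refl σ)
  exact ⟨q, hq, fun τ => h τ τ.2.lt.not_ge⟩

theorem exists_forall_nonneg_add {ι : Type*} [Finite ι] (a b : ι → ℝ)
    (h : ∀ i, 0 < a i ∨ 0 ≤ b i ∧ a i = 0) : ∃ N : ℝ, 0 < N ∧ ∀ i, 0 ≤ b i + N * a i := by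
  have hev : ∀ᶠ N : ℝ in Filter.atTop, ∀ i, 0 ≤ b i + N * a i := by
    refine Filter.eventually_all.2 fun i => ?_
    rcases h i with hi | ⟨hb, ha⟩
    · have : Filter.Tendsto (fun N : ℝ => b i + N * a i) Filter.atTop Filter.atTop :=
        Filter.tendsto_atTop_add_const_left _ _ (Filter.tendsto_id.atTop_mul_const hi)
      exact this.eventually_ge_atTop 0
    · exact Filter.Eventually.of_forall fun N => by rw [ha, mul_zero, add_zero]; exact hb
  obtain ⟨N, h1, h2⟩ := (hev.and (Filter.eventually_gt_atTop 0)).exists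
  exact ⟨N, h2, h1⟩

/-- Every proper face is contained in a facet. -/
theorem exists_facet_ge {δ : Cone Δ} (hδ : δ < σ) : ∃ τ : Facet σ, δ ≤ τ.1 := by
  by_contra hcon
  push Not at hcon
  obtain ⟨d, hd, hd'⟩ := exists_relint hδ.le
  refine hδ.not_ge fun x hx => ?_
  have hx' : x ∈ lin σ := Submodule.subset_span hx
  obtain ⟨N, hN, h⟩ := exists_forall_nonneg_add (fun τ : Facet σ => facetForm τ.2 d)
    (fun τ => facetForm τ.2 (-⟨x, hx'⟩)) fun τ => Or.inl (hd' τ (hcon τ))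
  have h1 : (-⟨x, hx'⟩ + N • d : lin σ).1 ∈ σ.1 := mem_of_facetForm_nonneg _ fun τ => by
    rw [map_add, map_smul, smul_eq_mul]
    exact h τ
  refine ((Cone.le_iff_isFaceOf δ σ).1 hδ.le).mem_of_add_mem_left hx h1 ?_
  change x + (-x + N • d.1) ∈ δ.1
  rw [add_neg_cancel_left]
  exact δ.1.smul_mem hN.le hd

/-! ### The diamond property -/

/-- The form of a facet restricts to a positive multiple of the form of a common codimension two
face. -/
theorem exists_restrictForm_eq (τ ρ : Facet σ) (hne : ρ ≠ τ) {γ : Cone Δ}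
    (hγ : IsFacet γ τ.1) (hγρ : γ ≤ ρ.1) :
    ∃ c : ℝ, 0 < c ∧ restrictForm τ.2.le (facetForm ρ.2) = c • facetForm hγ := by
  refine exists_pos_smul_facetForm (⟨γ, hγ⟩ : Facet τ.1) (fun h0 => hne (Subtype.ext
    (ρ.2.eq_of_restrictForm_eq_zero (facetForm_spec ρ.2) τ.2 h0))) (fun x hx => ?_) fun x hx => ?_
  · exact (facetForm_apply_eq_zero_iff ρ _).2 (lin_mono hγρ hx)
  · exact facetForm_nonneg' ρ _ (τ.2.le hx)

/-- A facet of a facet is contained in a second facet. -/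
theorem exists_other_facet (τ : Facet σ) {γ : Cone Δ} (hγ : IsFacet γ τ.1) :
    ∃ ρ : Facet σ, ρ ≠ τ ∧ γ ≤ ρ.1 := by
  by_contra hcon
  push Not at hcon
  obtain ⟨d, hd, hd'⟩ := exists_relint (hγ.le.trans τ.2.le)
  refine lin_ne_of_lt hγ.lt (le_antisymm (lin_mono hγ.le) fun y hy => ?_)
  -- `N d ± y` lies in the facet
  have key : ∀ y ∈ lin τ.1, ∃ N : ℝ, 0 < N ∧ ∀ M, N ≤ M → y + M • d.1 ∈ τ.1.1 := by
    intro y hy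
    have hyτ : facetForm τ.2 ⟨y, lin_mono τ.2.le hy⟩ = 0 := (facetForm_apply_eq_zero_iff τ _).2 hy
    obtain ⟨N, hN, h⟩ := exists_forall_nonneg_add (fun ρ : Facet σ => facetForm ρ.2 d)
      (fun ρ => facetForm ρ.2 ⟨y, lin_mono τ.2.le hy⟩) fun ρ => by
        by_cases e : ρ = τ
        · subst e
          exact Or.inr ⟨hyτ.ge, facetForm_eq_zero_of_le ρ hγ.le d hd⟩
        · exact Or.inl (hd' ρ (hcon ρ e))
    refine ⟨N, hN, fun M hM => mem_of_mem_lin τ.2.le (mem_of_facetForm_nonneg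
      (⟨y, lin_mono τ.2.le hy⟩ + M • d) fun ρ => ?_) (Submodule.add_mem _ hy
        (Submodule.smul_mem _ _ (Submodule.subset_span (hγ.le hd))))⟩
    rw [map_add, map_smul, smul_eq_mul]
    have h1 := h ρ
    have h2 := facetForm_nonneg' ρ d (τ.2.le (hγ.le hd))
    nlinarith
  obtain ⟨N, hN, h1⟩ := key y hy
  obtain ⟨M, hM, h2⟩ := key (-y) (Submodule.neg_mem _ hy)
  have h3 := h1 _ (le_max_left N M)
  have h4 := h2 _ (le_max_right N M)
  have h5 : y + max N M • d.1 ∈ γ.1 := by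
    refine ((Cone.le_iff_isFaceOf γ τ.1).1 hγ.le).mem_of_add_mem_left h3 h4 ?_
    have : y + max N M • d.1 + (-y + max N M • d.1) = (2 * max N M) • d.1 := by module
    rw [this]
    exact γ.1.smul_mem (by positivity) hd
  have h6 := Submodule.sub_mem (lin γ) (Submodule.subset_span h5)
    (Submodule.smul_mem _ (max N M) (Submodule.subset_span hd))
  rwa [add_sub_cancel_right] at h6

/-- A facet of a facet is contained in no third facet. -/
theorem other_facet_unique (τ : Facet σ) {γ : Cone Δ} (hγ : IsFacet γ τ.1) {ρ π : Facet σ}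
    (hρ : ρ ≠ τ) (hργ : γ ≤ ρ.1) (hπ : π ≠ τ) (hπγ : γ ≤ π.1) : ρ = π := by
  obtain ⟨c, hc, h1⟩ := exists_restrictForm_eq τ ρ hρ hγ hργ
  obtain ⟨d, hd, h2⟩ := exists_restrictForm_eq τ π hπ hγ hπγ
  obtain ⟨a, ha⟩ := (facetForm_spec τ.2).exists_eq_smul τ.2
    (l := c • facetForm π.2 - d • facetForm ρ.2) (by
      intro x hx
      have e1 : facetForm ρ.2 x = c * facetForm hγ ⟨x.1, hx⟩ :=
        DFunLike.congr_fun h1 (⟨x.1, hx⟩ : lin τ.1)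
      have e2 : facetForm π.2 x = d * facetForm hγ ⟨x.1, hx⟩ :=
        DFunLike.congr_fun h2 (⟨x.1, hx⟩ : lin τ.1)
      rw [LinearMap.sub_apply, LinearMap.smul_apply, LinearMap.smul_apply, e1, e2, smul_eq_mul,
        smul_eq_mul]
      ring)
  have key : ∀ x : lin σ, c * facetForm π.2 x - d * facetForm ρ.2 x = a * facetForm τ.2 x :=
    fun x => DFunLike.congr_fun ha x
  have sub : ∀ (α β : Facet σ), (∀ x : lin σ, x.1 ∈ σ.1 → facetForm α.2 x = 0 →
      facetForm β.2 x ≤ 0) → α = β := by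
    intro α β h
    refine Facet.eq_of_le fun x hx => ?_
    by_contra hx'
    have hxσ := α.2.le hx
    have := facetForm_pos_of_notMem β ⟨x, Submodule.subset_span hxσ⟩ hxσ hx'
    exact this.not_ge (h _ hxσ (facetForm_eq_zero_of_le α le_rfl _ hx))
  rcases le_total 0 a with h0 | h0
  · refine (sub π ρ fun x hx hx0 => ?_).symm
    have := key x
    have := facetForm_nonneg' τ x hx
    rw [hx0] at *
    by_contra hcon
    nlinarith [mul_pos hd (not_le.1 hcon), mul_nonneg h0 (facetForm_nonneg' τ x hx)]
  · refine sub ρ π fun x hx hx0 => ?_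
    have := key x
    rw [hx0] at this
    by_contra hcon
    nlinarith [mul_pos hc (not_le.1 hcon), mul_nonneg (neg_nonneg.2 h0) (facetForm_nonneg' τ x hx)]

/-! ### Line shellings and connectivity -/

/-- The value at `p` of the form of a facet, normalized to the value `1` at the interior
point `q`. -/
def level (q p : lin σ) (τ : Facet σ) : ℝ := facetForm τ.2 p / facetForm τ.2 q

/-- The point `p - level(p) q` of the hyperplane spanned by a facet. -/
def project (q : lin σ) (hq : ∀ τ : Facet σ, 0 < facetForm τ.2 q) (p : lin σ) (τ : Facet σ) :
    lin τ.1 :=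
  ⟨(p - level q p τ • q : lin σ).1, (facetForm_apply_eq_zero_iff τ _).1 (by
    rw [map_sub, map_smul, smul_eq_mul, level, div_mul_cancel₀ _ (hq τ).ne', sub_self])⟩

theorem inclusion_project (q : lin σ) (hq : ∀ τ : Facet σ, 0 < facetForm τ.2 q) (p : lin σ)
    (τ : Facet σ) :
    Submodule.inclusion (lin_mono τ.2.le) (project q hq p τ) = p - level q p τ • q := rfl

theorem facetForm_sub_smul (q : lin σ) (hq : ∀ τ : Facet σ, 0 < facetForm τ.2 q) (p : lin σ)
    (ρ : Facet σ) (c : ℝ) :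
    facetForm ρ.2 (p - c • q) = facetForm ρ.2 q * (level q p ρ - c) := by
  rw [map_sub, map_smul, smul_eq_mul, level]
  have := (hq ρ).ne'
  field_simp

/-- The sign at the projected point of the form of a facet `γ` of `τ` compares the levels of the
two facets of `σ` that contain `γ`. -/
theorem facetForm_project_neg_iff (q : lin σ) (hq : ∀ τ : Facet σ, 0 < facetForm τ.2 q)
    (p : lin σ) (τ ρ : Facet σ) (hne : ρ ≠ τ) {γ : Cone Δ} (hγ : IsFacet γ τ.1) (hγρ : γ ≤ ρ.1) :
    facetForm hγ (project q hq p τ) < 0 ↔ level q p ρ < level q p τ := by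
  obtain ⟨c, hc, h⟩ := exists_restrictForm_eq τ ρ hne hγ hγρ
  have h1 : facetForm ρ.2 (p - level q p τ • q) = c * facetForm hγ (project q hq p τ) :=
    DFunLike.congr_fun h (project q hq p τ)
  rw [facetForm_sub_smul q hq] at h1
  have hρ := hq ρ
  constructor
  · intro hneg
    by_contra hcon
    have := mul_nonneg hρ.le (sub_nonneg.2 (not_lt.1 hcon))
    rw [h1] at this
    nlinarith
  · intro hlt
    by_contra hcon
    have := mul_neg_of_pos_of_neg hρ (sub_neg.2 hlt)
    rw [h1] at this
    nlinarith

/-- If a face `δ` of the facet `τ` lies in a facet of smaller level, then it lies in a facet of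
`τ` that separates `τ` from a facet of smaller level: otherwise the projected point, moved far
into the direction of `δ`, would belong to `τ`. -/
theorem exists_adjacent_level_lt (q : lin σ) (hq : ∀ τ : Facet σ, 0 < facetForm τ.2 q)
    (p : lin σ) (τ ρ : Facet σ) {δ : Cone Δ} (hδτ : δ ≤ τ.1) (hδρ : δ ≤ ρ.1)
    (hlt : level q p ρ < level q p τ) :
    ∃ (γ : Cone Δ) (_ : IsFacet γ τ.1) (π : Facet σ), δ ≤ γ ∧ π ≠ τ ∧ γ ≤ π.1 ∧
      level q p π < level q p τ := by
  by_contra hcon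
  push Not at hcon
  obtain ⟨d, hd, hd'⟩ := exists_relint hδτ
  obtain ⟨N, hN, h⟩ := exists_forall_nonneg_add (fun γ : Facet τ.1 => facetForm γ.2 d)
    (fun γ => facetForm γ.2 (project q hq p τ)) fun γ => by
      by_cases e : δ ≤ γ.1
      · refine Or.inr ⟨?_, facetForm_eq_zero_of_le γ e d hd⟩
        obtain ⟨π, hπ, hγπ⟩ := exists_other_facet τ γ.2
        have h1 := hcon γ.1 γ.2 π e hπ hγπ
        by_contra hneg
        exact h1.not_gt ((facetForm_project_neg_iff q hq p τ π hπ γ.2 hγπ).1 (not_le.1 hneg))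
      · exact Or.inl (hd' γ e)
  have h1 : (project q hq p τ + N • d).1 ∈ τ.1.1 := mem_of_facetForm_nonneg _ fun γ => by
    rw [map_add, map_smul, smul_eq_mul]
    exact h γ
  have h2 := facetForm_nonneg' ρ
    (Submodule.inclusion (lin_mono τ.2.le) (project q hq p τ + N • d)) (τ.2.le h1)
  rw [map_add, map_smul, inclusion_project, map_add, map_smul,
    facetForm_eq_zero_of_le ρ hδρ (Submodule.inclusion (lin_mono τ.2.le) d) hd, smul_zero,
    add_zero, facetForm_sub_smul q hq] at h2
  have := mul_neg_of_pos_of_neg (hq ρ) (sub_neg.2 hlt)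
  linarith

/-- The facets of `σ` that contain a given face are connected through faces of codimension two
that contain it, by the argument of the simplex method. -/
theorem facet_connected {δ : Cone Δ} (P : Facet σ → Prop) (ρ : Facet σ) (hρ : δ ≤ ρ.1) (h0 : P ρ)
    (hstep : ∀ (τ π : Facet σ) (γ : Cone Δ), τ ≠ π → IsFacet γ τ.1 → IsFacet γ π.1 → δ ≤ γ →
      P π → P τ)
    (τ : Facet σ) (hτ : δ ≤ τ.1) : P τ := by
  obtain ⟨q, -, hq⟩ := exists_interior σ
  obtain ⟨p, hp, hp'⟩ := exists_relint ρ.2.le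
  have hwf : WellFounded fun τ π : Facet σ => level q p τ < level q p π :=
    @Finite.wellFounded_of_trans_of_irrefl _ _ _ ⟨fun _ _ _ => lt_trans⟩ ⟨fun _ => lt_irrefl _⟩
  induction τ using hwf.induction with
  | _ τ ih =>
    by_cases e : τ = ρ
    · exact e ▸ h0
    have hlt : level q p ρ < level q p τ := by
      rw [level, level, facetForm_eq_zero_of_le ρ le_rfl p hp, zero_div]
      exact div_pos (hp' τ fun h => e (Facet.eq_of_le h).symm) (hq τ)
    obtain ⟨γ, hγ, π, hδγ, hne, hγπ, hlt'⟩ := exists_adjacent_level_lt q hq p τ ρ hτ hρ hlt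
    exact hstep τ π γ hne.symm hγ (isFacet_of_other τ π hγ hγπ) hδγ
      (ih π hlt' (hδγ.trans hγπ))

/-- Any point can be moved to a point with pairwise distinct levels without changing the set of
facets whose forms are negative. -/
theorem exists_generic (q : lin σ) (hq : ∀ τ : Facet σ, 0 < facetForm τ.2 q) (y : lin σ) :
    ∃ p : lin σ, Function.Injective (level q p) ∧
      ∀ τ : Facet σ, facetForm τ.2 p < 0 ↔ facetForm τ.2 y < 0 := by
  classical
  let nf : Facet σ → Module.Dual ℝ (lin σ) := fun τ => (facetForm τ.2 q)⁻¹ • facetForm τ.2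
  have hnf : ∀ p τ, level q p τ = nf τ p := fun p τ => by
    change _ = (facetForm τ.2 q)⁻¹ * facetForm τ.2 p
    rw [level, div_eq_inv_mul]
  have hinj : Function.Injective nf := by
    intro τ ρ h
    refine Facet.eq_of_le fun x hx => mem_of_mem_lin ρ.2.le (τ.2.le hx) ?_
    have hx' : x ∈ lin σ := Submodule.subset_span (τ.2.le hx)
    have h1 : nf τ ⟨x, hx'⟩ = nf ρ ⟨x, hx'⟩ := by rw [h]
    rw [← hnf, ← hnf, level, level, facetForm_eq_zero_of_le τ le_rfl _ hx, zero_div, eq_comm,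
      div_eq_zero_iff] at h1
    exact (facetForm_apply_eq_zero_iff ρ _).1 (h1.resolve_right (hq ρ).ne')
  obtain ⟨z, hz⟩ : ∃ z : lin σ, ∀ i : {i : Facet σ × Facet σ // i.1 ≠ i.2},
      (nf i.1.1 - nf i.1.2) z ≠ 0 := by
    obtain ⟨z, hz⟩ := Module.exists_dual_forall_apply_ne_zero (K := ℝ)
      (fun i : {i : Facet σ × Facet σ // i.1 ≠ i.2} => nf i.1.1 - nf i.1.2)
      (fun i => sub_ne_zero.2 fun h => i.2 (hinj h))
    refine ⟨(Module.evalEquiv ℝ (lin σ)).symm z, fun i => ?_⟩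
    rw [Module.apply_evalEquiv_symm_apply]
    exact hz i
  obtain ⟨N, -, hN⟩ := exists_forall_nonneg_add (fun τ : Facet σ => facetForm τ.2 q)
    (fun τ => facetForm τ.2 z - facetForm τ.2 q) fun τ => Or.inl (hq τ)
  have hz' : ∀ τ : Facet σ, 0 < facetForm τ.2 (z + N • q) := fun τ => by
    rw [map_add, map_smul, smul_eq_mul]
    have := hN τ
    have := hq τ
    linarith
  have hdist : ∀ τ ρ : Facet σ, τ ≠ ρ → nf τ (z + N • q) ≠ nf ρ (z + N • q) := by
    intro τ ρ hne h
    have h1 : ∀ τ : Facet σ, nf τ q = 1 := fun τ => inv_mul_cancel₀ (hq τ).ne'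
    refine hz ⟨(τ, ρ), hne⟩ ?_
    rw [map_add, map_add, map_smul, map_smul, h1, h1] at h
    rw [LinearMap.sub_apply, sub_eq_zero]
    exact add_right_cancel h
  have hcont : ∀ f : Module.Dual ℝ (lin σ), Continuous fun ε : ℝ => f (y + ε • (z + N • q)) := by
    intro f
    have : (fun ε : ℝ => f (y + ε • (z + N • q))) = fun ε => f y + ε * f (z + N • q) := by
      funext ε; rw [map_add, map_smul, smul_eq_mul]
    rw [this]
    fun_prop
  have hev1 : ∀ᶠ ε : ℝ in nhdsWithin 0 (Set.Ioi 0), ∀ τ : Facet σ,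
      (facetForm τ.2 (y + ε • (z + N • q)) < 0 ↔ facetForm τ.2 y < 0) := by
    refine Filter.eventually_all.2 fun τ => ?_
    rcases lt_or_ge (facetForm τ.2 y) 0 with h | h
    · have h1 := ((hcont (facetForm τ.2)).tendsto 0).eventually
        (gt_mem_nhds (show facetForm τ.2 (y + (0 : ℝ) • (z + N • q)) < 0 by simpa using h))
      filter_upwards [h1.filter_mono nhdsWithin_le_nhds] with ε hε
      exact ⟨fun _ => h, fun _ => hε⟩
    · filter_upwards [self_mem_nhdsWithin] with ε hε
      rw [map_add, map_smul, smul_eq_mul]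
      have h2 := mul_pos (show (0 : ℝ) < ε from hε) (hz' τ)
      constructor <;> intro h3 <;> linarith
  have hev2 : ∀ᶠ ε : ℝ in nhdsWithin 0 (Set.Ioi 0), ∀ i : Facet σ × Facet σ, i.1 ≠ i.2 →
      nf i.1 (y + ε • (z + N • q)) ≠ nf i.2 (y + ε • (z + N • q)) := by
    refine Filter.eventually_all.2 fun i => ?_
    by_cases e : i.1 = i.2
    · exact Filter.Eventually.of_forall fun ε h => (h e).elim
    -- the two levels agree for at most one `ε`
    have hc := sub_ne_zero.2 (hdist _ _ e)
    set c := nf i.1 (z + N • q) - nf i.2 (z + N • q) with hcdef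
    have key : ∀ ε : ℝ, nf i.1 (y + ε • (z + N • q)) = nf i.2 (y + ε • (z + N • q)) →
        ε = -((nf i.1 y - nf i.2 y) / c) := by
      intro ε h
      rw [map_add, map_add, map_smul, map_smul, smul_eq_mul, smul_eq_mul] at h
      rw [← neg_div, eq_div_iff hc, hcdef]
      linarith
    by_cases e0 : (0 : ℝ) = -((nf i.1 y - nf i.2 y) / c)
    · filter_upwards [self_mem_nhdsWithin] with ε hε _ h
      rw [key ε h, ← e0] at hε
      exact lt_irrefl (0 : ℝ) hε
    · have h1 : ∀ᶠ ε : ℝ in nhds 0, ε ≠ -((nf i.1 y - nf i.2 y) / c) := isOpen_ne.mem_nhds e0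
      filter_upwards [h1.filter_mono nhdsWithin_le_nhds] with ε hε _ h
      exact hε (key ε h)
  obtain ⟨ε, h1, h2⟩ := (hev1.and hev2).exists
  refine ⟨y + ε • (z + N • q), fun τ ρ h => ?_, h1⟩
  by_contra hne
  exact h2 (τ, ρ) hne (by rw [← hnf, ← hnf, h])

end FacetGeometry

/-! ### Graded modules -/

section Components

variable {M : Type*} [AddCommGroup M] {G : ℤ → AddSubgroup M}

/-- The homogeneous components with respect to an internal grading. -/
def component (hG : DirectSum.IsInternal G) (i : ℤ) : M →+ M where
  toFun x := letI := hG.chooseDecomposition; (DirectSum.decompose G x i : M)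
  map_zero' := by simp
  map_add' x y := by simp

variable (hG : DirectSum.IsInternal G)

theorem component_mem (i : ℤ) (x : M) : component hG i x ∈ G i := SetLike.coe_mem _

theorem component_of_mem {i : ℤ} {x : M} (hx : x ∈ G i) : component hG i x = x :=
  let _ := hG.chooseDecomposition
  DirectSum.decompose_of_mem_same G hx

theorem component_of_mem_ne {i j : ℤ} {x : M} (hx : x ∈ G i) (h : i ≠ j) :
    component hG j x = 0 :=
  let _ := hG.chooseDecomposition
  DirectSum.decompose_of_mem_ne G hx h

theorem exists_sum_component (x : M) : ∃ s : Finset ℤ, x = ∑ i ∈ s, component hG i x := by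
  classical
  let _ := hG.chooseDecomposition
  exact ⟨_, (DirectSum.sum_support_decompose G x).symm⟩

include hG in
theorem grading_induction {P : M → Prop} (h0 : P 0) (hadd : ∀ x y, P x → P y → P (x + y))
    (hhom : ∀ i, ∀ x ∈ G i, P x) (x : M) : P x := by
  obtain ⟨s, hs⟩ := exists_sum_component hG x
  rw [hs]
  exact Finset.sum_induction _ P hadd h0 fun i _ => hhom i _ (component_mem hG i x)

theorem mem_of_component_eq_zero {i : ℤ} {x : M} (h : ∀ j, j ≠ i → component hG j x = 0) :
    x ∈ G i := by
  obtain ⟨s, hs⟩ := exists_sum_component hG x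
  rw [hs]
  refine AddSubgroup.sum_mem _ fun j _ => ?_
  by_cases e : j = i
  · exact e ▸ component_mem hG j x
  · rw [h j e]; exact AddSubgroup.zero_mem _

variable {N : Type*} [AddCommGroup N] {H : ℤ → AddSubgroup N} (hH : DirectSum.IsInternal H)

/-- A homomorphism of degree zero commutes with the homogeneous components. -/
theorem component_map (f : M →+ N) (hf : ∀ i, ∀ x ∈ G i, f x ∈ H i) (i : ℤ) (x : M) :
    component hH i (f x) = f (component hG i x) := by
  induction x using grading_induction hG with
  | h0 => simp
  | hadd x y hx hy => simp only [map_add, hx, hy]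
  | hhom j x hx =>
    by_cases e : j = i
    · subst e
      rw [component_of_mem hG hx, component_of_mem hH (hf _ x hx)]
    · rw [component_of_mem_ne hG hx e, component_of_mem_ne hH (hf _ x hx) e, map_zero]

include hG hH in
/-- An injective homomorphism of degree zero reflects degrees. -/
theorem mem_of_injective (f : M →+ N) (hf : ∀ i, ∀ x ∈ G i, f x ∈ H i)
    (hinj : Function.Injective f) {i : ℤ} {x : M} (hx : f x ∈ H i) : x ∈ G i := by
  refine mem_of_component_eq_zero hG fun j hj => hinj ?_
  rw [← component_map hG hH f hf, component_of_mem_ne hH hx hj.symm, map_zero]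

include hG in
/-- Internal gradings are transported along isomorphisms, with a shift of the degree. -/
theorem isInternal_of_equiv (e : M ≃+ N) (k : ℤ) (h : ∀ i y, y ∈ H (i + k) ↔ e.symm y ∈ G i) :
    DirectSum.IsInternal H := by
  classical
  have h' : ∀ i y, y ∈ H i ↔ e.symm y ∈ G (i - k) := fun i y => by
    rw [← h (i - k) y, sub_add_cancel]
  refine isInternal_of_components H
    (fun i => e.toAddMonoidHom.comp ((component hG (i - k)).comp e.symm.toAddMonoidHom))
    (fun i x hx => ?_) (fun i j hij x hx => ?_) fun x => ?_
  · change e (component hG (i - k) (e.symm x)) = x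
    rw [component_of_mem hG ((h' i x).1 hx), e.apply_symm_apply]
  · change e (component hG (j - k) (e.symm x)) = 0
    rw [component_of_mem_ne hG ((h' i x).1 hx) (by omega), map_zero]
  · obtain ⟨s, hs⟩ := exists_sum_component hG (e.symm x)
    refine ⟨s.image (· + k), fun i => e (component hG (i - k) (e.symm x)), fun i => ?_, ?_⟩
    · rw [h', e.symm_apply_apply]; exact component_mem hG _ _
    · rw [Finset.sum_image (by intro a _ b _ hab; simpa using hab)]
      simp only [add_sub_cancel_right]
      rw [← map_sum, ← hs, e.apply_symm_apply]

/-- A subgroup that contains the components of its elements inherits the grading. -/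
theorem isInternal_comap (K : AddSubgroup M) (hK : ∀ x ∈ K, ∀ i, component hG i x ∈ K) :
    DirectSum.IsInternal fun i => (G i).comap K.subtype := by
  refine isInternal_of_components _
    (fun i => ((component hG i).comp K.subtype).codRestrict K fun x => hK x x.2 i)
    (fun i x hx => Subtype.ext (component_of_mem hG hx))
    (fun i j hij x hx => Subtype.ext (component_of_mem_ne hG hx hij)) fun x => ?_
  obtain ⟨s, hs⟩ := exists_sum_component hG x.1
  refine ⟨s, fun i => ⟨component hG i x.1, hK x x.2 i⟩, fun i => component_mem hG i x.1,
    Subtype.ext ?_⟩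
  rw [AddSubgroup.val_finsetSum]
  exact hs

end Components

section GradedModules

variable {R : Type*} [CommRing R] [Algebra ℝ R] (𝒜 : ℤ → Submodule ℝ R) [GradedAlgebra 𝒜]
  {M : Type*} [AddCommGroup M] [Module R M] {G : ℤ → AddSubgroup M}

variable {𝒜} in
/-- The homogeneous components of a multiple of a homogeneous element. -/
theorem component_smul_of_mem (hG : DirectSum.IsInternal G)
    (hsmul : ∀ (i j : ℤ) (a : R) (x : M), a ∈ 𝒜 i → x ∈ G j → a • x ∈ G (i + j))
    (a : R) {x : M} {d : ℤ} (hx : x ∈ G d) (n : ℤ) :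
    component hG n (a • x) = (DirectSum.decompose 𝒜 a (n - d) : R) • x := by
  classical
  induction a using DirectSum.Decomposition.inductionOn 𝒜 with
  | zero => simp
  | @homogeneous i a =>
    have h1 := hsmul i d a x a.2 hx
    by_cases e : i = n - d
    · subst e
      rw [sub_add_cancel] at h1
      rw [component_of_mem hG h1, DirectSum.decompose_of_mem_same 𝒜 a.2]
    · rw [component_of_mem_ne hG h1 (by omega), DirectSum.decompose_of_mem_ne 𝒜 a.2 e, zero_smul]
  | add a b ha hb =>
    rw [add_smul, map_add, ha, hb, DirectSum.decompose_add, DirectSum.add_apply, Submodule.coe_add,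
      add_smul]

/-- The coordinates of a homogeneous element with respect to a homogeneous basis are
homogeneous. -/
theorem repr_mem_of_mem (hG : DirectSum.IsInternal G)
    (hsmul : ∀ (i j : ℤ) (a : R) (x : M), a ∈ 𝒜 i → x ∈ G j → a • x ∈ G (i + j))
    {ι : Type*} [Fintype ι] (b : Module.Basis ι R M) (d : ι → ℤ) (hb : ∀ k, b k ∈ G (d k))
    {n : ℤ} {x : M} (hx : x ∈ G n) (k : ι) : b.repr x k ∈ 𝒜 (n - d k) := by
  classical
  have h1 : x = ∑ k, (DirectSum.decompose 𝒜 (b.repr x k) (n - d k) : R) • b k := by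
    conv_lhs => rw [← component_of_mem hG hx, ← b.sum_repr x, map_sum]
    exact Finset.sum_congr rfl fun k _ => component_smul_of_mem hG hsmul _ (hb k) n
  have h2 : b.repr x k = (DirectSum.decompose 𝒜 (b.repr x k) (n - d k) : R) := by
    conv_lhs => rw [h1]
    rw [map_sum, Finset.sum_apply']
    simp [Finsupp.single_apply]
  rw [h2]
  exact SetLike.coe_mem _

/-- The linear forms of degree `q` on a graded module. -/
def homGrade (G : ℤ → AddSubgroup M) (q : ℤ) : AddSubgroup (M →ₗ[R] R) where
  carrier := {f | ∀ (i : ℤ) (x : M), x ∈ G i → f x ∈ 𝒜 (i + q)}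
  zero_mem' := fun _ _ _ => Submodule.zero_mem _
  add_mem' := fun hf hg i x hx => Submodule.add_mem _ (hf i x hx) (hg i x hx)
  neg_mem' := fun hf i x hx => Submodule.neg_mem _ (hf i x hx)

/-- The dual of a graded module with a homogeneous basis is graded. -/
theorem homGrade_isInternal (hG : DirectSum.IsInternal G)
    (hsmul : ∀ (i j : ℤ) (a : R) (x : M), a ∈ 𝒜 i → x ∈ G j → a • x ∈ G (i + j))
    {ι : Type*} [Fintype ι] (b : Module.Basis ι R M) (d : ι → ℤ) (hb : ∀ k, b k ∈ G (d k)) :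
    DirectSum.IsInternal (homGrade 𝒜 G) := by
  classical
  have hconstr : ∀ (q : ℤ) (v : ι → R), (∀ k, v k ∈ 𝒜 (d k + q)) →
      b.constr ℕ v ∈ homGrade 𝒜 G q := by
    intro q v hv i x hx
    rw [Module.Basis.constr_apply_fintype]
    refine Submodule.sum_mem _ fun k _ => ?_
    have h1 := SetLike.mul_mem_graded (repr_mem_of_mem 𝒜 hG hsmul b d hb hx k) (hv k)
    rwa [show i - d k + (d k + q) = i + q by ring] at h1
  refine isInternal_of_components _ (fun q =>
    { toFun := fun f => b.constr ℕ fun k => (DirectSum.decompose 𝒜 (f (b k)) (d k + q) : R)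
      map_zero' := b.ext fun k => by simp
      map_add' := fun f g => b.ext fun k => by simp }) ?_ ?_ ?_
  · intro q f hf
    refine b.ext fun k => ?_
    exact (b.constr_basis ℕ _ k).trans (DirectSum.decompose_of_mem_same 𝒜 (hf _ _ (hb k)))
  · intro q r hqr f hf
    refine b.ext fun k => ?_
    exact (b.constr_basis ℕ _ k).trans
      (DirectSum.decompose_of_mem_ne 𝒜 (hf _ _ (hb k)) (by omega))
  · intro f
    refine ⟨Finset.univ.biUnion fun k => (DirectSum.decompose 𝒜 (f (b k))).support.image (· - d k),
      fun q => b.constr ℕ fun k => (DirectSum.decompose 𝒜 (f (b k)) (d k + q) : R),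
      fun q => hconstr q _ fun k => SetLike.coe_mem _, b.ext fun k => ?_⟩
    rw [LinearMap.sum_apply]
    simp only [Module.Basis.constr_basis]
    conv_lhs => rw [← DirectSum.sum_support_decompose 𝒜 (f (b k))]
    rw [← Finset.sum_subset (Finset.subset_biUnion_of_mem
      (fun k => (DirectSum.decompose 𝒜 (f (b k))).support.image (· - d k)) (Finset.mem_univ k))]
    · rw [Finset.sum_image (by intro a _ b _ hab; simpa using hab)]
      exact Finset.sum_congr rfl fun i _ => by rw [add_sub_cancel]
    · intro q _ hq
      by_contra hne
      refine hq (Finset.mem_image.2 ⟨d k + q, DFinsupp.mem_support_iff.2 fun h0 => hne ?_, by ring⟩)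
      rw [h0]; rfl

/-- A finitely generated projective graded module over a connected graded domain has a homogeneous
basis: a minimal finite set of homogeneous generators. -/
theorem exists_homogeneous_basis [IsDomain R] (ε : R →ₐ[ℝ] ℝ)
    (hε : ∀ i, i ≠ 0 → ∀ a ∈ 𝒜 i, ε a = 0)
    (h𝒜 : ∀ a ∈ 𝒜 0, ∃ r : ℝ, algebraMap ℝ R r = a) [Module.Finite R M] [Module.Projective R M]
    (hG : DirectSum.IsInternal G)
    (hsmul : ∀ (i j : ℤ) (a : R) (x : M), a ∈ 𝒜 i → x ∈ G j → a • x ∈ G (i + j)) :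
    ∃ (s : Finset M) (b : Module.Basis s R M) (d : s → ℤ), ∀ k, b k ∈ G (d k) := by
  classical
  have hex : ∃ n, ∃ s : Finset M, s.card = n ∧ (∀ x ∈ s, ∃ d, x ∈ G d) ∧
      Submodule.span R (s : Set M) = ⊤ := by
    obtain ⟨S, hS⟩ := Module.Finite.fg_top (R := R) (M := M)
    choose t ht using exists_sum_component hG
    refine ⟨_, S.biUnion fun x => (t x).image fun i => component hG i x, rfl, ?_, ?_⟩
    · intro x hx
      obtain ⟨y, -, hy⟩ := Finset.mem_biUnion.1 hx
      obtain ⟨i, -, rfl⟩ := Finset.mem_image.1 hy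
      exact ⟨i, component_mem hG i y⟩
    · rw [eq_top_iff, ← hS, Submodule.span_le]
      intro x hx
      rw [SetLike.mem_coe, ht x]
      exact Submodule.sum_mem _ fun i hi => Submodule.subset_span (Finset.mem_coe.2
        (Finset.mem_biUnion.2 ⟨x, hx, Finset.mem_image_of_mem _ hi⟩))
  obtain ⟨s, hcard, hhom, hspan⟩ := Nat.find_spec hex
  choose d hd using fun x : s => hhom x.1 x.2
  let π : (s → R) →ₗ[R] M := Fintype.linearCombination R fun x : s => x.1
  have hπ : ∀ r, π r = ∑ x : s, r x • x.1 := fun r => Fintype.linearCombination_apply _ _ _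
  have hsurj : Function.Surjective π := by
    rw [← LinearMap.range_eq_top, Fintype.range_linearCombination, ← hspan]
    congr 1
    ext x
    simp
  -- by minimality the relations have coefficients in the augmentation ideal
  have hrel : ∀ r, π r = 0 → ∀ x, ε (r x) = 0 := by
    intro r hr x
    by_contra hne
    have h0 : (DirectSum.decompose 𝒜 (r x) 0 : R) ≠ 0 := by
      intro h0
      refine hne ?_
      rw [← DirectSum.sum_support_decompose 𝒜 (r x), map_sum]
      refine Finset.sum_eq_zero fun i _ => ?_
      by_cases e : i = 0
      · subst e; rw [h0, map_zero]
      · exact hε i e _ (SetLike.coe_mem _)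
    obtain ⟨c, hc⟩ := h𝒜 _ (SetLike.coe_mem (DirectSum.decompose 𝒜 (r x) 0))
    have hc0 : c ≠ 0 := by rintro rfl; rw [map_zero] at hc; exact h0 hc.symm
    have h1 : ∑ y : s, (DirectSum.decompose 𝒜 (r y) (d x - d y) : R) • y.1 = 0 := by
      have h2 := congrArg (component hG (d x)) hr
      rw [hπ, map_sum, map_zero] at h2
      rw [← h2]
      exact Finset.sum_congr rfl fun y _ => (component_smul_of_mem hG hsmul _ (hd y) _).symm
    rw [← Finset.add_sum_erase _ _ (Finset.mem_univ x), sub_self, ← hc] at h1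
    have h2 : x.1 ∈ Submodule.span R ((s.erase x.1 : Finset M) : Set M) := by
      have h3 : x.1 = -((algebraMap ℝ R c⁻¹) •
          ∑ y ∈ Finset.univ.erase x, (DirectSum.decompose 𝒜 (r y) (d x - d y) : R) • y.1) := by
        rw [eq_neg_iff_add_eq_zero, ← smul_zero (algebraMap ℝ R c⁻¹), ← h1, smul_add, smul_smul,
          ← map_mul, inv_mul_cancel₀ hc0, map_one, one_smul]
      suffices h4 : -((algebraMap ℝ R c⁻¹) •
          ∑ y ∈ Finset.univ.erase x, (DirectSum.decompose 𝒜 (r y) (d x - d y) : R) • y.1) ∈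
          Submodule.span R ((s.erase x.1 : Finset M) : Set M) by rwa [← h3] at h4
      refine Submodule.neg_mem _ (Submodule.smul_mem _ _ (Submodule.sum_mem _ fun y hy =>
        Submodule.smul_mem _ _ (Submodule.subset_span ?_)))
      exact Finset.mem_coe.2 (Finset.mem_erase.2
        ⟨fun h => (Finset.mem_erase.1 hy).1 (Subtype.ext h), y.2⟩)
    refine Nat.find_min hex (m := (s.erase x.1).card) ?_ ⟨s.erase x.1, rfl,
      fun y hy => hhom y (Finset.mem_of_mem_erase hy), ?_⟩
    · rw [← hcard]; exact Finset.card_erase_lt_of_mem x.2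
    · rw [eq_top_iff, ← hspan, Submodule.span_le]
      intro y hy
      by_cases e : y = x.1
      · rw [e]; exact h2
      · exact Submodule.subset_span (Finset.mem_coe.2 (Finset.mem_erase.2 ⟨e, hy⟩))
  -- the module of relations is a direct summand `K` with `K = m K`, hence zero
  obtain ⟨g, hg⟩ := Module.projective_lifting_property π LinearMap.id hsurj
  have hg' : ∀ x, π (g x) = x := fun x => DFunLike.congr_fun hg x
  let I : Ideal R := RingHom.ker ε
  let K : Submodule R (s → R) := LinearMap.ker π
  have hKfg : K.FG := by
    have : K = LinearMap.range (LinearMap.id - g ∘ₗ π) := by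
      ext r
      constructor
      · intro hr
        refine ⟨r, ?_⟩
        rw [LinearMap.sub_apply, LinearMap.comp_apply, LinearMap.mem_ker.1 hr, map_zero, sub_zero]
        rfl
      · rintro ⟨r, rfl⟩
        rw [LinearMap.mem_ker, LinearMap.sub_apply, map_sub, LinearMap.comp_apply, hg']
        exact sub_self _
    rw [this]
    exact Submodule.FG.of_finite
  have hKI : K ≤ I • K := by
    intro r hr
    have h1 : r = ∑ x, r x • (Pi.single x 1 - g (π (Pi.single x 1))) := by
      have h2 : (LinearMap.id - g ∘ₗ π : (s → R) →ₗ[R] (s → R)) r = r := by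
        rw [LinearMap.sub_apply, LinearMap.comp_apply, LinearMap.mem_ker.1 hr, map_zero, sub_zero]
        rfl
      conv_lhs => rw [← h2, pi_eq_sum_univ' r, map_sum]
      refine Finset.sum_congr rfl fun x _ => ?_
      rw [map_smul]
      rfl
    rw [h1]
    refine Submodule.sum_mem _ fun x _ => Submodule.smul_mem_smul
      (RingHom.mem_ker.2 (hrel r hr x)) ?_
    rw [LinearMap.mem_ker, map_sub, hg', sub_self]
  obtain ⟨a, ha, ha'⟩ := Submodule.exists_sub_one_mem_and_smul_eq_zero_of_fg_of_le_smul I K hKfg hKI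
  have ha0 : a ≠ 0 := by
    rintro rfl
    have : ε (0 - 1) = 0 := ha
    rw [zero_sub, map_neg, map_one] at this
    norm_num at this
  have hinj : Function.Injective π := by
    rw [← LinearMap.ker_eq_bot, eq_bot_iff]
    intro r hr
    have h1 := ha' r hr
    exact (smul_eq_zero.1 h1).resolve_left ha0
  refine ⟨s, (Module.Basis.ofEquivFun (LinearEquiv.ofBijective π ⟨hinj, hsurj⟩).symm), d,
    fun k => ?_⟩
  have : (Module.Basis.ofEquivFun (LinearEquiv.ofBijective π ⟨hinj, hsurj⟩).symm) k = k.1 := by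
    rw [Module.Basis.coe_ofEquivFun]
    change π (Pi.single k 1) = k.1
    rw [hπ]
    simp [Pi.single_apply]
  rw [this]
  exact hd k

end GradedModules

/-! ### Projectivity of kernels -/

section Kernel

variable {R R' : Type*} [CommRing R] [CommRing R'] (ρ : R →+* R') (hρ : Function.Surjective ρ)
  {P : Type*} [AddCommGroup P] [Module R P]

include hρ in
/-- A semilinear form on a projective module with values in a quotient ring lifts. -/
theorem exists_lift_semilinear [Module.Projective R P] (g : P →ₛₗ[ρ] R') :
    ∃ c : P →ₗ[R] R, ∀ x, ρ (c x) = g x := by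
  let _ : Module R R' := Module.compHom R' ρ
  let ρ' : R →ₗ[R] R' := { toFun := ρ, map_add' := map_add ρ, map_smul' := map_mul ρ }
  let g' : P →ₗ[R] R' := { toFun := g, map_add' := map_add g, map_smul' := g.map_smulₛₗ }
  obtain ⟨c, hc⟩ := Module.projective_lifting_property ρ' g' hρ
  exact ⟨c, fun x => DFunLike.congr_fun hc x⟩

include hρ in
/-- The kernel of a surjection from a projective module over a domain `R` onto a finitely generated
projective module over `R / (h)` is projective. -/
theorem projective_ker_of_semilinear [IsDomain R] [Module.Projective R P] {h : R} (h0 : h ≠ 0)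
    (hker : ∀ a, ρ a = 0 ↔ ∃ b, a = h * b) {M : Type*} [AddCommGroup M] [Module R' M]
    [Module.Finite R' M] [Module.Projective R' M] (π : P →ₛₗ[ρ] M) (hπ : Function.Surjective π) :
    Module.Projective R (LinearMap.ker π) := by
  obtain ⟨n, f, hf⟩ := Module.Finite.exists_fin' R' M
  obtain ⟨g, hg⟩ := Module.projective_lifting_property f LinearMap.id hf
  choose p hp using fun i : Fin n => hπ (f (Pi.single i 1))
  choose c hc using fun i : Fin n => exists_lift_semilinear ρ hρ
    (((LinearMap.proj i : (Fin n → R') →ₗ[R'] R') ∘ₗ g).comp π)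
  have hc' : ∀ i x, ρ (c i x) = g (π x) i := hc
  have hfg : ∀ y, ∑ i, g y i • f (Pi.single i 1) = y := by
    intro y
    have h1 : f (g y) = y := DFunLike.congr_fun hg y
    conv_rhs => rw [← h1, pi_eq_sum_univ' (g y), map_sum]
    exact Finset.sum_congr rfl fun i _ => (map_smul f _ _).symm
  -- `t` is the identity modulo the kernel, and it maps the kernel into `h P`
  let t : P →ₗ[R] P := ∑ i, (c i).smulRight (p i)
  have ht : ∀ x, t x = ∑ i, c i x • p i := fun x => by
    simp [t]
  have hπt : ∀ x, π (t x) = π x := by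
    intro x
    rw [ht, map_sum, ← hfg (π x)]
    refine Finset.sum_congr rfl fun i _ => ?_
    rw [π.map_smulₛₗ, hc', hp]
  have htk : ∀ x : LinearMap.ker π, ∃ u, t x = h • u := by
    intro x
    have h1 : ∀ i, ∃ b, c i x = h * b := fun i => (hker _).1 (by
      rw [hc', LinearMap.mem_ker.1 x.2, map_zero]; rfl)
    choose b hb using h1
    refine ⟨∑ i, b i • p i, ?_⟩
    rw [ht, Finset.smul_sum]
    exact Finset.sum_congr rfl fun i _ => by rw [hb, mul_smul]
  choose u hu using htk
  have hinj := smul_right_injective P h0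
  have hρh : ρ h = 0 := (hker h).2 ⟨1, (mul_one h).symm⟩
  let u' : LinearMap.ker π →ₗ[R] P :=
    { toFun := u
      map_add' := fun x y => hinj (by
        change h • _ = h • _
        rw [smul_add, ← hu, ← hu, ← hu, ← map_add]; rfl)
      map_smul' := fun a x => hinj (by
        change h • _ = h • a • _
        rw [smul_comm, ← hu, ← hu, ← map_smul]; rfl) }
  let r : P × P →ₗ[R] LinearMap.ker π :=
    LinearMap.codRestrict (LinearMap.ker π) (LinearMap.coprod (LinearMap.id - t) (h • LinearMap.id))
      fun x => by
        change π (x.1 - t x.1 + h • x.2) = 0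
        rw [map_add, map_sub, hπt, sub_self, π.map_smulₛₗ, hρh, zero_smul, add_zero]
  refine Module.Projective.of_split (LinearMap.prod (LinearMap.ker π).subtype u') r ?_
  refine LinearMap.ext fun x => Subtype.ext ?_
  change x.1 - t x.1 + h • u x = x.1
  rw [← hu, sub_add_cancel]

end Kernel

section Extension

/-! ### Sections vanishing on a set of facets -/

/-- If `u` vanishes on each facet of a finite set, it is divisible by the product of the
equations of these facets. -/
theorem prod_form_dvd [FiniteDimensional ℝ V] {σ : Cone Δ} (S : Finset (Facet σ)) (u : A σ)
    (hu : ∀ τ ∈ S, restrict τ.2.le u = 0) : ∏ τ ∈ S, form σ (facetForm τ.2) ∣ u := by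
  classical
  induction S using Finset.induction_on generalizing u with
  | empty => simp
  | insert τ S hτ ih =>
    obtain ⟨b, rfl⟩ := exists_eq_form_mul τ.2 (facetForm_spec τ.2)
      (hu τ (Finset.mem_insert_self _ _))
    rw [Finset.prod_insert hτ]
    refine mul_dvd_mul_left _ (ih b fun ρ hρ => ?_)
    have h1 := hu ρ (Finset.mem_insert_of_mem hρ)
    rw [map_mul, restrict_form] at h1
    refine (mul_eq_zero.1 h1).resolve_left (form_ne_zero fun h0 => hτ ?_)
    rwa [Subtype.ext (τ.2.eq_of_restrictForm_eq_zero (facetForm_spec τ.2) ρ.2 h0)]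

/-- The sections over `σ` that vanish on the facets in `S`. -/
def relFacets (F : GradedSystem.{u, w} Δ) (σ : Cone Δ) (S : Set (Facet σ)) :
    Submodule (A σ) (F.obj σ) where
  carrier := {x | ∀ τ ∈ S, F.res τ.2.le x = 0}
  zero_mem' := fun τ _ => map_zero _
  add_mem' := fun hx hy τ h => by rw [map_add, hx τ h, hy τ h, add_zero]
  smul_mem' := fun a x hx τ h => by rw [F.res_smul, hx τ h, smul_zero]

theorem rel_le_relFacets (F : GradedSystem.{u, w} Δ) (σ : Cone Δ) (S : Set (Facet σ)) :
    rel F σ ≤ relFacets F σ S := fun _ hx τ _ => hx τ.1 τ.2.lt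

theorem IsSheaf.res_eq_zero_of_le {F : GradedSystem.{u, w} Δ} (hF : IsSheaf F) {σ τ γ : Cone Δ}
    (h : τ ≤ σ) (h' : γ ≤ τ) {x : F.obj σ} (hx : F.res h x = 0) : F.res (h'.trans h) x = 0 := by
  rw [← hF.res_comp h h', hx, map_zero]

instance (F : PerverseSheaf.{u, w} Δ) (σ : Cone Δ) : Module.Free (A σ) (F.obj σ) :=
  F.isPerverse.free σ

instance (F : PerverseSheaf.{u, w} Δ) (σ : Cone Δ) : Module.Finite (A σ) (F.obj σ) :=
  F.isPerverse.finite σ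

/-! ### Extending sections -/

/-- A section over a face that vanishes on its boundary extends to a section that vanishes on all
faces not containing the given one. -/
theorem exists_extend_rel (F : PerverseSheaf.{u, w} Δ) {σ γ : Cone Δ} (hγ : γ < σ)
    (g : rel F.toGradedSystem γ) :
    ∃ x : F.obj σ, F.res hγ.le x = g.1 ∧
      ∀ δ (hδ : δ < σ), ¬ γ ≤ δ → F.res hδ.le x = 0 := by
  classical
  let s : Section F.toGradedSystem
      (⟨{δ | δ < σ ∧ ¬ γ < δ}, fun a b hba ha =>
        ⟨hba.trans_lt ha.1, fun h => ha.2 (h.trans_le hba)⟩⟩ : LowerSet (Cone Δ)) :=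
    { val := fun δ _ => if e : δ = γ then e ▸ g.1 else 0
      compatible := by
        intro δ ε hδ hε hle
        by_cases e1 : δ = γ
        · subst e1
          by_cases e2 : ε = δ
          · subst e2
            simpa using F.isPerverse.isSheaf.res_refl _ _
          · simpa [e2] using g.2 ε (lt_of_le_of_ne hle e2)
        · by_cases e2 : ε = γ
          · subst e2
            exact absurd (lt_of_le_of_ne hle (Ne.symm e1)) hδ.2
          · simp [e1, e2] }
  obtain ⟨t, ht⟩ := F.isPerverse.isFlabby _ s
  refine ⟨t.val σ LowerSet.mem_top, ?_, fun δ hδ hne => ?_⟩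
  · rw [t.compatible σ γ LowerSet.mem_top LowerSet.mem_top hγ.le, ht γ ⟨hγ, lt_irrefl γ⟩]
    simp [s]
  · rw [t.compatible σ δ LowerSet.mem_top LowerSet.mem_top hδ.le,
      ht δ ⟨hδ, fun h => hne h.le⟩]
    simp [s, show δ ≠ γ from fun e => hne e.ge]

/-- A section over a facet that vanishes on its intersections with the facets in `S` extends to a
section that vanishes on the facets in `S`. -/
theorem exists_extend_facet (F : PerverseSheaf.{u, w} Δ) {σ : Cone Δ} (τ : Facet σ)
    (S : Set (Facet σ)) (z : F.obj τ.1)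
    (hz : ∀ δ (hδ : δ ≤ τ.1), ∀ ρ ∈ S, δ ≤ ρ.1 → F.res hδ z = 0) :
    ∃ x ∈ relFacets F.toGradedSystem σ S, F.res τ.2.le x = z := by
  classical
  let s : Section F.toGradedSystem
      (⟨{δ | δ ≤ τ.1 ∨ ∃ ρ ∈ S, δ ≤ ρ.1}, fun a b hba ha => ha.imp hba.trans
        fun ⟨ρ, h, h'⟩ => ⟨ρ, h, hba.trans h'⟩⟩ : LowerSet (Cone Δ)) :=
    { val := fun δ _ => if e : δ ≤ τ.1 then F.res e z else 0
      compatible := by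
        intro δ ε hδ hε hle
        by_cases e1 : δ ≤ τ.1
        · rw [dif_pos e1, dif_pos (hle.trans e1), F.isPerverse.isSheaf.res_comp]
        · obtain ⟨ρ, hρ, h⟩ := hδ.resolve_left e1
          rw [dif_neg e1, map_zero]
          by_cases e2 : ε ≤ τ.1
          · rw [dif_pos e2, hz ε e2 ρ hρ (hle.trans h)]
          · rw [dif_neg e2] }
  obtain ⟨t, ht⟩ := F.isPerverse.isFlabby _ s
  refine ⟨t.val σ LowerSet.mem_top, fun ρ hρ => ?_, ?_⟩
  · rw [t.compatible σ ρ.1 LowerSet.mem_top LowerSet.mem_top ρ.2.le,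
      ht ρ.1 (Or.inr ⟨ρ, hρ, le_rfl⟩)]
    change (if e : ρ.1 ≤ τ.1 then F.res e z else 0) = 0
    split_ifs with e
    · exact hz ρ.1 e ρ hρ le_rfl
    · rfl
  · rw [t.compatible σ τ.1 LowerSet.mem_top LowerSet.mem_top τ.2.le, ht τ.1 (Or.inl le_rfl)]
    change (if e : τ.1 ≤ τ.1 then F.res e z else 0) = z
    rw [dif_pos le_rfl, F.isPerverse.isSheaf.res_refl]

variable [FiniteDimensional ℝ V]

theorem IsSheaf.mem_rel_iff {F : GradedSystem.{u, w} Δ} (hF : IsSheaf F) {σ : Cone Δ}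
    {x : F.obj σ} : x ∈ rel F σ ↔ ∀ τ : Facet σ, F.res τ.2.le x = 0 := by
  refine ⟨fun h τ => h τ.1 τ.2.lt, fun h γ hγ => ?_⟩
  obtain ⟨τ, hτ⟩ := exists_facet_ge hγ
  exact hF.res_eq_zero_of_le τ.2.le hτ (h τ)

/-- A section that vanishes on all facets but one extends a section over that facet which vanishes
on its boundary. -/
theorem IsSheaf.isExt_of_forall_ne {F : GradedSystem.{u, w} Δ} (hF : IsSheaf F) {σ : Cone Δ}
    (τ : Facet σ) {x : F.obj σ} (hx : ∀ ρ : Facet σ, ρ ≠ τ → F.res ρ.2.le x = 0) :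
    F.res τ.2.le x ∈ rel F τ.1 ∧ IsExt F τ.2 (F.res τ.2.le x) x := by
  have h1 : ∀ γ (hγ : γ < τ.1), F.res (hγ.le.trans τ.2.le) x = 0 := by
    intro γ hγ
    obtain ⟨δ, hδ⟩ := exists_facet_ge hγ
    obtain ⟨ρ, hρ, hδρ⟩ := exists_other_facet τ δ.2
    exact hF.res_eq_zero_of_le ρ.2.le (hδ.trans hδρ) (hx ρ hρ)
  refine ⟨fun γ hγ => by rw [hF.res_comp]; exact h1 γ hγ, rfl, fun γ hγ hne => ?_⟩
  obtain ⟨ρ, hρ⟩ := exists_facet_ge hγ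
  by_cases e : ρ = τ
  · subst e
    exact h1 γ (lt_of_le_of_ne hρ hne)
  · exact hF.res_eq_zero_of_le ρ.2.le hρ (hx ρ e)

/-! ### Extending linear forms by division -/

section Extend

variable (F : PerverseSheaf.{u, w} Δ) {σ : Cone Δ}

open Classical in
/-- The product of the equations of the facets outside `S`. -/
def cofacetProd (S : Set (Facet σ)) : A σ :=
  ∏ τ ∈ Finset.univ.filter (· ∉ S), form σ (facetForm τ.2)

theorem facetForm_form_ne_zero (τ : Facet σ) : form σ (facetForm τ.2) ≠ 0 :=
  form_ne_zero ((facetForm_spec τ.2).ne_zero τ.2)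

theorem cofacetProd_ne_zero (S : Set (Facet σ)) : cofacetProd S ≠ 0 :=
  Finset.prod_ne_zero_iff.2 fun τ _ => facetForm_form_ne_zero τ

theorem cofacetProd_eq_mul (S : Set (Facet σ)) {τ : Facet σ} (hτ : τ ∉ S) :
    cofacetProd S = form σ (facetForm τ.2) * cofacetProd (insert τ S) := by
  classical
  unfold cofacetProd
  rw [← Finset.mul_prod_erase _ _ (Finset.mem_filter.2 ⟨Finset.mem_univ τ, hτ⟩)]
  congr 1
  refine Finset.prod_congr ?_ fun _ _ => rfl
  ext ρ
  simp

theorem restrict_cofacetProd (S : Set (Facet σ)) {τ : Facet σ} (hτ : τ ∉ S) :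
    restrict τ.2.le (cofacetProd S) = 0 := by
  rw [cofacetProd_eq_mul S hτ, map_mul, (facetForm_spec τ.2).restrict_eq_zero, zero_mul]

theorem restrict_cofacetProd_ne_zero (τ : Facet σ) :
    restrict τ.2.le (cofacetProd {τ}) ≠ 0 := by
  unfold cofacetProd
  rw [map_prod]
  refine Finset.prod_ne_zero_iff.2 fun ρ hρ => ?_
  rw [restrict_form]
  have hρ' : ρ ≠ τ := by simpa using hρ
  refine form_ne_zero fun h0 => hρ' ?_
  exact Subtype.ext (ρ.2.eq_of_restrictForm_eq_zero (facetForm_spec ρ.2) τ.2 h0)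

theorem cofacetProd_mem (S : Set (Facet σ)) : ∃ i : ℤ, cofacetProd S ∈ gradeA σ i := by
  classical
  unfold cofacetProd
  generalize Finset.univ.filter (· ∉ S) = T
  induction T using Finset.induction_on with
  | empty => exact ⟨0, by rw [Finset.prod_empty]; exact SetLike.one_mem_graded _⟩
  | insert τ T hτ ih =>
    obtain ⟨i, hi⟩ := ih
    rw [Finset.prod_insert hτ]
    exact ⟨_, SetLike.mul_mem_graded (form_mem_gradeA σ _) hi⟩

variable {F}

theorem cofacetProd_smul_mem_rel {S : Set (Facet σ)} {x : F.obj σ}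
    (hx : x ∈ relFacets F.toGradedSystem σ S) :
    cofacetProd S • x ∈ rel F.toGradedSystem σ := by
  refine F.isPerverse.isSheaf.mem_rel_iff.2 fun τ => ?_
  rw [F.res_smul]
  by_cases h : τ ∈ S
  · rw [hx τ h, smul_zero]
  · rw [restrict_cofacetProd S h, zero_smul]

/-- A linear form on the sections vanishing on the facets in `S` is determined by its values on
`F_(σ,∂σ)`. -/
theorem hom_eq_of_forall_rel {S : Set (Facet σ)}
    {ψ ψ' : relFacets F.toGradedSystem σ S →ₗ[A σ] A σ}
    (h : ∀ x (hx : x ∈ rel F.toGradedSystem σ),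
      ψ ⟨x, rel_le_relFacets _ _ _ hx⟩ = ψ' ⟨x, rel_le_relFacets _ _ _ hx⟩) : ψ = ψ' := by
  refine LinearMap.ext fun x => mul_left_cancel₀ (cofacetProd_ne_zero S) ?_
  have h1 := h _ (cofacetProd_smul_mem_rel x.2)
  have h2 : (⟨cofacetProd S • x.1, rel_le_relFacets _ _ _ (cofacetProd_smul_mem_rel x.2)⟩ :
    relFacets F.toGradedSystem σ S) = cofacetProd S • x := rfl
  rwa [h2, map_smul, map_smul] at h1

/-- A linear form on `F_(σ,∂σ)` whose restrictions to the facets outside `S` vanish extends to the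
sections that vanish only on the facets in `S`: it sends `x` to `f (H x) / H`, where `H` is the
product of the equations of the facets outside `S`. -/
theorem exists_extend_hom (S : Set (Facet σ)) (f : rel F.toGradedSystem σ →ₗ[A σ] A σ)
    (hf : ∀ τ, τ ∉ S → phi F τ.2 (facetForm τ.2) (facetForm_spec τ.2) f = 0) :
    ∃ ψ : relFacets F.toGradedSystem σ S →ₗ[A σ] A σ, ∀ x (hx : x ∈ rel F.toGradedSystem σ),
      ψ ⟨x, rel_le_relFacets _ _ _ hx⟩ = f ⟨x, hx⟩ := by
  classical
  have hF := F.isPerverse.isSheaf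
  have key : ∀ x : relFacets F.toGradedSystem σ S, ∃ u,
      f ⟨cofacetProd S • x.1, cofacetProd_smul_mem_rel x.2⟩ = cofacetProd S * u := by
    intro x
    refine prod_form_dvd _ _ fun τ hτ => ?_
    have hτ' : τ ∉ S := (Finset.mem_filter.1 hτ).2
    obtain ⟨h1, h2⟩ := hF.isExt_of_forall_ne τ (x := cofacetProd (insert τ S) • x.1) (by
      intro ρ hρ
      rw [F.res_smul]
      by_cases h : ρ ∈ S
      · rw [x.2 ρ h, smul_zero]
      · rw [restrict_cofacetProd _ (by simp [h, hρ]), zero_smul])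
    have h3 := phiApply_eq F τ.2 (facetForm τ.2) (facetForm_spec τ.2) f ⟨_, h1⟩ h2
    have h4 : phiApply F τ.2 (facetForm τ.2) (facetForm_spec τ.2) f = 0 := hf τ hτ'
    rw [h4, LinearMap.zero_apply] at h3
    rw [h3]
    congr 2
    refine Subtype.ext ?_
    change cofacetProd S • x.1 = form σ (facetForm τ.2) • cofacetProd (insert τ S) • x.1
    rw [smul_smul, ← cofacetProd_eq_mul S hτ']
  choose u hu using key
  have h0 := cofacetProd_ne_zero S
  refine ⟨{ toFun := u, map_add' := fun x y => ?_, map_smul' := fun a x => ?_ }, fun x hx => ?_⟩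
  · refine mul_left_cancel₀ h0 ?_
    rw [mul_add, ← hu, ← hu, ← hu, ← map_add]
    exact congrArg f (Subtype.ext (smul_add _ _ _))
  · refine mul_left_cancel₀ h0 ?_
    rw [RingHom.id_apply, smul_eq_mul, mul_left_comm, ← hu, ← hu, ← smul_eq_mul, ← map_smul]
    exact congrArg f (Subtype.ext (smul_comm _ _ _))
  · refine mul_left_cancel₀ h0 ?_
    change _ * u _ = _
    rw [← hu, ← smul_eq_mul, ← map_smul]
    rfl

/-- Conversely, linear forms that extend to the sections vanishing on `S` restrict to zero on the
facets outside `S`. -/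
theorem phi_eq_zero_of_extend (S : Set (Facet σ)) {f : rel F.toGradedSystem σ →ₗ[A σ] A σ}
    {ψ : relFacets F.toGradedSystem σ S →ₗ[A σ] A σ}
    (hψ : ∀ x (hx : x ∈ rel F.toGradedSystem σ),
      ψ ⟨x, rel_le_relFacets _ _ _ hx⟩ = f ⟨x, hx⟩) {τ : Facet σ} (hτ : τ ∉ S)
    {h : Module.Dual ℝ (lin σ)} (hh : IsFacetForm τ.1 σ h) : phi F τ.2 h hh f = 0 := by
  refine LinearMap.ext fun g => ?_
  obtain ⟨x, hx⟩ := exists_isExt F τ.2 g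
  refine (phiApply_eq F τ.2 h hh f g hx).trans ?_
  have hxS : x ∈ relFacets F.toGradedSystem σ S := fun ρ hρ =>
    hx.res_eq_zero ρ.1 ρ.2.lt fun e => hτ (by rwa [← Subtype.ext e])
  rw [← hψ]
  have : (⟨form σ h • x, rel_le_relFacets _ _ _ (hx.smul_mem_rel hh)⟩ :
    relFacets F.toGradedSystem σ S) = form σ h • ⟨x, hxS⟩ := rfl
  rw [this, map_smul, smul_eq_mul, map_mul, hh.restrict_eq_zero, zero_mul]
  rfl

variable (F)

/-- The linear forms on `F_σ` are the linear forms on `F_(σ,∂σ)` whose restrictions to all facets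
vanish. -/
theorem exists_extend_hom_univ (f : rel F.toGradedSystem σ →ₗ[A σ] A σ)
    (hf : ∀ τ : Facet σ, phi F τ.2 (facetForm τ.2) (facetForm_spec τ.2) f = 0) :
    ∃ ψ : Module.Dual (A σ) (F.obj σ), ψ ∘ₗ (rel F.toGradedSystem σ).subtype = f := by
  obtain ⟨ψ, hψ⟩ := exists_extend_hom ∅ f fun τ _ => hf τ
  refine ⟨ψ ∘ₗ LinearMap.id.codRestrict _ (fun x τ h => h.elim), LinearMap.ext fun x => ?_⟩
  exact hψ x.1 x.2

theorem phi_comp_subtype (ψ : Module.Dual (A σ) (F.obj σ)) (τ : Facet σ)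
    {h : Module.Dual ℝ (lin σ)} (hh : IsFacetForm τ.1 σ h) :
    phi F τ.2 h hh (ψ ∘ₗ (rel F.toGradedSystem σ).subtype) = 0 :=
  phi_eq_zero_of_extend ∅ (ψ := ψ ∘ₗ Submodule.subtype _) (fun _ _ => rfl) (Set.notMem_empty τ) hh

theorem comp_subtype_injective :
    Function.Injective fun ψ : Module.Dual (A σ) (F.obj σ) =>
      ψ ∘ₗ (rel F.toGradedSystem σ).subtype := by
  intro ψ ψ' h
  have h1 : ψ ∘ₗ (relFacets F.toGradedSystem σ ∅).subtype =
      ψ' ∘ₗ (relFacets F.toGradedSystem σ ∅).subtype :=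
    hom_eq_of_forall_rel fun x hx => DFunLike.congr_fun h (⟨x, hx⟩ : rel F.toGradedSystem σ)
  exact LinearMap.ext fun x => DFunLike.congr_fun h1
    (⟨x, fun τ h => h.elim⟩ : relFacets F.toGradedSystem σ ∅)

end Extend

end Extension

section Orientation

/-! ### Volume forms and normalized facet forms -/

/-- A volume form in the chosen orientation. -/
def vol (o : Orientations Δ) (σ : Cone Δ) : Det σ := (o σ).someVector

theorem vol_ne_zero (o : Orientations Δ) (σ : Cone Δ) : vol o σ ≠ 0 := (o σ).someVector_ne_zero

theorem rayOfNeZero_vol (o : Orientations Δ) (σ : Cone Δ) :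
    rayOfNeZero ℝ (vol o σ) (vol_ne_zero o σ) = o σ := (o σ).someVector_ray

/-- Interchanging the first two arguments of an alternating form, with casts of the index types. -/
theorem map_cons_cons_swap {E : Type*} [AddCommGroup E] [Module ℝ E] {n m m' k : ℕ}
    (h1 : m + 1 = n) (h2 : k + 1 = m) (h1' : m' + 1 = n) (h2' : k + 1 = m')
    (ω : E [⋀^Fin n]→ₗ[ℝ] ℝ) (a b : E) (w : Fin k → E) :
    ω (Matrix.vecCons a (Matrix.vecCons b w ∘ finCongr h2.symm) ∘ finCongr h1.symm) =
      -ω (Matrix.vecCons b (Matrix.vecCons a w ∘ finCongr h2'.symm) ∘ finCongr h1'.symm) := by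
  subst h2 h1
  obtain rfl : m' = k + 1 := h2'.symm
  rw [← ω.map_swap _ (show (0 : Fin (k + 1 + 1)) ≠ 1 by simp)]
  congr 1
  funext i
  refine Fin.cases ?_ (fun i => Fin.cases ?_ (fun i => ?_) i) i
  · simp [Matrix.vecCons]
  · simp [Matrix.vecCons]
  · have h0 : i.succ.succ ≠ (0 : Fin (k + 1 + 1)) := Fin.succ_ne_zero _
    have h1 : i.succ.succ ≠ (1 : Fin (k + 1 + 1)) := by
      rw [← Fin.succ_zero_eq_one]
      exact fun h => Fin.succ_ne_zero _ (Fin.succ_injective _ h)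
    simp [Matrix.vecCons, Equiv.swap_apply_of_ne_of_ne h0 h1]

theorem contract_apply {τ σ : Cone Δ} (hf : IsFacet τ σ) (v : lin σ) (ω : Det σ)
    (w : Fin (dim τ) → lin τ) :
    contract hf v ω w = ω (Matrix.vecCons v (Submodule.inclusion (lin_mono hf.le) ∘ w) ∘
      finCongr hf.dim_eq.symm) := rfl

/-- Contractions along the two flags of a codimension two face differ by a sign. -/
theorem contract_contract {σ τ ρ γ : Cone Δ} (hτ : IsFacet τ σ) (hρ : IsFacet ρ σ)
    (hγτ : IsFacet γ τ) (hγρ : IsFacet γ ρ) (u : lin τ) (v : lin ρ) (ω : Det σ) :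
    contract hγτ u (contract hτ (Submodule.inclusion (lin_mono hρ.le) v) ω) =
      -contract hγρ v (contract hρ (Submodule.inclusion (lin_mono hτ.le) u) ω) := by
  ext w
  rw [AlternatingMap.neg_apply]
  simp only [contract_apply]
  have key : ∀ {τ : Cone Δ} (hτ : IsFacet τ σ) (hγτ : IsFacet γ τ) (u : lin τ) (v : lin σ),
      (Matrix.vecCons v (Submodule.inclusion (lin_mono hτ.le) ∘
        (Matrix.vecCons u (Submodule.inclusion (lin_mono hγτ.le) ∘ w) ∘
          finCongr hγτ.dim_eq.symm)) ∘ finCongr hτ.dim_eq.symm : Fin (dim σ) → lin σ) =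
      Matrix.vecCons v (Matrix.vecCons (Submodule.inclusion (lin_mono hτ.le) u)
        (Submodule.inclusion (lin_mono (hγτ.le.trans hτ.le)) ∘ w) ∘ finCongr hγτ.dim_eq.symm) ∘
          finCongr hτ.dim_eq.symm := by
    intro τ hτ hγτ u v
    congr 2
    funext i
    generalize hj : finCongr hγτ.dim_eq.symm i = j
    simp only [Function.comp_apply, hj]
    refine Fin.cases ?_ (fun j => ?_) j <;> rfl
  rw [key hτ hγτ, key hρ hγρ]
  exact map_cons_cons_swap hτ.dim_eq hγτ.dim_eq hρ.dim_eq hγρ.dim_eq _ _ _ _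

variable [FiniteDimensional ℝ V]

/-- The determinant line is spanned by any of its nonzero elements. -/
theorem exists_smul_eq {σ : Cone Δ} {ω : Det σ} (h : ω ≠ 0) (η : Det σ) : ∃ c : ℝ, η = c • ω := by
  let e : Module.Basis (Fin (dim σ)) ℝ (lin σ) := Module.finBasis ℝ (lin σ)
  have h1 := ω.eq_smul_basis_det e
  have h2 := η.eq_smul_basis_det e
  have h3 : ω e ≠ 0 := fun h0 => h (by rw [h1, h0, zero_smul])
  refine ⟨η e / ω e, ?_⟩
  calc η = η e • e.det := h2
    _ = (η e / ω e) • ω e • e.det := by rw [smul_smul, div_mul_cancel₀ _ h3]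
    _ = (η e / ω e) • ω := by rw [← h1]

/-- The contraction of a top form with a vector of the hyperplane of a facet vanishes on the
facet. -/
theorem contract_eq_zero {τ σ : Cone Δ} (hf : IsFacet τ σ) {v : lin σ} (hv : v.1 ∈ lin τ)
    (ω : Det σ) : contract hf v ω = 0 := by
  ext w
  rw [contract_apply, AlternatingMap.zero_apply]
  refine ω.map_linearDependent _ fun hli => ?_
  have h1 : LinearIndependent ℝ fun i => (⟨((Matrix.vecCons v
      (Submodule.inclusion (lin_mono hf.le) ∘ w) ∘ finCongr hf.dim_eq.symm) i).1, by
        generalize hj : finCongr hf.dim_eq.symm i = j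
        simp only [Function.comp_apply, hj]
        exact Fin.cases hv (fun j => (w j).2) j⟩ : lin τ) :=
    LinearIndependent.of_comp (Submodule.inclusion (lin_mono hf.le)) hli
  have h2 := h1.fintype_card_le_finrank
  rw [Fintype.card_fin] at h2
  have := hf.dim_eq
  unfold dim at *
  omega

theorem contract_ne_zero {τ σ : Cone Δ} (hf : IsFacet τ σ) {v : lin σ} (hv : v.1 ∉ lin τ)
    {ω : Det σ} (hω : ω ≠ 0) : contract hf v ω ≠ 0 := by
  intro h0
  let b : Module.Basis (Fin (dim τ)) ℝ (lin τ) := Module.finBasis ℝ (lin τ)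
  let e : Fin (dim τ + 1) → lin σ :=
    Matrix.vecCons v (Submodule.inclusion (lin_mono hf.le) ∘ b)
  have he : LinearIndependent ℝ e := by
    refine linearIndependent_finCons.2 ⟨b.linearIndependent.map' _
      (LinearMap.ker_eq_bot.2 (Submodule.inclusion_injective _)), fun hmem => hv ?_⟩
    have h1 : Submodule.span ℝ (Set.range (Submodule.inclusion (lin_mono hf.le) ∘ b)) ≤
        (lin τ).comap (lin σ).subtype := by
      rw [Submodule.span_le]
      rintro _ ⟨i, rfl⟩
      exact (b i).2
    exact h1 hmem
  have he' : LinearIndependent ℝ (e ∘ finCongr hf.dim_eq.symm) :=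
    he.comp _ (finCongr hf.dim_eq.symm).injective
  let B := basisOfLinearIndependentOfCardEqFinrank' _ he' (Fintype.card_fin _)
  have hB : ⇑B = e ∘ finCongr hf.dim_eq.symm :=
    coe_basisOfLinearIndependentOfCardEqFinrank' _ _ _
  refine hω ?_
  rw [ω.eq_smul_basis_det B, hB, show ω (e ∘ finCongr hf.dim_eq.symm) = contract hf v ω b from rfl,
    h0, AlternatingMap.zero_apply, zero_smul]

/-- The map `φ_h` depends linearly on the facet form `h`. -/
theorem phi_smul (F : PerverseSheaf.{u, w} Δ) {τ σ : Cone Δ} (hf : IsFacet τ σ)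
    {h : Module.Dual ℝ (lin σ)} (hh : IsFacetForm τ σ h) (c : ℝ) (hch : IsFacetForm τ σ (c • h))
    (f : rel F.toGradedSystem σ →ₗ[A σ] A σ) :
    phi F hf (c • h) hch f = c • phi F hf h hh f := by
  refine LinearMap.ext fun g => ?_
  obtain ⟨x, hx⟩ := exists_isExt F hf g
  refine (phiApply_eq F hf _ hch f g hx).trans ?_
  change _ = c • phiApply F hf h hh f g
  rw [phiApply_eq F hf h hh f g hx, ← map_smul, ← algebraMap_smul (A σ) c
    (f ⟨_, hx.smul_mem_rel hh⟩), ← map_smul]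
  congr 2
  refine Subtype.ext ?_
  change form σ (c • h) • x = algebraMap ℝ (A σ) c • form σ h • x
  rw [map_smul, smul_smul, ← Algebra.smul_def]

/-- The normalized facet form: the positive multiple `n` of the facet form for which the
contraction of the volume form of `σ` with a vector `v` is `± n v` times the volume form of the
facet. With this form the restriction of the dual sheaf involves no signs. -/
theorem exists_normForm (o : Orientations Δ) {τ σ : Cone Δ} (hf : IsFacet τ σ) :
    ∃ n : Module.Dual ℝ (lin σ), (∃ c : ℝ, 0 < c ∧ n = c • facetForm hf ∧
        (transition o hf : ℝ) • psi hf (facetForm hf) (facetForm_spec hf) (vol o σ) =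
          c • vol o τ) ∧
      ∃ s : ℝ, |s| = 1 ∧ ∀ v, contract hf v (vol o σ) = (s * n v) • vol o τ := by
  set h := facetForm hf with hh
  have hspec : IsFacetForm τ σ h := facetForm_spec hf
  set v₀ := (hspec.exists_eq_one hf).choose with hv₀
  have hv1 : h v₀ = 1 := (hspec.exists_eq_one hf).choose_spec
  have hpsi : ∀ ω, psi hf h hspec ω = contract hf v₀ ω := fun _ => rfl
  have hv0 : v₀.1 ∉ lin τ := fun h' => by
    rw [(hspec.apply_eq_zero_iff v₀).2 h'] at hv1
    exact zero_ne_one hv1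
  obtain ⟨t, ht⟩ := exists_smul_eq (vol_ne_zero o τ) (contract hf v₀ (vol o σ))
  have ht0 : t ≠ 0 := by
    rintro rfl
    rw [zero_smul] at ht
    exact contract_ne_zero hf hv0 (vol_ne_zero o σ) ht
  have hc : ∀ v, contract hf v (vol o σ) = (t * h v) • vol o τ := by
    intro v
    have h1 : contract hf (v - h v • v₀) (vol o σ) = 0 := contract_eq_zero hf
      ((hspec.apply_eq_zero_iff _).1 (by
        rw [map_sub, map_smul, hv1, smul_eq_mul, mul_one, sub_self])) _
    have h2 : contract hf (v - h v • v₀) (vol o σ) =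
        contract hf v (vol o σ) - h v • contract hf v₀ (vol o σ) := by
      ext w
      change ((vol o σ).domDomCongr (finCongr hf.dim_eq.symm)).curryLeft (v - h v • v₀) _ = _
      rw [map_sub, map_smul]
      rfl
    rw [h2, sub_eq_zero] at h1
    rw [h1, ht, smul_smul, mul_comm]
  have htrans : (transition o hf : ℝ) * t = |t| := by
    have hiff : (∃ (ω : Det σ) (hω : ω ≠ 0) (hη : psi hf (facetForm hf) (facetForm_spec hf) ω ≠ 0),
        rayOfNeZero ℝ ω hω = o σ ∧ rayOfNeZero ℝ _ hη = o τ) ↔ 0 < t := by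
      constructor
      · rintro ⟨ω, hω, hη, h1, h2⟩
        rw [← rayOfNeZero_vol o σ, ray_eq_iff] at h1
        rw [← rayOfNeZero_vol o τ, ray_eq_iff] at h2
        obtain ⟨r, r', hr, hr', e1⟩ := h1.exists_pos hω (vol_ne_zero o σ)
        obtain ⟨a, b, ha, hb, e2⟩ := h2.exists_pos hη (vol_ne_zero o τ)
        have e3 := congrArg (contract hf v₀) e1
        rw [map_smul, map_smul, ht] at e3
        have e4 : (a * (r' * t)) • vol o τ = (r * b) • vol o τ := by
          rw [mul_smul, mul_smul, mul_smul, ← e3, ← e2, smul_comm a r]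
          rfl
        have e5 := smul_left_injective ℝ (vol_ne_zero o τ) e4
        have e6 : 0 < a * r' * t := by nlinarith [mul_pos hr hb]
        exact (pos_iff_pos_of_mul_pos e6).1 (mul_pos ha hr')
      · intro ht'
        have h2 : psi hf (facetForm hf) (facetForm_spec hf) (vol o σ) = t • vol o τ := ht
        refine ⟨vol o σ, vol_ne_zero o σ, by rw [h2]; exact smul_ne_zero ht0 (vol_ne_zero o τ),
          rayOfNeZero_vol o σ, ?_⟩
        rw [← rayOfNeZero_vol o τ, ray_eq_iff, h2]
        exact SameRay.sameRay_pos_smul_left _ ht'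
    unfold transition
    rcases lt_or_gt_of_ne ht0 with hneg | hpos
    · rw [if_neg (by rw [hiff]; exact hneg.not_gt), abs_of_neg hneg]
      simp
    · rw [if_pos (hiff.2 hpos), abs_of_pos hpos]
      simp
  refine ⟨|t| • h, ⟨|t|, abs_pos.2 ht0, rfl, ?_⟩, t / |t|, ?_, fun v => ?_⟩
  · change (transition o hf : ℝ) • contract hf v₀ (vol o σ) = _
    rw [ht, smul_smul, htrans]
  · rw [abs_div, abs_abs, div_self (abs_pos.2 ht0).ne']
  · rw [hc, LinearMap.smul_apply, smul_eq_mul, ← mul_assoc,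
      div_mul_cancel₀ _ (abs_pos.2 ht0).ne']

end Orientation

section DualRestriction

variable [FiniteDimensional ℝ V]

/-- The normalized form of a facet with respect to the chosen orientations. -/
def normForm (o : Orientations Δ) {τ σ : Cone Δ} (hf : IsFacet τ σ) : Module.Dual ℝ (lin σ) :=
  (exists_normForm o hf).choose

theorem exists_normForm_eq_smul (o : Orientations Δ) {τ σ : Cone Δ} (hf : IsFacet τ σ) :
    ∃ c : ℝ, 0 < c ∧ normForm o hf = c • facetForm hf ∧
      (transition o hf : ℝ) • psi hf (facetForm hf) (facetForm_spec hf) (vol o σ) =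
        c • vol o τ := (exists_normForm o hf).choose_spec.1

theorem contract_vol (o : Orientations Δ) {τ σ : Cone Δ} (hf : IsFacet τ σ) :
    ∃ s : ℝ, |s| = 1 ∧ ∀ v, contract hf v (vol o σ) = (s * normForm o hf v) • vol o τ :=
  (exists_normForm o hf).choose_spec.2

theorem normForm_spec (o : Orientations Δ) {τ σ : Cone Δ} (hf : IsFacet τ σ) :
    IsFacetForm τ σ (normForm o hf) := by
  obtain ⟨c, hc, h, -⟩ := exists_normForm_eq_smul o hf
  rw [h]
  exact (facetForm_spec hf).smul hc.ne'

/-! ### The restrictions of the dual sheaf in terms of linear forms -/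

/-- The restriction to a facet of linear forms on `F_(σ,∂σ)`, with the normalized facet form. Under
`f ↦ f ⊗ vol` it is the restriction of the dual sheaf. -/
def homRes (o : Orientations Δ) (F : PerverseSheaf.{u, w} Δ) {τ σ : Cone Δ} (hf : IsFacet τ σ) :
    (rel F.toGradedSystem σ →ₗ[A σ] A σ) →ₗ[ℝ] (rel F.toGradedSystem τ →ₗ[A τ] A τ) :=
  phi F hf (normForm o hf) (normForm_spec o hf)

theorem facetRes_tmul_vol (o : Orientations Δ) (F : PerverseSheaf.{u, w} Δ) {τ σ : Cone Δ}
    (hf : IsFacet τ σ) (f : rel F.toGradedSystem σ →ₗ[A σ] A σ) :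
    facetRes o F hf (f ⊗ₜ vol o σ) = homRes o F hf f ⊗ₜ[ℝ] vol o τ := by
  obtain ⟨c, hc, h, h'⟩ := exists_normForm_eq_smul o hf
  have key : ∀ (n : Module.Dual ℝ (lin σ)) (hn : IsFacetForm τ σ n), n = c • facetForm hf →
      phi F hf n hn f = c • phi F hf (facetForm hf) (facetForm_spec hf) f := by
    rintro n hn rfl
    exact phi_smul F hf (facetForm_spec hf) c hn f
  rw [facetRes_tmul, homRes, key _ _ h, TensorProduct.smul_tmul, ← h',
    ← Int.cast_smul_eq_zsmul ℝ, TensorProduct.tmul_smul]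

theorem homRes_apply (o : Orientations Δ) (F : PerverseSheaf.{u, w} Δ) {τ σ : Cone Δ}
    (hf : IsFacet τ σ) (f : rel F.toGradedSystem σ →ₗ[A σ] A σ) (g : rel F.toGradedSystem τ)
    {x : F.obj σ} (hx : IsExt F.toGradedSystem hf g.1 x) :
    homRes o F hf f g = restrict hf.le (f ⟨_, hx.smul_mem_rel (normForm_spec o hf)⟩) :=
  phiApply_eq F hf _ (normForm_spec o hf) f g hx

theorem homRes_eq_zero_iff (o : Orientations Δ) (F : PerverseSheaf.{u, w} Δ) {τ σ : Cone Δ}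
    (hf : IsFacet τ σ) (f : rel F.toGradedSystem σ →ₗ[A σ] A σ) :
    homRes o F hf f = 0 ↔ phi F hf (facetForm hf) (facetForm_spec hf) f = 0 := by
  obtain ⟨c, hc, h, -⟩ := exists_normForm_eq_smul o hf
  have key : ∀ (n : Module.Dual ℝ (lin σ)) (hn : IsFacetForm τ σ n), n = c • facetForm hf →
      (phi F hf n hn f = 0 ↔ phi F hf (facetForm hf) (facetForm_spec hf) f = 0) := by
    rintro n hn rfl
    rw [phi_smul F hf (facetForm_spec hf)]
    refine ⟨fun h0 => ?_, fun h0 => by rw [h0, smul_zero]⟩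
    rw [← inv_smul_smul₀ hc.ne' (phi F hf (facetForm hf) (facetForm_spec hf) f), h0, smul_zero]
  exact key _ _ h

/-- The identification of linear forms with elements of the dual sheaf by a determinant form. -/
def tmulEquiv (F : GradedSystem.{u, w} Δ) (σ : Cone Δ) (ω : Det σ) (hω : ω ≠ 0) :
    (rel F σ →ₗ[A σ] A σ) ≃ₗ[A σ] DualObj F σ :=
  LinearEquiv.ofBijective
    { toFun := fun f => f ⊗ₜ ω
      map_add' := fun f g => TensorProduct.add_tmul f g ω
      map_smul' := fun a f => rfl }
    (by
      -- a linear form on the determinant line with value `1` at `ω` yields the inverse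
      obtain ⟨c, hc⟩ : ∃ c : Det σ →ₗ[ℝ] ℝ, c ω = 1 := by
        let e : Module.Basis (Fin (dim σ)) ℝ (lin σ) := Module.finBasis ℝ (lin σ)
        have h3 : ω e ≠ 0 := fun h0 => hω (by rw [ω.eq_smul_basis_det e, h0, zero_smul])
        exact ⟨{ toFun := fun η => η e / ω e, map_add' := fun x y => add_div _ _ _,
                 map_smul' := fun r x => mul_div_assoc _ _ _ }, div_self h3⟩
      let inv : DualObj F σ →ₗ[ℝ] (rel F σ →ₗ[A σ] A σ) :=
        (TensorProduct.rid ℝ _).toLinearMap ∘ₗ TensorProduct.map LinearMap.id c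
      have hinv : ∀ f : rel F σ →ₗ[A σ] A σ, inv (f ⊗ₜ ω) = f := fun f => by
        change TensorProduct.rid ℝ _ (f ⊗ₜ c ω) = f
        rw [hc, TensorProduct.rid_tmul, one_smul]
      refine ⟨fun f g h => ?_, fun z => ?_⟩
      · rw [← hinv f, ← hinv g]
        exact congrArg inv h
      · induction z using TensorProduct.induction_on with
        | zero => exact ⟨0, TensorProduct.zero_tmul _ _⟩
        | add x y hx hy =>
          obtain ⟨f, rfl⟩ := hx
          obtain ⟨g, rfl⟩ := hy
          exact ⟨f + g, TensorProduct.add_tmul _ _ _⟩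
        | tmul f η =>
          obtain ⟨r, rfl⟩ := exists_smul_eq hω η
          exact ⟨r • f, TensorProduct.smul_tmul _ _ _⟩)

theorem tmulEquiv_apply (F : GradedSystem.{u, w} Δ) (σ : Cone Δ) {ω : Det σ} (hω : ω ≠ 0)
    (f : rel F σ →ₗ[A σ] A σ) : tmulEquiv F σ ω hω f = f ⊗ₜ ω := rfl

theorem exists_eq_tmul (F : GradedSystem.{u, w} Δ) (σ : Cone Δ) {ω : Det σ} (hω : ω ≠ 0)
    (z : DualObj F σ) : ∃ f : rel F σ →ₗ[A σ] A σ, z = f ⊗ₜ ω := by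
  obtain ⟨f, hf⟩ := (tmulEquiv F σ ω hω).surjective z
  exact ⟨f, hf.symm⟩

theorem tmul_injective (F : GradedSystem.{u, w} Δ) (σ : Cone Δ) {ω : Det σ} (hω : ω ≠ 0)
    {f g : rel F σ →ₗ[A σ] A σ} (h : f ⊗ₜ[ℝ] ω = g ⊗ₜ[ℝ] ω) : f = g :=
  (tmulEquiv F σ ω hω).injective h

/-! ### Independence of the chain of facets -/

/-- The normalized forms along the two flags of a codimension two face: each form of the lower
facet is the same multiple of the restricted form of the opposite upper facet. The signs need not
be compared, since all forms are positive at interior points of the facets. -/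
theorem exists_normForm_restrict (o : Orientations Δ) {σ : Cone Δ} {τ ρ : Facet σ} (hne : τ ≠ ρ)
    {γ : Cone Δ} (hγτ : IsFacet γ τ.1) (hγρ : IsFacet γ ρ.1) :
    ∃ a : ℝ, normForm o hγτ = a • restrictForm τ.2.le (normForm o ρ.2) ∧
      normForm o hγρ = a • restrictForm ρ.2.le (normForm o τ.2) := by
  have key : ∀ {τ ρ : Facet σ} (hne : τ ≠ ρ) (hγτ : IsFacet γ τ.1) (hγρ : IsFacet γ ρ.1),
      ∃ a : ℝ, normForm o hγτ = a • restrictForm τ.2.le (normForm o ρ.2) ∧ 0 < a ∧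
        ∃ u : lin τ.1, 0 < normForm o ρ.2 (Submodule.inclusion (lin_mono τ.2.le) u) := by
    intro τ ρ hne hγτ hγρ
    obtain ⟨c, hc, h1⟩ := exists_restrictForm_eq τ ρ hne.symm hγτ hγρ.le
    obtain ⟨d, hd, h2, -⟩ := exists_normForm_eq_smul o ρ.2
    obtain ⟨e, he, h3, -⟩ := exists_normForm_eq_smul o hγτ
    have h4 : restrictForm τ.2.le (normForm o ρ.2) = (d * c) • facetForm hγτ := by
      rw [h2, map_smul, h1, smul_smul]
    refine ⟨e / (d * c), ?_, by positivity, ?_⟩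
    · rw [h4, smul_smul, div_mul_cancel₀ _ (mul_pos hd hc).ne', h3]
    · obtain ⟨u, -, hu⟩ := exists_interior τ.1
      refine ⟨u, ?_⟩
      change 0 < restrictForm τ.2.le (normForm o ρ.2) u
      rw [h4]
      exact mul_pos (mul_pos hd hc) (hu ⟨γ, hγτ⟩)
  obtain ⟨a, ha, ha0, u, hu⟩ := key hne hγτ hγρ
  obtain ⟨b, hb, hb0, v, hv⟩ := key hne.symm hγρ hγτ
  obtain ⟨s₁, hs₁, h₁⟩ := contract_vol o τ.2
  obtain ⟨s₂, hs₂, h₂⟩ := contract_vol o ρ.2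
  obtain ⟨t₁, ht₁, k₁⟩ := contract_vol o hγτ
  obtain ⟨t₂, ht₂, k₂⟩ := contract_vol o hγρ
  -- the two iterated contractions of the volume form agree up to sign
  have h := contract_contract τ.2 ρ.2 hγτ hγρ u v (vol o σ)
  rw [h₁, h₂, map_smul, map_smul, k₁, k₂, smul_smul, smul_smul, ← neg_smul] at h
  have h5 := congrArg abs (smul_left_injective ℝ (vol_ne_zero o γ) h)
  have e1 : normForm o hγτ u = a * normForm o ρ.2 (Submodule.inclusion (lin_mono τ.2.le) u) := by
    rw [ha]; rfl
  have e2 : normForm o hγρ v = b * normForm o τ.2 (Submodule.inclusion (lin_mono ρ.2.le) v) := by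
    rw [hb]; rfl
  rw [e1, e2, abs_neg] at h5
  simp only [abs_mul, hs₁, hs₂, ht₁, ht₂, abs_of_pos hu, abs_of_pos hv, abs_of_pos ha0,
    abs_of_pos hb0, one_mul] at h5
  have h6 : a = b := by
    refine mul_right_cancel₀ (mul_pos hu hv).ne' ?_
    linarith
  exact ⟨a, ha, h6 ▸ hb⟩

/-- The restrictions of linear forms along the two flags of a codimension two face agree. -/
theorem homRes_comm (o : Orientations Δ) (F : PerverseSheaf.{u, w} Δ) {σ : Cone Δ} {τ ρ : Facet σ}
    (hne : τ ≠ ρ) {γ : Cone Δ} (hγτ : IsFacet γ τ.1) (hγρ : IsFacet γ ρ.1)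
    (f : rel F.toGradedSystem σ →ₗ[A σ] A σ) :
    homRes o F hγτ (homRes o F τ.2 f) = homRes o F hγρ (homRes o F ρ.2 f) := by
  have hF := F.isPerverse.isSheaf
  obtain ⟨a, ha, hb⟩ := exists_normForm_restrict o hne hγτ hγρ
  refine LinearMap.ext fun g => ?_
  have hγσ : γ < σ := hγτ.lt.trans τ.2.lt
  obtain ⟨x, hx, hx0⟩ := exists_extend_rel F hγσ g
  -- both sides are the value of `f` at the product of the two forms with `x`
  have key : ∀ {τ ρ : Facet σ} (hne : τ ≠ ρ) (hγτ : IsFacet γ τ.1) (hγρ : IsFacet γ ρ.1)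
      (ha : normForm o hγτ = a • restrictForm τ.2.le (normForm o ρ.2)),
      ∃ h : form σ (normForm o τ.2) • form σ (a • normForm o ρ.2) • x ∈ rel F.toGradedSystem σ,
      homRes o F hγτ (homRes o F τ.2 f) g = restrict hγσ.le (f ⟨_, h⟩) := by
    intro τ ρ hne hγτ hγρ ha
    have h1 : IsExt F.toGradedSystem hγτ g.1 (F.res τ.2.le x) :=
      ⟨by rw [hF.res_comp, hx], fun δ hδ hδγ => by
        rw [hF.res_comp]
        exact hx0 δ (hδ.trans τ.2.lt) fun h => hδγ (hγτ.eq_of_le_of_lt h hδ)⟩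
    have h2 : IsExt F.toGradedSystem τ.2
        (form τ.1 (normForm o hγτ) • F.res τ.2.le x) (form σ (a • normForm o ρ.2) • x) := by
      refine ⟨by rw [F.res_smul, restrict_form, ha, map_smul], fun δ hδ hδτ => ?_⟩
      rw [F.res_smul]
      by_cases e : γ ≤ δ
      · have h0 : restrict hδ.le (form σ (normForm o ρ.2)) = 0 := by
          by_cases e' : δ = γ
          · subst e'
            rw [← restrict_comp ρ.2.le hγρ.le, (normForm_spec o ρ.2).restrict_eq_zero, map_zero]
          · have hδf : IsFacet δ σ := by
              refine ⟨hδ.le, ?_⟩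
              have i1 := dim_lt_of_lt (lt_of_le_of_ne e (Ne.symm e'))
              have i2 := dim_lt_of_lt hδ
              have i3 := τ.2.dim_eq
              have i4 := hγτ.dim_eq
              omega
            have h3 : (⟨δ, hδf⟩ : Facet σ) = ρ := other_facet_unique τ hγτ
              (fun h => hδτ (congrArg Subtype.val h)) e hne.symm hγρ.le
            obtain rfl : δ = ρ.1 := congrArg Subtype.val h3
            exact (normForm_spec o ρ.2).restrict_eq_zero _
        rw [map_smul, map_smul, h0, smul_zero, zero_smul]
      · rw [hx0 δ hδ e, smul_zero]
    refine ⟨h2.smul_mem_rel (normForm_spec o τ.2), ?_⟩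
    rw [homRes_apply o F hγτ _ g h1, homRes_apply o F τ.2 f ⟨_, _⟩ h2, restrict_comp]
  obtain ⟨h1, e1⟩ := key hne hγτ hγρ ha
  obtain ⟨h2, e2⟩ := key hne.symm hγρ hγτ hb
  rw [e1, e2]
  congr 3
  rw [map_smul, map_smul, smul_smul, smul_smul, mul_smul_comm, mul_smul_comm, mul_comm]

theorem facetRes_comm (o : Orientations Δ) (F : PerverseSheaf.{u, w} Δ) {σ : Cone Δ}
    {τ ρ : Facet σ} (hne : τ ≠ ρ) {γ : Cone Δ} (hγτ : IsFacet γ τ.1) (hγρ : IsFacet γ ρ.1)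
    (z : DualObj F.toGradedSystem σ) :
    facetRes o F hγτ (facetRes o F τ.2 z) = facetRes o F hγρ (facetRes o F ρ.2 z) := by
  obtain ⟨f, rfl⟩ := exists_eq_tmul _ _ (vol_ne_zero o σ) z
  rw [facetRes_tmul_vol, facetRes_tmul_vol, facetRes_tmul_vol, facetRes_tmul_vol,
    homRes_comm o F hne hγτ hγρ]

theorem exists_facetChain {σ τ : Cone Δ} (h : τ ≤ σ) : Nonempty (FacetChain σ τ) := by
  induction hn : dim σ using Nat.strong_induction_on generalizing σ with
  | _ n ih =>
    rcases eq_or_lt_of_le h with rfl | hlt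
    · exact ⟨.nil _⟩
    · obtain ⟨ρ, hρ⟩ := exists_facet_ge hlt
      obtain ⟨c⟩ := ih (dim ρ.1) (by have := ρ.2.dim_eq; omega) hρ rfl
      exact ⟨.cons ρ.2 c⟩

theorem FacetChain.dim_le {σ τ : Cone Δ} (c : FacetChain σ τ) : dim τ ≤ dim σ :=
  Submodule.finrank_mono (lin_mono c.le)

/-- The composition of restrictions along a chain of facets depends only on its ends, since any two
facets through a face are connected by codimension two faces. -/
theorem chainRes_eq (o : Orientations Δ) (F : PerverseSheaf.{u, w} Δ) {σ τ : Cone Δ}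
    (c c' : FacetChain σ τ) : chainRes o F c = chainRes o F c' := by
  obtain ⟨n, hn⟩ : ∃ n, dim σ = n := ⟨_, rfl⟩
  induction n using Nat.strong_induction_on generalizing σ with
  | _ n ih =>
    cases c with
    | nil =>
      cases c' with
      | nil => rfl
      | cons h' c' =>
        have := c'.dim_le
        have := h'.dim_eq
        omega
    | @cons _ ρ _ h c =>
      cases c' with
      | nil =>
        have := c.dim_le
        have := h.dim_eq
        omega
      | @cons _ ρ' _ h' c' =>
        refine facet_connected (σ := σ) (δ := τ)
          (fun π : Facet σ => ∀ d : FacetChain π.1 τ,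
            chainRes o F (.cons π.2 d) = chainRes o F (.cons h' c'))
          ⟨ρ', h'⟩ c'.le (fun d => ?_) ?_ ⟨ρ, h⟩ c.le c
        · refine congrArg (fun r => AddMonoidHom.comp r (facetRes o F h')) ?_
          exact ih (dim ρ') (by have := h'.dim_eq; omega) d c' rfl
        · intro α β γ hne hγα hγβ hτγ hβ d
          obtain ⟨e⟩ := exists_facetChain hτγ
          rw [← hβ (.cons hγβ e)]
          have h1 : chainRes o F d = chainRes o F (.cons hγα e) :=
            ih (dim α.1) (by have := α.2.dim_eq; omega) d _ rfl
          refine AddMonoidHom.ext fun z => ?_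
          change chainRes o F d (facetRes o F α.2 z) =
            chainRes o F e (facetRes o F hγβ (facetRes o F β.2 z))
          rw [h1, ← facetRes_comm o F hne hγα hγβ z]
          rfl

theorem dualRes_eq_chainRes (o : Orientations Δ) (F : PerverseSheaf.{u, w} Δ) {σ τ : Cone Δ}
    (c : FacetChain σ τ) : dualRes o F σ τ = chainRes o F c := by
  unfold dualRes
  rw [dif_pos ⟨c⟩]
  exact chainRes_eq o F _ c

theorem dualRes_facet (o : Orientations Δ) (F : PerverseSheaf.{u, w} Δ) {σ τ : Cone Δ}
    (hf : IsFacet τ σ) : dualRes o F σ τ = facetRes o F hf :=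
  dualRes_eq_chainRes o F (.cons hf (.nil _))

theorem dualRes_tmul_vol (o : Orientations Δ) (F : PerverseSheaf.{u, w} Δ) {σ τ : Cone Δ}
    (hf : IsFacet τ σ) (f : rel F.toGradedSystem σ →ₗ[A σ] A σ) :
    dualRes o F σ τ (f ⊗ₜ vol o σ) = homRes o F hf f ⊗ₜ[ℝ] vol o τ := by
  rw [dualRes_facet o F hf, facetRes_tmul_vol]

theorem dualRes_refl (o : Orientations Δ) (F : PerverseSheaf.{u, w} Δ) (σ : Cone Δ)
    (z : DualObj F.toGradedSystem σ) : dualRes o F σ σ z = z := by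
  rw [dualRes_eq_chainRes o F (.nil σ)]
  rfl

theorem dualRes_facet_comp (o : Orientations Δ) (F : PerverseSheaf.{u, w} Δ) {σ ρ τ : Cone Δ}
    (hf : IsFacet ρ σ) (h : τ ≤ ρ) (z : DualObj F.toGradedSystem σ) :
    dualRes o F ρ τ (dualRes o F σ ρ z) = dualRes o F σ τ z := by
  obtain ⟨c⟩ := exists_facetChain h
  rw [dualRes_eq_chainRes o F c, dualRes_facet o F hf, dualRes_eq_chainRes o F (.cons hf c)]
  rfl

theorem dualRes_comp (o : Orientations Δ) (F : PerverseSheaf.{u, w} Δ) {σ τ γ : Cone Δ}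
    (h : τ ≤ σ) (h' : γ ≤ τ) (z : DualObj F.toGradedSystem σ) :
    dualRes o F τ γ (dualRes o F σ τ z) = dualRes o F σ γ z := by
  obtain ⟨c⟩ := exists_facetChain h
  induction c with
  | nil σ => rw [dualRes_refl]
  | cons hf c ih =>
    rw [← dualRes_facet_comp o F hf c.le, ih c.le h', dualRes_facet_comp o F hf (h'.trans c.le)]

end DualRestriction

section Shellability

/-! ### Flabbiness and the boundary of a cone -/

/-- Flabbiness can be tested by extending sections from the boundary of a cone to the cone. -/
theorem isFlabby_of_exists_extend (G : GradedSystem.{u, w} Δ)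
    (hrefl : ∀ σ (x : G.obj σ), G.res (le_refl σ) x = x)
    (h : ∀ (σ : Cone Δ) (s : Section G (LowerSet.Iio σ)),
      ∃ x : G.obj σ, ∀ τ (hτ : τ < σ), G.res hτ.le x = s.val τ hτ) : IsFlabby G := by
  classical
  intro Λ
  obtain ⟨n, hn⟩ : ∃ n, {σ | σ ∉ Λ}.ncard = n := ⟨_, rfl⟩
  induction n using Nat.strong_induction_on generalizing Λ with
  | _ n ih =>
    intro s
    by_cases htop : ∀ σ, σ ∈ Λ
    · exact ⟨⟨fun σ _ => s.val σ (htop σ), fun σ τ _ _ h => s.compatible σ τ _ _ h⟩,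
        fun σ hσ => rfl⟩
    push Not at htop
    obtain ⟨σ, hσ, hmin⟩ := (Set.toFinite {σ | σ ∉ Λ}).exists_minimal htop
    have hlt : ∀ τ, τ < σ → τ ∈ Λ := fun τ hτ => by
      by_contra hcon
      exact hτ.not_ge (hmin hcon hτ.le)
    obtain ⟨x, hx⟩ := h σ ⟨fun τ hτ => s.val τ (hlt τ hτ),
      fun τ ρ _ _ hle => s.compatible τ ρ _ _ hle⟩
    let Λ' : LowerSet (Cone Δ) := ⟨{τ | τ ∈ Λ ∨ τ = σ}, fun a b hba ha => by
      rcases ha with ha | rfl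
      · exact Or.inl (Λ.lower hba ha)
      · exact (eq_or_lt_of_le hba).elim Or.inr fun h => Or.inl (hlt b h)⟩
    let s' : Section G Λ' :=
      { val := fun τ hτ => if e : τ ∈ Λ then s.val τ e else
          (hτ.resolve_left e : τ = σ) ▸ x
        compatible := by
          intro τ ρ hτ hρ hle
          by_cases e : τ ∈ Λ
          · have e' : ρ ∈ Λ := Λ.lower hle e
            rw [dif_pos e, dif_pos e']
            exact s.compatible τ ρ e _ hle
          · obtain rfl : τ = σ := hτ.resolve_left e
            rw [dif_neg e]
            rcases eq_or_lt_of_le hle with rfl | hlt'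
            · rw [dif_neg e]
              exact hrefl _ x
            · rw [dif_pos (hlt ρ hlt')]
              exact hx ρ hlt' }
    have hcard : {τ | τ ∉ Λ'}.ncard < n := by
      rw [← hn]
      refine Set.ncard_lt_ncard ⟨fun τ hτ h => hτ (Or.inl h), fun hsub => ?_⟩ (Set.toFinite _)
      exact hsub hσ (Or.inr rfl)
    obtain ⟨t, ht⟩ := ih _ hcard Λ' rfl s'
    refine ⟨t, fun τ hτ => ?_⟩
    rw [ht τ (Or.inl hτ)]
    exact dif_pos hτ

variable [FiniteDimensional ℝ V]

/-! ### Shelling and projectivity -/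

instance (F : PerverseSheaf.{u, w} Δ) (σ : Cone Δ) (S : Set (Facet σ)) :
    Module.Finite (A σ) (relFacets F.toGradedSystem σ S) :=
  inferInstanceAs (Module.Finite (A σ) (relFacets F.toGradedSystem σ S : Submodule _ _))

instance (F : PerverseSheaf.{u, w} Δ) (σ : Cone Δ) :
    Module.Finite (A σ) (rel F.toGradedSystem σ) :=
  inferInstanceAs (Module.Finite (A σ) (rel F.toGradedSystem σ : Submodule _ _))

/-- The facets of a cone that are visible from a point of its span. -/
def visible {σ : Cone Δ} (y : lin σ) : Set (Facet σ) := {τ | facetForm τ.2 y < 0}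

section Shelling

variable (F : PerverseSheaf.{u, w} Δ) {σ : Cone Δ} (q : lin σ)
  (hq : ∀ τ : Facet σ, 0 < facetForm τ.2 q) (p : lin σ)

/-- In the shelling of `∂σ` by the levels of the facets, a facet `τ` meets the preceding facets in
the facets of `τ` visible from the projected point. Sections that vanish on the preceding facets
therefore restrict to sections that vanish on the visible facets of `τ`. -/
def shellRes (τ : Facet σ) :
    relFacets F.toGradedSystem σ {ρ | level q p ρ < level q p τ} →ₛₗ[(restrict τ.2.le).toRingHom]
      relFacets F.toGradedSystem τ.1 (visible (project q hq p τ)) where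
  toFun x := ⟨F.res τ.2.le x.1, fun γ hγ => by
    obtain ⟨ρ, hρ, hγρ⟩ := exists_other_facet τ γ.2
    have h1 := (facetForm_project_neg_iff q hq p τ ρ hρ γ.2 hγρ).1 hγ
    rw [F.isPerverse.isSheaf.res_comp]
    exact F.isPerverse.isSheaf.res_eq_zero_of_le ρ.2.le hγρ (x.2 ρ h1)⟩
  map_add' x y := Subtype.ext (map_add _ _ _)
  map_smul' a x := Subtype.ext (F.res_smul _ _ _)

theorem shellRes_surjective (τ : Facet σ) : Function.Surjective (shellRes F q hq p τ) := by
  intro z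
  obtain ⟨x, hx, hxz⟩ := exists_extend_facet F τ {ρ | level q p ρ < level q p τ} z.1 (by
    intro δ hδ ρ hρ hδρ
    obtain ⟨γ, hγ, π, hδγ, hne, hγπ, hlt⟩ := exists_adjacent_level_lt q hq p τ ρ hδ hδρ hρ
    exact F.isPerverse.isSheaf.res_eq_zero_of_le hγ.le hδγ
      (z.2 ⟨γ, hγ⟩ ((facetForm_project_neg_iff q hq p τ π hne hγ hγπ).2 hlt)))
  exact ⟨⟨x, hx⟩, Subtype.ext hxz⟩

theorem restrict_eq_zero_iff (τ : Facet σ) (a : A σ) :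
    (restrict τ.2.le).toRingHom a = 0 ↔ ∃ b, a = form σ (facetForm τ.2) * b := by
  refine ⟨fun h => exists_eq_form_mul τ.2 (facetForm_spec τ.2) h, ?_⟩
  rintro ⟨b, rfl⟩
  change restrict τ.2.le _ = 0
  rw [map_mul, (facetForm_spec τ.2).restrict_eq_zero, zero_mul]

/-- The sections that vanish on the facets preceding and including `τ` form a projective module
if those that vanish on the preceding ones do. -/
theorem projective_insert (τ : Facet σ)
    [Module.Projective (A σ) (relFacets F.toGradedSystem σ {ρ | level q p ρ < level q p τ})]
    [Module.Projective (A τ.1)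
      (relFacets F.toGradedSystem τ.1 (visible (project q hq p τ)))] :
    Module.Projective (A σ)
      (relFacets F.toGradedSystem σ (insert τ {ρ | level q p ρ < level q p τ})) := by
  have h1 := projective_ker_of_semilinear (restrict τ.2.le).toRingHom
    (restrict_surjective τ.2.le) (facetForm_form_ne_zero τ) (restrict_eq_zero_iff τ)
    (shellRes F q hq p τ) (shellRes_surjective F q hq p τ)
  let e : LinearMap.ker (shellRes F q hq p τ) ≃ₗ[A σ]
      relFacets F.toGradedSystem σ (insert τ {ρ | level q p ρ < level q p τ}) :=
    { toFun := fun x => ⟨x.1.1, by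
        rintro ρ (rfl | hρ)
        · exact congrArg Subtype.val x.2
        · exact x.1.2 ρ hρ⟩
      map_add' := fun _ _ => rfl
      map_smul' := fun _ _ => rfl
      invFun := fun x => ⟨⟨x.1, fun ρ hρ => x.2 ρ (Or.inr hρ)⟩,
        Subtype.ext (x.2 τ (Or.inl rfl))⟩
      left_inv := fun _ => rfl
      right_inv := fun _ => rfl }
  exact Module.Projective.of_equiv e

end Shelling

/-- The sections over `σ` that vanish on the facets visible from a given point form a projective
module: the visible facets are an initial segment of a line shelling. -/
theorem projective_relFacets_visible (F : PerverseSheaf.{u, w} Δ) (σ : Cone Δ) (y : lin σ) :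
    Module.Projective (A σ) (relFacets F.toGradedSystem σ (visible y)) := by
  classical
  obtain ⟨n, hn⟩ : ∃ n, dim σ = n := ⟨_, rfl⟩
  induction n using Nat.strong_induction_on generalizing σ with
  | _ n ih =>
    obtain ⟨q, -, hq⟩ := exists_interior σ
    obtain ⟨p, hp, hpy⟩ := exists_generic q hq y
    have key : ∀ S : Finset (Facet σ),
        (∀ τ ∈ S, ∀ ρ, level q p ρ < level q p τ → ρ ∈ S) →
        Module.Projective (A σ) (relFacets F.toGradedSystem σ (S : Set (Facet σ))) := by
      intro S
      induction hm : S.card generalizing S with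
      | zero =>
        intro _
        rw [Finset.card_eq_zero.1 hm, Finset.coe_empty]
        have h1 : relFacets F.toGradedSystem σ ∅ = ⊤ := eq_top_iff.2 fun x _ τ h => h.elim
        rw [h1]
        exact Module.Projective.of_equiv Submodule.topEquiv.symm
      | succ m ihm =>
        intro hS
        obtain ⟨τ, hτ, hmax⟩ := S.exists_max_image (level q p) (Finset.card_pos.1 (by omega))
        have hmax' : ∀ ρ ∈ S, ρ ≠ τ → level q p ρ < level q p τ := fun ρ hρ hne =>
          lt_of_le_of_ne (hmax ρ hρ) fun h => hne (hp h)
        have h1 : ((S.erase τ : Finset (Facet σ)) : Set (Facet σ)) =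
            {ρ | level q p ρ < level q p τ} := by
          ext ρ
          rw [Finset.coe_erase]
          refine ⟨fun h => hmax' ρ h.1 h.2, fun h => ⟨hS τ hτ ρ h, ?_⟩⟩
          rintro rfl
          exact lt_irrefl (level q p ρ) h
        have h2 := ihm (S.erase τ) (by rw [Finset.card_erase_of_mem hτ, hm]; rfl) (by
          intro π hπ ρ hρ
          have h3 : π ∈ ((S.erase τ : Finset (Facet σ)) : Set (Facet σ)) := hπ
          rw [h1] at h3
          have h4 : ρ ∈ ((S.erase τ : Finset (Facet σ)) : Set (Facet σ)) := by
            rw [h1]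
            exact lt_trans hρ h3
          exact h4)
        rw [h1] at h2
        have h3 := ih (dim τ.1) (by have := τ.2.dim_eq; omega) τ.1 (project q hq p τ) rfl
        have h4 := projective_insert F q hq p τ
        rwa [← h1, ← Finset.coe_insert, Finset.insert_erase hτ] at h4
    have h1 : visible y = ((Finset.univ.filter fun τ : Facet σ => level q p τ < 0 :
        Finset (Facet σ)) : Set (Facet σ)) := by
      ext τ
      rw [Finset.coe_filter]
      simp only [Finset.mem_univ, true_and]
      change facetForm τ.2 y < 0 ↔ level q p τ < 0
      rw [← hpy τ, level, div_neg_iff]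
      have := hq τ
      constructor
      · exact fun h => Or.inr ⟨h, this⟩
      · rintro (h | h)
        · exact absurd h.2 this.not_gt
        · exact h.1
    rw [h1]
    refine key _ fun τ hτ ρ hρ => ?_
    rw [Finset.mem_filter] at hτ ⊢
    exact ⟨Finset.mem_univ _, hρ.trans hτ.2⟩

/-- `F_(σ,∂σ)` is projective: all facets are visible from the opposite of an interior point. -/
theorem projective_rel (F : PerverseSheaf.{u, w} Δ) (σ : Cone Δ) :
    Module.Projective (A σ) (rel F.toGradedSystem σ) := by
  obtain ⟨q, -, hq⟩ := exists_interior σ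
  have h1 := projective_relFacets_visible F σ (-q)
  have h2 : relFacets F.toGradedSystem σ (visible (-q)) = rel F.toGradedSystem σ := by
    ext x
    rw [F.isPerverse.isSheaf.mem_rel_iff]
    refine ⟨fun h τ => h τ ?_, fun h τ _ => h τ⟩
    change facetForm τ.2 (-q) < 0
    rw [map_neg, neg_lt_zero]
    exact hq τ
  rwa [h2] at h1

/-! ### Flabbiness of the dual sheaf -/

/-- In a shelling of `∂σ`, a linear form over the facet `τ` that vanishes on the facets of `τ`
shared with later facets of the shelling is the restriction of a linear form over `σ` that
vanishes on the later facets. -/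
theorem exists_homRes_eq_of_shelling (o : Orientations Δ) (F : PerverseSheaf.{u, w} Δ) {σ : Cone Δ}
    (q : lin σ) (hq : ∀ τ : Facet σ, 0 < facetForm τ.2 q) (p : lin σ) (τ : Facet σ)
    (f : rel F.toGradedSystem τ.1 →ₗ[A τ.1] A τ.1)
    (hf : ∀ γ : Facet τ.1, γ ∉ visible (project q hq p τ) → homRes o F γ.2 f = 0) :
    ∃ v : rel F.toGradedSystem σ →ₗ[A σ] A σ, homRes o F τ.2 v = f ∧
      ∀ ρ : Facet σ, level q p τ < level q p ρ → homRes o F ρ.2 v = 0 := by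
  have hF := F.isPerverse.isSheaf
  obtain ⟨ψ, hψ⟩ := exists_extend_hom (visible (project q hq p τ)) f
    fun γ hγ => (homRes_eq_zero_iff o F γ.2 f).1 (hf γ hγ)
  set S : Set (Facet σ) := {ρ | level q p ρ < level q p τ} with hS
  have hτS : τ ∉ S := lt_irrefl (level q p τ)
  have hproj : Module.Projective (A σ) (relFacets F.toGradedSystem σ S) := by
    have h1 := projective_relFacets_visible F σ (p - level q p τ • q)
    have h2 : visible (p - level q p τ • q) = S := by
      ext ρ
      change facetForm ρ.2 _ < 0 ↔ level q p ρ < level q p τ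
      rw [facetForm_sub_smul q hq, mul_neg_iff]
      have := hq ρ
      constructor
      · rintro (h | h)
        · linarith [h.2]
        · linarith [h.1]
      · exact fun h => Or.inl ⟨this, by linarith⟩
    rwa [h2] at h1
  obtain ⟨c, hc⟩ := exists_lift_semilinear (restrict τ.2.le).toRingHom
    (restrict_surjective τ.2.le) (ψ.comp (shellRes F q hq p τ))
  have hc' : ∀ x, restrict τ.2.le (c x) = ψ (shellRes F q hq p τ x) := hc
  -- on sections that vanish on `τ` as well, the lift is divisible by the form of `τ`
  let ι : relFacets F.toGradedSystem σ (insert τ S) →ₗ[A σ] relFacets F.toGradedSystem σ S :=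
    Submodule.inclusion fun x hx ρ hρ => hx ρ (Or.inr hρ)
  have hdiv : ∀ x, ∃ b, c (ι x) = form σ (normForm o τ.2) * b := fun x =>
    exists_eq_form_mul τ.2 (normForm_spec o τ.2) (by
      rw [hc']
      have : shellRes F q hq p τ (ι x) = 0 := Subtype.ext (x.2 τ (Or.inl rfl))
      rw [this, map_zero])
  choose b hb using hdiv
  have h0 : form σ (normForm o τ.2) ≠ 0 := form_ne_zero ((normForm_spec o τ.2).ne_zero τ.2)
  let v' : relFacets F.toGradedSystem σ (insert τ S) →ₗ[A σ] A σ :=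
    { toFun := b
      map_add' := fun x y => mul_left_cancel₀ h0 (by
        rw [mul_add, ← hb, ← hb, ← hb, map_add, map_add])
      map_smul' := fun a x => mul_left_cancel₀ h0 (by
        rw [RingHom.id_apply, smul_eq_mul, mul_left_comm, ← hb, ← hb, map_smul, map_smul,
          smul_eq_mul]) }
  refine ⟨v' ∘ₗ Submodule.inclusion (rel_le_relFacets _ _ _), LinearMap.ext fun g => ?_,
    fun ρ hρ => ?_⟩
  · obtain ⟨x, hx⟩ := exists_isExt F τ.2 g
    have hxS : x ∈ relFacets F.toGradedSystem σ S := fun ρ hρ =>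
      hx.res_eq_zero ρ.1 ρ.2.lt fun e => hτS (by rwa [← Subtype.ext e])
    rw [homRes_apply o F τ.2 _ g hx]
    have h1 : b ⟨form σ (normForm o τ.2) • x, rel_le_relFacets _ _ _
        (hx.smul_mem_rel (normForm_spec o τ.2))⟩ = c ⟨x, hxS⟩ := by
      refine mul_left_cancel₀ h0 ?_
      rw [← hb, ← smul_eq_mul, ← map_smul]
      rfl
    refine (congrArg (restrict τ.2.le) h1).trans ?_
    rw [hc']
    have h2 : shellRes F q hq p τ ⟨x, hxS⟩ = ⟨g.1, rel_le_relFacets _ _ _ g.2⟩ :=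
      Subtype.ext hx.res_eq
    rw [h2, hψ g.1 g.2]
  · refine phi_eq_zero_of_extend (insert τ S) (ψ := v') (fun _ _ => rfl) ?_ (normForm_spec o ρ.2)
    rintro (rfl | h)
    · exact lt_irrefl _ hρ
    · exact lt_asymm hρ h

/-- Compatible linear forms over the facets of `σ` are the restrictions of a linear form over
`σ`. -/
theorem exists_homRes_eq (o : Orientations Δ) (F : PerverseSheaf.{u, w} Δ) {σ : Cone Δ}
    (s : ∀ τ : Facet σ, rel F.toGradedSystem τ.1 →ₗ[A τ.1] A τ.1)
    (hs : ∀ (τ ρ : Facet σ) (γ : Cone Δ) (hγτ : IsFacet γ τ.1) (hγρ : IsFacet γ ρ.1),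
      homRes o F hγτ (s τ) = homRes o F hγρ (s ρ)) :
    ∃ f : rel F.toGradedSystem σ →ₗ[A σ] A σ, ∀ τ : Facet σ, homRes o F τ.2 f = s τ := by
  classical
  obtain ⟨q, -, hq⟩ := exists_interior σ
  obtain ⟨p, hp, -⟩ := exists_generic q hq 0
  -- extend over the facets in the order opposite to the shelling
  have key : ∀ U : Finset (Facet σ), (∀ τ ∈ U, ∀ ρ, level q p τ < level q p ρ → ρ ∈ U) →
      ∃ f : rel F.toGradedSystem σ →ₗ[A σ] A σ, ∀ τ ∈ U, homRes o F τ.2 f = s τ := by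
    intro U
    induction hm : U.card generalizing U with
    | zero =>
      rw [Finset.card_eq_zero.1 hm]
      exact fun _ => ⟨0, by simp⟩
    | succ m ihm =>
      intro hU
      obtain ⟨τ, hτ, hmin⟩ := U.exists_min_image (level q p) (Finset.card_pos.1 (by omega))
      have hmin' : ∀ ρ ∈ U, ρ ≠ τ → level q p τ < level q p ρ := fun ρ hρ hne =>
        lt_of_le_of_ne (hmin ρ hρ) fun h => hne (hp h).symm
      have hmem : ∀ ρ, level q p τ < level q p ρ → ρ ∈ U.erase τ := fun ρ hρ =>
        Finset.mem_erase.2 ⟨by rintro rfl; exact lt_irrefl _ hρ, hU τ hτ ρ hρ⟩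
      obtain ⟨f, hf⟩ := ihm (U.erase τ) (by rw [Finset.card_erase_of_mem hτ, hm]; rfl) (by
        intro π hπ ρ hρ
        obtain ⟨h1, h2⟩ := Finset.mem_erase.1 hπ
        exact hmem ρ ((hmin' π h2 h1).trans hρ))
      obtain ⟨v, hv, hv'⟩ := exists_homRes_eq_of_shelling o F q hq p τ (s τ - homRes o F τ.2 f) (by
        intro γ hγ
        obtain ⟨ρ, hρ, hγρ⟩ := exists_other_facet τ γ.2
        have h1 : level q p τ < level q p ρ := by
          refine lt_of_le_of_ne (not_lt.1 fun h => hγ ?_) fun h => hρ (hp h).symm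
          exact (facetForm_project_neg_iff q hq p τ ρ hρ γ.2 hγρ).2 h
        have h2 := isFacet_of_other τ ρ γ.2 hγρ
        rw [map_sub, homRes_comm o F hρ.symm γ.2 h2, hf ρ (hmem ρ h1), hs τ ρ γ.1 γ.2 h2, sub_self])
      refine ⟨f + v, fun ρ hρ => ?_⟩
      rw [map_add]
      by_cases e : ρ = τ
      · subst e
        rw [hv, add_sub_cancel]
      · rw [hv' ρ (hmin' ρ hρ e), add_zero, hf ρ (Finset.mem_erase.2 ⟨e, hρ⟩)]
  obtain ⟨f, hf⟩ := key Finset.univ fun _ _ _ _ => Finset.mem_univ _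
  exact ⟨f, fun τ => hf τ (Finset.mem_univ τ)⟩

theorem dual_isFlabby (o : Orientations Δ) (F : PerverseSheaf.{u, w} Δ) :
    IsFlabby (dual o F) := by
  refine isFlabby_of_exists_extend _ (fun σ x => dualRes_refl o F σ x) fun σ s => ?_
  choose t ht using fun τ : Facet σ =>
    exists_eq_tmul F.toGradedSystem τ.1 (vol_ne_zero o τ.1) (s.val τ.1 τ.2.lt)
  have hres : ∀ (τ : Facet σ) (γ : Cone Δ) (hγ : IsFacet γ τ.1),
      homRes o F hγ (t τ) ⊗ₜ[ℝ] vol o γ = s.val γ (hγ.lt.trans τ.2.lt) := by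
    intro τ γ hγ
    rw [← dualRes_tmul_vol, ← ht]
    exact s.compatible τ.1 γ τ.2.lt (hγ.lt.trans τ.2.lt) hγ.le
  obtain ⟨f, hf⟩ := exists_homRes_eq o F t fun τ ρ γ hγτ hγρ =>
    tmul_injective _ _ (vol_ne_zero o γ) ((hres τ γ hγτ).trans (hres ρ γ hγρ).symm)
  refine ⟨f ⊗ₜ vol o σ, fun γ hγ => ?_⟩
  obtain ⟨τ, hτ⟩ := exists_facet_ge hγ
  change dualRes o F σ γ (f ⊗ₜ vol o σ) = _
  rw [← dualRes_facet_comp o F τ.2 hτ, dualRes_tmul_vol o F τ.2, hf, ← ht]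
  exact s.compatible τ.1 γ τ.2.lt hγ hτ

end Shellability

section Grading

/-! ### The grading of the dual sheaf -/

/-- The induced grading of `F_(σ,∂σ)`. -/
def relGrade (F : GradedSystem.{u, w} Δ) (σ : Cone Δ) (i : ℤ) : AddSubgroup (rel F σ) :=
  (F.grade σ i).comap (rel F σ).toAddSubgroup.subtype

theorem relGrade_isInternal {F : GradedSystem.{u, w} Δ} (hF : IsSheaf F) (σ : Cone Δ) :
    DirectSum.IsInternal (relGrade F σ) := by
  refine isInternal_comap (hF.isInternal σ) (rel F σ).toAddSubgroup fun x hx i τ hτ => ?_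
  rw [← component_map (hF.isInternal σ) (hF.isInternal τ) (F.res hτ.le) (hF.res_mem hτ.le),
    hx τ hτ, map_zero]

variable [FiniteDimensional ℝ V]

theorem exists_relGrade_basis (F : PerverseSheaf.{u, w} Δ) (σ : Cone Δ) :
    ∃ (s : Finset (rel F.toGradedSystem σ))
      (b : Module.Basis s (A σ) (rel F.toGradedSystem σ)) (d : s → ℤ),
      ∀ k, b k ∈ relGrade F.toGradedSystem σ (d k) := by
  have := projective_rel F σ
  exact exists_homogeneous_basis (gradeA σ) SymmetricAlgebra.algebraMapInv
    (fun i hi a ha => algebraMapInv_eq_zero hi ha) (fun a ha => exists_algebraMap_eq ha)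
    (relGrade_isInternal F.isPerverse.isSheaf σ)
    fun i j a x ha hx => F.isPerverse.isSheaf.smul_mem σ i j a x.1 ha hx

instance (F : PerverseSheaf.{u, w} Δ) (σ : Cone Δ) :
    Module.Free (A σ) (rel F.toGradedSystem σ) := by
  obtain ⟨s, b, d, -⟩ := exists_relGrade_basis F σ
  exact Module.Free.of_basis b

theorem homGrade_rel_isInternal (F : PerverseSheaf.{u, w} Δ) (σ : Cone Δ) :
    DirectSum.IsInternal (homGrade (gradeA σ) (relGrade F.toGradedSystem σ)) := by
  obtain ⟨s, b, d, hb⟩ := exists_relGrade_basis F σ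
  exact homGrade_isInternal (gradeA σ) (relGrade_isInternal F.isPerverse.isSheaf σ)
    (fun i j a x ha hx => F.isPerverse.isSheaf.smul_mem σ i j a x.1 ha hx) b d hb

/-- The degree of `f ⊗ ω` in the dual sheaf is the degree of `f` shifted by `2 dim σ`. -/
theorem tmul_mem_dualGrade_iff (F : GradedSystem.{u, w} Δ) (σ : Cone Δ) {ω : Det σ} (hω : ω ≠ 0)
    (q : ℤ) (f : rel F σ →ₗ[A σ] A σ) :
    f ⊗ₜ[ℝ] ω ∈ dualGrade F σ q ↔
      f ∈ homGrade (gradeA σ) (relGrade F σ) (q - 2 * (dim σ : ℤ)) := by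
  constructor
  · intro h
    have key : ∀ z ∈ dualGrade F σ q, (tmulEquiv F σ ω hω).symm z ∈
        homGrade (gradeA σ) (relGrade F σ) (q - 2 * (dim σ : ℤ)) := by
      intro z hz
      induction hz using AddSubgroup.closure_induction with
      | mem z hz =>
        obtain ⟨g, η, hg, rfl⟩ := hz
        obtain ⟨r, rfl⟩ := exists_smul_eq hω η
        have h1 : (tmulEquiv F σ ω hω).symm (g ⊗ₜ[ℝ] (r • ω)) = r • g := by
          rw [LinearEquiv.symm_apply_eq, tmulEquiv_apply, TensorProduct.smul_tmul]
        rw [h1]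
        exact fun i x hx => Submodule.smul_mem _ r (hg i x hx)
      | zero => rw [map_zero]; exact AddSubgroup.zero_mem _
      | add x y _ _ hx hy => rw [map_add]; exact AddSubgroup.add_mem _ hx hy
      | neg x _ hx => rw [map_neg]; exact AddSubgroup.neg_mem _ hx
    have h1 := key _ h
    rwa [← tmulEquiv_apply F σ hω, LinearEquiv.symm_apply_apply] at h1
  · exact fun h => AddSubgroup.subset_closure ⟨f, ω, h, rfl⟩

theorem homRes_mem_homGrade (o : Orientations Δ) (F : PerverseSheaf.{u, w} Δ) {τ σ : Cone Δ}
    (hf : IsFacet τ σ) {q : ℤ} {f : rel F.toGradedSystem σ →ₗ[A σ] A σ}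
    (h : f ∈ homGrade (gradeA σ) (relGrade F.toGradedSystem σ) q) :
    homRes o F hf f ∈ homGrade (gradeA τ) (relGrade F.toGradedSystem τ) (q + 2) := by
  intro i g hg
  have hF := F.isPerverse.isSheaf
  obtain ⟨x, hx⟩ := exists_isExt F hf g
  -- the extension can be chosen homogeneous
  have hres : ∀ (γ : Cone Δ) (h : γ ≤ σ), F.res h (component (hF.isInternal σ) i x) =
      component (hF.isInternal γ) i (F.res h x) := fun γ h =>
    (component_map (hF.isInternal σ) (hF.isInternal γ) (F.res h) (hF.res_mem h) i x).symm
  have hx' : IsExt F.toGradedSystem hf g.1 (component (hF.isInternal σ) i x) :=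
    ⟨by rw [hres, hx.res_eq]; exact component_of_mem _ hg,
      fun γ h hne => by rw [hres, hx.res_eq_zero γ h hne, map_zero]⟩
  rw [homRes_apply o F hf f g hx', show i + (q + 2) = 2 + i + q by ring]
  refine restrict_mem_gradeA hf.le (h (2 + i) _ ?_)
  exact hF.smul_mem σ 2 i _ _ (form_mem_gradeA σ _) (component_mem _ i x)

theorem dualRes_mem_dualGrade (o : Orientations Δ) (F : PerverseSheaf.{u, w} Δ) {τ σ : Cone Δ}
    (h : τ ≤ σ) (q : ℤ) {z : DualObj F.toGradedSystem σ}
    (hz : z ∈ dualGrade F.toGradedSystem σ q) :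
    dualRes o F σ τ z ∈ dualGrade F.toGradedSystem τ q := by
  obtain ⟨c⟩ := exists_facetChain h
  induction c with
  | nil σ => rwa [dualRes_refl]
  | @cons σ ρ τ hf c ih =>
    rw [← dualRes_facet_comp o F hf c.le]
    refine ih c.le ?_
    obtain ⟨f, rfl⟩ := exists_eq_tmul _ _ (vol_ne_zero o σ) z
    rw [dualRes_tmul_vol o F hf, tmul_mem_dualGrade_iff _ _ (vol_ne_zero o ρ)]
    rw [tmul_mem_dualGrade_iff _ _ (vol_ne_zero o σ)] at hz
    have h1 := homRes_mem_homGrade o F hf hz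
    rwa [show q - 2 * (dim σ : ℤ) + 2 = q - 2 * (dim ρ : ℤ) by rw [← hf.dim_eq]; push_cast; ring]
      at h1

theorem dual_isSheaf (o : Orientations Δ) (F : PerverseSheaf.{u, w} Δ) : IsSheaf (dual o F) where
  isInternal σ := by
    refine isInternal_of_equiv (homGrade_rel_isInternal F σ)
      (tmulEquiv F.toGradedSystem σ (vol o σ) (vol_ne_zero o σ)).toAddEquiv (2 * (dim σ : ℤ))
      fun i y => ?_
    obtain ⟨f, rfl⟩ := (tmulEquiv F.toGradedSystem σ (vol o σ) (vol_ne_zero o σ)).surjective y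
    refine (tmul_mem_dualGrade_iff _ _ (vol_ne_zero o σ) _ f).trans ?_
    rw [add_sub_cancel_right]
    change _ ↔ (tmulEquiv F.toGradedSystem σ (vol o σ) (vol_ne_zero o σ)).symm _ ∈ _
    rw [LinearEquiv.symm_apply_apply]
  smul_mem σ i j a z ha hz := by
    obtain ⟨f, rfl⟩ := exists_eq_tmul F.toGradedSystem σ (vol_ne_zero o σ) z
    have h1 := (tmul_mem_dualGrade_iff _ _ (vol_ne_zero o σ) _ f).1 hz
    refine (tmul_mem_dualGrade_iff _ _ (vol_ne_zero o σ) _ (a • f)).2 fun k x hx => ?_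
    have h2 := SetLike.mul_mem_graded ha (h1 k x hx)
    rwa [show i + (k + (j - 2 * (dim σ : ℤ))) = k + (i + j - 2 * (dim σ : ℤ)) by ring] at h2
  res_mem h i x hx := dualRes_mem_dualGrade o F h i hx
  res_refl σ x := dualRes_refl o F σ x
  res_comp h h' x := dualRes_comp o F h h' x

/-- The dual of a perverse sheaf is perverse. -/
theorem dual_isPerverse (o : Orientations Δ) (F : PerverseSheaf.{u, w} Δ) :
    IsPerverse (dual o F) where
  isSheaf := dual_isSheaf o F
  isFlabby := dual_isFlabby o F
  finite σ := Module.Finite.equiv (tmulEquiv F.toGradedSystem σ (vol o σ) (vol_ne_zero o σ))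
  free σ := Module.Free.of_equiv (tmulEquiv F.toGradedSystem σ (vol o σ) (vol_ne_zero o σ))

end Grading

section Biduality

variable [FiniteDimensional ℝ V]

/-! ### Biduality -/

theorem tmul_vol_mem_rel_iff (o : Orientations Δ) (F : PerverseSheaf.{u, w} Δ) (σ : Cone Δ)
    (f : rel F.toGradedSystem σ →ₗ[A σ] A σ) :
    (show (dual o F).obj σ from f ⊗ₜ[ℝ] vol o σ) ∈ rel (dual o F) σ ↔
      ∀ τ : Facet σ, homRes o F τ.2 f = 0 := by
  refine (dual_isSheaf o F).mem_rel_iff.trans (forall_congr' fun τ => ?_)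
  change dualRes o F σ τ.1 (f ⊗ₜ[ℝ] vol o σ) = 0 ↔ _
  rw [dualRes_tmul_vol o F τ.2]
  refine ⟨fun h => tmul_injective _ _ (vol_ne_zero o τ.1) ?_, fun h => ?_⟩
  · rw [h, TensorProduct.zero_tmul]
  · rw [h, TensorProduct.zero_tmul]

theorem comp_subtype_tmul_mem_rel (o : Orientations Δ) (F : PerverseSheaf.{u, w} Δ) (σ : Cone Δ)
    (ω : Det σ) (ψ : Module.Dual (A σ) (F.obj σ)) :
    (show (dual o F).obj σ from (ψ ∘ₗ (rel F.toGradedSystem σ).subtype) ⊗ₜ[ℝ] ω) ∈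
      rel (dual o F) σ := by
  obtain ⟨r, rfl⟩ := exists_smul_eq (vol_ne_zero o σ) ω
  have h : (ψ ∘ₗ (rel F.toGradedSystem σ).subtype) ⊗ₜ[ℝ] (r • vol o σ) =
      (((algebraMap ℝ (A σ) r • ψ) ∘ₗ (rel F.toGradedSystem σ).subtype) ⊗ₜ[ℝ] vol o σ) := by
    rw [← TensorProduct.smul_tmul, LinearMap.smul_comp, algebraMap_smul]
  rw [h]
  refine (tmul_vol_mem_rel_iff o F σ _).2 fun τ => ?_
  rw [homRes_eq_zero_iff]
  exact phi_comp_subtype F _ τ _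

/-- The map `Hom (F_σ, A_σ) → (DF)_(σ,∂σ)` that restricts a linear form to `F_(σ,∂σ)`. -/
def dualRelMap (o : Orientations Δ) (F : PerverseSheaf.{u, w} Δ) (σ : Cone Δ) (ω : Det σ) :
    Module.Dual (A σ) (F.obj σ) →ₗ[A σ] rel (dual o F) σ where
  toFun ψ := ⟨(ψ ∘ₗ (rel F.toGradedSystem σ).subtype) ⊗ₜ[ℝ] ω,
    comp_subtype_tmul_mem_rel o F σ ω ψ⟩
  map_add' ψ ψ' := Subtype.ext (TensorProduct.add_tmul (ψ ∘ₗ (rel F.toGradedSystem σ).subtype)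
    (ψ' ∘ₗ (rel F.toGradedSystem σ).subtype) ω)
  map_smul' _ _ := rfl

/-- The isomorphism `Hom (F_σ, A_σ) ≃ (DF)_(σ,∂σ)` that restricts a linear form to `F_(σ,∂σ)`. -/
def dualRelEquiv (o : Orientations Δ) (F : PerverseSheaf.{u, w} Δ) (σ : Cone Δ) (ω : Det σ)
    (hω : ω ≠ 0) : Module.Dual (A σ) (F.obj σ) ≃ₗ[A σ] rel (dual o F) σ :=
  LinearEquiv.ofBijective (dualRelMap o F σ ω)
    (by
      refine ⟨fun ψ ψ' h => comp_subtype_injective F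
        (tmul_injective F.toGradedSystem σ hω (congrArg Subtype.val h)), fun y => ?_⟩
      obtain ⟨f, hf⟩ := exists_eq_tmul F.toGradedSystem σ hω y.1
      obtain ⟨r, hr⟩ := exists_smul_eq (vol_ne_zero o σ) ω
      have hr0 : r ≠ 0 := fun h0 => hω (by rw [hr, h0, zero_smul])
      have hy : (show (dual o F).obj σ from (r • f) ⊗ₜ[ℝ] vol o σ) ∈ rel (dual o F) σ := by
        have h1 := y.2
        rw [hf, hr, ← TensorProduct.smul_tmul] at h1
        exact h1
      obtain ⟨ψ, hψ⟩ := exists_extend_hom_univ F f fun τ => by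
        have h1 := (tmul_vol_mem_rel_iff o F σ _).1 hy τ
        rw [map_smul] at h1
        rw [← homRes_eq_zero_iff o, ← inv_smul_smul₀ hr0 (homRes o F τ.2 f), h1, smul_zero]
      exact ⟨ψ, Subtype.ext ((congrArg (· ⊗ₜ[ℝ] ω) hψ).trans hf.symm)⟩)

theorem dualRelEquiv_apply (o : Orientations Δ) (F : PerverseSheaf.{u, w} Δ) (σ : Cone Δ)
    {ω : Det σ} (hω : ω ≠ 0) (ψ : Module.Dual (A σ) (F.obj σ)) :
    (dualRelEquiv o F σ ω hω ψ).1 = (ψ ∘ₗ (rel F.toGradedSystem σ).subtype) ⊗ₜ[ℝ] ω := rfl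

/-- The biduality map of the free module `F_σ`. -/
def bidualEquiv (o : Orientations Δ) (F : PerverseSheaf.{u, w} Δ) (σ : Cone Δ) :
    F.obj σ ≃ₗ[A σ] DualObj (dual o F) σ :=
  (Module.evalEquiv (A σ) (F.obj σ)).trans
    ((dualRelEquiv o F σ (vol o σ) (vol_ne_zero o σ)).symm.dualMap.trans
      (tmulEquiv (dual o F) σ (vol o σ) (vol_ne_zero o σ)))

/-- The biduality map does not depend on the determinant form used to express it. -/
theorem bidualEquiv_apply (o : Orientations Δ) (F : PerverseSheaf.{u, w} Δ) (σ : Cone Δ)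
    {ω : Det σ} (hω : ω ≠ 0) (x : F.obj σ) :
    bidualEquiv o F σ x = (Module.Dual.eval (A σ) (F.obj σ) x ∘ₗ
      (dualRelEquiv o F σ ω hω).symm.toLinearMap) ⊗ₜ[ℝ] ω := by
  have h0 : bidualEquiv o F σ x = (Module.Dual.eval (A σ) (F.obj σ) x ∘ₗ
      (dualRelEquiv o F σ _ (vol_ne_zero o σ)).symm.toLinearMap) ⊗ₜ[ℝ] vol o σ := rfl
  obtain ⟨r, hr⟩ := exists_smul_eq (vol_ne_zero o σ) ω
  rw [h0]
  refine Eq.trans ?_ (congrArg (_ ⊗ₜ[ℝ] ·) hr.symm)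
  refine Eq.trans (congrArg (· ⊗ₜ[ℝ] _) (LinearMap.ext fun y => ?_))
    (TensorProduct.smul_tmul r _ (vol o σ))
  obtain ⟨ψ, rfl⟩ := (dualRelEquiv o F σ ω hω).surjective y
  have h1 : dualRelEquiv o F σ ω hω ψ =
      dualRelEquiv o F σ _ (vol_ne_zero o σ) (algebraMap ℝ (A σ) r • ψ) := by
    refine Subtype.ext ?_
    rw [dualRelEquiv_apply, dualRelEquiv_apply, LinearMap.smul_comp, algebraMap_smul,
      TensorProduct.smul_tmul, ← hr]
  change ((dualRelEquiv o F σ _ (vol_ne_zero o σ)).symm (dualRelEquiv o F σ ω hω ψ)) x =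
    r • (((dualRelEquiv o F σ ω hω).symm (dualRelEquiv o F σ ω hω ψ)) x)
  rw [LinearEquiv.symm_apply_apply, h1, LinearEquiv.symm_apply_apply, LinearMap.smul_apply,
    algebraMap_smul]

/-- A linear form on `F_σ` is homogeneous if its restriction to `F_(σ,∂σ)` is: multiply by the
product of the equations of the facets. -/
theorem mem_homGrade_of_comp_subtype (F : PerverseSheaf.{u, w} Δ) {σ : Cone Δ} {q : ℤ}
    {ψ : Module.Dual (A σ) (F.obj σ)}
    (h : ψ ∘ₗ (rel F.toGradedSystem σ).subtype ∈
      homGrade (gradeA σ) (relGrade F.toGradedSystem σ) q) :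
    ψ ∈ homGrade (gradeA σ) (F.grade σ) q := by
  intro i x hx
  obtain ⟨k, hk⟩ := cofacetProd_mem (σ := σ) ∅
  have hx' : x ∈ relFacets F.toGradedSystem σ ∅ := fun τ h => (Set.notMem_empty τ h).elim
  have h1 := h (k + i) ⟨_, cofacetProd_smul_mem_rel hx'⟩
    (F.isPerverse.isSheaf.smul_mem σ k i _ _ hk hx)
  change ψ (cofacetProd (σ := σ) ∅ • x) ∈ _ at h1
  rw [map_smul, smul_eq_mul, add_assoc] at h1
  exact mem_gradeA_of_mul_mem hk (cofacetProd_ne_zero _) h1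

theorem bidualEquiv_mem (o : Orientations Δ) (F : PerverseSheaf.{u, w} Δ) (σ : Cone Δ) (i : ℤ)
    (x : F.obj σ) (hx : x ∈ F.grade σ i) : bidualEquiv o F σ x ∈ dualGrade (dual o F) σ i := by
  rw [bidualEquiv_apply o F σ (vol_ne_zero o σ),
    tmul_mem_dualGrade_iff _ _ (vol_ne_zero o σ)]
  intro j y hy
  obtain ⟨ψ, rfl⟩ := (dualRelEquiv o F σ _ (vol_ne_zero o σ)).surjective y
  change (((dualRelEquiv o F σ _ (vol_ne_zero o σ)).symm
    (dualRelEquiv o F σ _ (vol_ne_zero o σ) ψ)) x) ∈ _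
  rw [LinearEquiv.symm_apply_apply]
  have h1 := (tmul_mem_dualGrade_iff F.toGradedSystem σ (vol_ne_zero o σ) j
    (ψ ∘ₗ (rel F.toGradedSystem σ).subtype)).1 hy
  have h2 := mem_homGrade_of_comp_subtype F h1 i x hx
  rwa [show i + (j - 2 * (dim σ : ℤ)) = j + (i - 2 * (dim σ : ℤ)) by ring] at h2

/-- If the normalized form `n` of the facet `τ` times `f` extends to a linear form `Ψ` on `F_σ`,
and the restriction of `f` to `τ` extends to a linear form `ψ` on `F_τ`, then `Ψ` restricts to `ψ`.
After multiplication by the product of the equations of the other facets this is the definition of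
the restriction of `f`. -/
theorem restrict_apply_eq (o : Orientations Δ) (F : PerverseSheaf.{u, w} Δ) {σ : Cone Δ}
    (τ : Facet σ) {f : rel F.toGradedSystem σ →ₗ[A σ] A σ} {Ψ : Module.Dual (A σ) (F.obj σ)}
    {ψ : Module.Dual (A τ.1) (F.obj τ.1)}
    (hΨ : Ψ ∘ₗ (rel F.toGradedSystem σ).subtype = form σ (normForm o τ.2) • f)
    (hψ : ψ ∘ₗ (rel F.toGradedSystem τ.1).subtype = homRes o F τ.2 f) (x : F.obj σ) :
    restrict τ.2.le (Ψ x) = ψ (F.res τ.2.le x) := by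
  refine mul_left_cancel₀ (restrict_cofacetProd_ne_zero τ) ?_
  have hF := F.isPerverse.isSheaf
  have hH : ∀ ρ : Facet σ, ρ ≠ τ → F.res ρ.2.le (cofacetProd {τ} • x) = 0 := fun ρ hρ => by
    rw [F.res_smul, restrict_cofacetProd _ (by simpa using hρ), zero_smul]
  obtain ⟨h1, h2⟩ := hF.isExt_of_forall_ne τ hH
  have h3 := homRes_apply o F τ.2 f ⟨_, h1⟩ h2
  have h4 : Ψ (cofacetProd {τ} • x) =
      f ⟨_, h2.smul_mem_rel (normForm_spec o τ.2)⟩ := by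
    refine mul_left_cancel₀ (form_ne_zero ((normForm_spec o τ.2).ne_zero τ.2)) ?_
    have h5 := DFunLike.congr_fun hΨ ⟨_, h2.smul_mem_rel (normForm_spec o τ.2)⟩
    rw [← smul_eq_mul, ← map_smul, ← smul_eq_mul]
    exact h5
  rw [← h4, ← hψ] at h3
  change ψ (F.res τ.2.le (cofacetProd {τ} • x)) = _ at h3
  rw [F.res_smul, map_smul, map_smul, smul_eq_mul, smul_eq_mul, map_mul] at h3
  exact h3.symm

theorem bidualEquiv_res_facet (o : Orientations Δ) (F : PerverseSheaf.{u, w} Δ) {σ : Cone Δ}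
    (τ : Facet σ) (x : F.obj σ) :
    dualRes o (dualSheaf o F (dual_isPerverse o F)) σ τ.1 (bidualEquiv o F σ x) =
      bidualEquiv o F τ.1 (F.res τ.2.le x) := by
  rw [bidualEquiv_apply o F σ (vol_ne_zero o σ), bidualEquiv_apply o F τ.1 (vol_ne_zero o τ.1)]
  refine (dualRes_tmul_vol o (dualSheaf o F (dual_isPerverse o F)) τ.2 _).trans ?_
  refine congrArg (· ⊗ₜ[ℝ] vol o τ.1) (LinearMap.ext fun y => ?_)
  obtain ⟨z, hz⟩ := exists_isExt (dualSheaf o F (dual_isPerverse o F)) τ.2 y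
  refine (homRes_apply o (dualSheaf o F (dual_isPerverse o F)) τ.2 _ y hz).trans ?_
  obtain ⟨f, rfl⟩ := exists_eq_tmul F.toGradedSystem σ (vol_ne_zero o σ) z
  -- the preimages of `n z` and `y` under the identifications of `(DF)_(σ,∂σ)` and `(DF)_(τ,∂τ)`
  -- with linear forms on `F_σ` and `F_τ` extend `n f` and the restriction of `f`
  refine restrict_apply_eq o F τ (f := f) ?_ ?_ x
  · refine tmul_injective F.toGradedSystem σ (vol_ne_zero o σ) ?_
    rw [← dualRelEquiv_apply o F σ (vol_ne_zero o σ)]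
    change ((dualRelEquiv o F σ _ (vol_ne_zero o σ)) ((dualRelEquiv o F σ _
      (vol_ne_zero o σ)).symm _)).1 = _
    rw [LinearEquiv.apply_symm_apply]
    rfl
  · refine tmul_injective F.toGradedSystem τ.1 (vol_ne_zero o τ.1) ?_
    rw [← dualRelEquiv_apply o F τ.1 (vol_ne_zero o τ.1)]
    change ((dualRelEquiv o F τ.1 _ (vol_ne_zero o τ.1)) ((dualRelEquiv o F τ.1 _
      (vol_ne_zero o τ.1)).symm y)).1 = _
    rw [LinearEquiv.apply_symm_apply, ← dualRes_tmul_vol]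
    exact hz.res_eq.symm

theorem bidualEquiv_res (o : Orientations Δ) (F : PerverseSheaf.{u, w} Δ) {σ τ : Cone Δ}
    (h : τ ≤ σ) (x : F.obj σ) :
    bidualEquiv o F τ (F.res h x) =
      dualRes o (dualSheaf o F (dual_isPerverse o F)) σ τ (bidualEquiv o F σ x) := by
  obtain ⟨c⟩ := exists_facetChain h
  induction c with
  | nil σ =>
    rw [F.isPerverse.isSheaf.res_refl]
    exact (dualRes_refl o (dualSheaf o F (dual_isPerverse o F)) σ _).symm
  | @cons σ ρ τ hf c ih =>
    rw [← F.isPerverse.isSheaf.res_comp hf.le c.le, ih c.le,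
      ← bidualEquiv_res_facet o F ⟨ρ, hf⟩]
    exact dualRes_facet_comp o (dualSheaf o F (dual_isPerverse o F)) hf c.le _

/-- The biduality isomorphism `F ≃ D (D F)`. -/
def bidualIso (o : Orientations Δ) (F : PerverseSheaf.{u, w} Δ) :
    Iso F.toGradedSystem (dual o (dualSheaf o F (dual_isPerverse o F))) where
  hom :=
    { app := fun σ => (bidualEquiv o F σ).toLinearMap
      app_mem := fun σ i x hx => bidualEquiv_mem o F σ i x hx
      app_res := fun h x => bidualEquiv_res o F h x }
  inv :=
    { app := fun σ => (bidualEquiv o F σ).symm.toLinearMap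
      app_mem := fun σ i y hy => mem_of_injective (F.isPerverse.isSheaf.isInternal σ)
        ((dual_isSheaf o (dualSheaf o F (dual_isPerverse o F))).isInternal σ)
        (bidualEquiv o F σ).toAddEquiv.toAddMonoidHom
        (fun i x hx => bidualEquiv_mem o F σ i x hx) (bidualEquiv o F σ).injective
        (by
          change bidualEquiv o F σ ((bidualEquiv o F σ).symm y) ∈ _
          exact (congrArg (· ∈ _) ((bidualEquiv o F σ).apply_symm_apply y)).mpr hy)
      app_res := fun {σ τ} h y => by
        refine (LinearEquiv.symm_apply_eq _).2 ((congrArg _ ?_).trans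
          (bidualEquiv_res o F h ((bidualEquiv o F σ).symm y)).symm)
        exact ((bidualEquiv o F σ).apply_symm_apply y).symm }
  inv_hom σ x := (bidualEquiv o F σ).symm_apply_apply x
  hom_inv σ y := (bidualEquiv o F σ).apply_symm_apply y

theorem bidualEquiv_naturality (o : Orientations Δ) {F G : PerverseSheaf.{u, w} Δ}
    (φ : Hom F.toGradedSystem G.toGradedSystem) (σ : Cone Δ) (x : F.obj σ) :
    dualMapApp (dualMap φ o) σ (bidualEquiv o F σ x) = bidualEquiv o G σ (φ.app σ x) := by
  rw [bidualEquiv_apply o F σ (vol_ne_zero o σ), bidualEquiv_apply o G σ (vol_ne_zero o σ),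
    dualMapApp_tmul]
  refine congrArg (· ⊗ₜ[ℝ] vol o σ) (LinearMap.ext fun y => ?_)
  obtain ⟨ψ, rfl⟩ := (dualRelEquiv o G σ _ (vol_ne_zero o σ)).surjective y
  have h1 : (dualMap φ o).relMap σ (dualRelEquiv o G σ _ (vol_ne_zero o σ) ψ) =
      dualRelEquiv o F σ _ (vol_ne_zero o σ) (ψ ∘ₗ φ.app σ) := rfl
  change ((dualRelEquiv o F σ _ (vol_ne_zero o σ)).symm ((dualMap φ o).relMap σ _)) x =
    ((dualRelEquiv o G σ _ (vol_ne_zero o σ)).symm _) (φ.app σ x)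
  rw [h1, LinearEquiv.symm_apply_apply, LinearEquiv.symm_apply_apply]
  rfl

end Biduality

end FanSheaf

end


open FanSheaf

theorem mainTheorem4 {V : Type u} [AddCommGroup V] [Module ℝ V] [FiniteDimensional ℝ V]
    (Δ : Fan V) (o : Orientations Δ) :
    -- the dual of a perverse sheaf is perverse, so that `D (D F)` makes sense
    ∃ hD : ∀ F : PerverseSheaf.{u, w} Δ, IsPerverse (dual o F),
    ∃ β : ∀ F : PerverseSheaf.{u, w} Δ,
      Iso F.toGradedSystem (dual o (dualSheaf o F (hD F))),
      -- naturality
      (∀ (F G : PerverseSheaf.{u, w} Δ) (φ : Hom F.toGradedSystem G.toGradedSystem)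
        (σ : Cone Δ) (x : F.obj σ),
        (dualMap (F := dualSheaf o G (hD G)) (G := dualSheaf o F (hD F))
          (dualMap φ o) o).app σ ((β F).hom.app σ x) = (β G).hom.app σ (φ.app σ x)) ∧
      -- on each cone: `(DF)_(σ,∂σ)` is identified by restriction with `Hom (F_σ, A_σ) ⊗ det V_σ^*`,
      -- and under this identification `β` is the biduality map of the module `F_σ`
      (∀ (F : PerverseSheaf.{u, w} Δ) (σ : Cone Δ) (ω : Det σ), ω ≠ 0 →
        ∃ e : Module.Dual (A σ) (F.obj σ) ≃ₗ[A σ] rel (dual o F) σ,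
          (∀ ψ : Module.Dual (A σ) (F.obj σ),
            (e ψ).1 = (ψ ∘ₗ (rel F.toGradedSystem σ).subtype) ⊗ₜ[ℝ] ω) ∧
          ∀ x : F.obj σ, (β F).hom.app σ x =
            (Module.Dual.eval (A σ) (F.obj σ) x ∘ₗ e.symm.toLinearMap) ⊗ₜ[ℝ] ω) :=
  ⟨fun F => dual_isPerverse o F, fun F => bidualIso o F,
    fun _ _ φ σ x => bidualEquiv_naturality o φ σ x,
    fun F σ ω hω => ⟨dualRelEquiv o F σ ω hω, fun ψ => dualRelEquiv_apply o F σ hω ψ,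
      fun x => bidualEquiv_apply o F σ hω x⟩⟩
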